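/- **Setting.** Consider the lattice $\mathbb Z^4$ with its oriented edges and plaquettes, where every edge $e$ and plaquette $p$ occurs with both orientations ($-e$, $-p$), and let $B_N=[-N,N]^4\cap\mathbb Z^4$; a cell is in $B_N$ if all its corners are. Let $G=\mathbb Z_2$ and $\rho(0)=1$, $\rho(1)=-1$. A $1$-form $\sigma\in\Omega^1(B_N,G)$ is a $G$-valued function on the oriented edges $C_1(B_N)$ with $\sigma(-e)=-\sigma(e)$, a $0$-form $\phi\in\Omega^0(B_N,G)$ is a $G$-valued function on the vertices of $B_N$; both are extended linearly to integer chains, and $d\sigma(p)=\sigma(\partial p)$. For $\beta,\kappa\ge 0$ the fixed length lattice Higgs model is the probability measure on $\Omega^1(B_N,G)\times\Omega^0(B_N,G)$ proportional to $$\exp\Bigl(\beta\sum_{p\in C_2(B_N)}\rho(d\sigma(p))+\kappa\sum_{e\in C_1(B_N)}\rho\bigl(\sigma(e)-\phi(\partial e)\bigr)\Bigr),$$ the sums being over oriented plaquettes $C_2(B_N)$ and oriented edges $C_1(B_N)$ of $B_N$. For $\beta=\infty$ it is the probability measure on pairs with $d\sigma=0$ proportional to $\exp(\kappa\sum_{e\in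 C_1(B_N)}\rho(\sigma(e)-\phi(\partial e)))$. Write $\langle f\rangle_{\beta,\kappa,\infty}$ for the limit as $N\to\infty$ of the expectation of $f$ under this measure, $\beta\in[0,\infty]$. A *path* is an integer $1$-chain $\gamma$ with finite support and coefficients in $\{-1,0,1\}$ such that either $\partial\gamma=0$ or $\partial\gamma=x_2-x_1$ for some vertices $x_1,x_2$. Write $|\operatorname{supp}\gamma|$ for the number of positively oriented edges with non-zero coefficient in $\gamma$, and $L_\gamma(\sigma,\phi)=\rho(\sigma(\gamma)-\phi(\partial\gamma))$. **Theorem.** There are a non-negative function $\mathbf K''=\mathbf K''(\kappa,\beta,\ell_1,\ell_2,\gamma)$ and a function $o_\kappa(1)$ of $\kappa$ alone, which tends to $0$ as $\kappa\to\infty$, such that the following holds. Let $\beta,\kappa\ge 0$ satisfy $18^2e^{-4\kappa}(2+e^{-4\kappa})<1$ and $6\beta>\kappa$, let $\gamma$ be a path along the boundary of an axis-parallel rectangle with integer side lengths $\ell_1,\ell_2\ge 8$, with $|\operatorname{supp}\gamma|\ge 24$, and let $e\in C_1(\mathbb Z^4)$ be an arbitrary oriented edge. Then the infinite volume limits $\langle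 L_\gamma\rangle_{\beta,\kappa,\infty}$, $\langle L_\gamma\rangle_{\infty,\kappa,\infty}$ and $\langle L_e\rangle_{\infty,\kappa,\infty}$ exist, and $$\Bigl|\langle L_\gamma(\sigma,\phi)\rangle_{\beta,\kappa,\infty}-\Theta'_{\beta,\kappa}(\gamma)H_\kappa(\gamma)\Bigr|\le\mathbf K''\Bigl(e^{-4(\beta+\kappa/6)}+|\operatorname{supp}\gamma|^{-1/2}\Bigr)^{1/4},$$ where $$\Theta'_{\beta,\kappa}(\gamma)=\exp\Bigl(-2|\operatorname{supp}\gamma|\,e^{-24\beta-4\kappa}\Bigl(1+(e^{8\kappa}-1)\,\tfrac{1-\langle L_e(\sigma,\phi)\rangle_{\infty,\kappa,\infty}}{2}\Bigr)\Bigr),\qquad H_\kappa(\gamma)=\langle L_\gamma(\sigma,\phi)\rangle_{\infty,\kappa,\infty},$$ and $$\mathbf K''\le 2\cdot 18^3+|\operatorname{supp}\gamma|^{1/2}\bigl(18^2e^{-4\kappa}(2+e^{-4\kappa})\bigr)^{\min(\ell_1,\ell_2)}+o_\kappa(1).$$ -/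

import Mathlib

open Filter Topology

noncomputable section

namespace LatticeHiggs

/-! ### The cell complex of `ℤ⁴` -/

abbrev Vertex := Fin 4 → ℤ

/-- The `i`-th unit vector. -/
def unit (i : Fin 4) : Vertex := Pi.single i 1

/-- Positively oriented edges: `(a, i)` is the edge from `a` to `a + unit i`. An oriented edge is
a positively oriented edge together with a sign in `ℤˣ`. -/
abbrev PosEdge := Vertex × Fin 4

/-- Positively oriented plaquettes: `(a, (i, j))` with `i < j` is the plaquette with corners
`a`, `a + unit i`, `a + unit j`, `a + unit i + unit j`. -/
abbrev PosPlaquette := Vertex × {q : Fin 4 × Fin 4 // q.1 < q.2}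

/-- Integer `0`-chains and `1`-chains: finite formal sums of positively oriented cells. -/
abbrev Chain0 := Vertex →₀ ℤ
abbrev Chain1 := PosEdge →₀ ℤ

/-- The boundary `(a + unit i) - a` of the edge `(a, i)`. -/
def edgeBoundary (e : PosEdge) : Chain0 :=
  Finsupp.single (e.1 + unit e.2) 1 - Finsupp.single e.1 1

/-- The boundary of a `1`-chain. -/
def boundary (q : Chain1) : Chain0 := q.sum fun e c => c • edgeBoundary e

/-- The oriented boundary of a plaquette. -/
def plaquetteBoundary (p : PosPlaquette) : Chain1 :=
  let a := p.1
  let i := p.2.1.1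
  let j := p.2.1.2
  Finsupp.single (a, i) 1 + Finsupp.single (a + unit i, j) 1
    - Finsupp.single (a + unit j, i) 1 - Finsupp.single (a, j) 1

/-! ### The box `B_N = [-N, N]⁴ ∩ ℤ⁴` and its cells (all corners in the box) -/

def box (N : ℕ) : Finset Vertex := Finset.Icc (fun _ => -(N : ℤ)) (fun _ => (N : ℤ))

def boxEdges (N : ℕ) : Finset PosEdge :=
  (box N ×ˢ Finset.univ).filter fun e => e.1 + unit e.2 ∈ box N

def boxPlaquettes (N : ℕ) : Finset PosPlaquette :=
  (box N ×ˢ Finset.univ).filter fun p =>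
    p.1 + unit p.2.1.1 ∈ box N ∧ p.1 + unit p.2.1.2 ∈ box N ∧
      p.1 + unit p.2.1.1 + unit p.2.1.2 ∈ box N

/-! ### Discrete forms with values in `ℤ/2`, given by their values on positively oriented cells -/

/-- Higgs field configurations on the box. -/
abbrev Form0 (N : ℕ) := {x : Vertex // x ∈ box N} → ZMod 2

/-- Gauge field configurations on the box. -/
abbrev Form1 (N : ℕ) := {e : PosEdge // e ∈ boxEdges N} → ZMod 2

/-- `φ(q)` for a `0`-chain `q` (cells outside the box contribute `0`). -/
def Form0.eval {N : ℕ} (φ : Form0 N) (q : Chain0) : ZMod 2 :=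
  q.sum fun x c => c • (if h : x ∈ box N then φ ⟨x, h⟩ else 0)

/-- `σ(q)` for a `1`-chain `q` (cells outside the box contribute `0`). -/
def Form1.eval {N : ℕ} (σ : Form1 N) (q : Chain1) : ZMod 2 :=
  q.sum fun e c => c • (if h : e ∈ boxEdges N then σ ⟨e, h⟩ else 0)

/-- The exterior derivative, `dσ(p) = σ(∂p)`. -/
def Form1.d {N : ℕ} (σ : Form1 N) (p : PosPlaquette) : ZMod 2 := σ.eval (plaquetteBoundary p)

/-- The representation of `ℤ/2` with `ρ(0) = 1` and `ρ(1) = -1` (it is real-valued). -/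
def rho (g : ZMod 2) : ℝ := if g = 0 then 1 else -1

/-! ### The fixed length lattice Higgs model on the box -/

/-- `σ(q) - φ(∂q)` for a `1`-chain `q`. -/
def covariantEval {N : ℕ} (σ : Form1 N) (φ : Form0 N) (q : Chain1) : ZMod 2 :=
  σ.eval q - φ.eval (boundary q)

/-- The sum of `ρ(dσ(p))` over all oriented plaquettes of the box (each positively oriented
plaquette is counted with both its orientations `s = ±1`). -/
def wilsonSum {N : ℕ} (σ : Form1 N) : ℝ :=
  ∑ p ∈ boxPlaquettes N, ∑ s : ℤˣ, rho ((s : ℤ) • σ.d p)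

/-- The sum of `ρ(σ(e) - φ(∂e))` over all oriented edges of the box. -/
def interactionSum {N : ℕ} (σ : Form1 N) (φ : Form0 N) : ℝ :=
  ∑ e ∈ boxEdges N, ∑ s : ℤˣ, rho (covariantEval σ φ (Finsupp.single e (s : ℤ)))

def action {N : ℕ} (β κ : ℝ) (σ : Form1 N) (φ : Form0 N) : ℝ :=
  -β * wilsonSum σ - κ * interactionSum σ φ

/-- The Boltzmann weight `exp(-S)` at finite `β`. -/
def weight {N : ℕ} (β κ : ℝ) (x : Form1 N × Form0 N) : ℝ := Real.exp (-action β κ x.1 x.2)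

open Classical in
/-- The Boltzmann weight at `β = ∞`: the gauge field is restricted to closed forms. -/
def weightInfty {N : ℕ} (κ : ℝ) (x : Form1 N × Form0 N) : ℝ :=
  if ∀ p ∈ boxPlaquettes N, x.1.d p = 0 then Real.exp (κ * interactionSum x.1 x.2) else 0

/-- The expectation of `f` under the probability measure on a finite set proportional to `w`. -/
def gibbsExpectation {Ω : Type*} [Fintype Ω] (w f : Ω → ℝ) : ℝ :=
  (∑ x, w x * f x) / ∑ x, w x

/-- The Wilson line observable `L_γ(σ, φ) = ρ(σ(γ) - φ(∂γ))`. -/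
def wilsonLine (N : ℕ) (γ : Chain1) (x : Form1 N × Form0 N) : ℝ := rho (covariantEval x.1 x.2 γ)

/-- `𝔼_{N,β,κ,∞}[L_γ(σ, φ)]`. -/
def wilsonExpectation (β κ : ℝ) (γ : Chain1) (N : ℕ) : ℝ :=
  gibbsExpectation (weight β κ) (wilsonLine N γ)

/-- `𝔼_{N,∞,κ,∞}[L_γ(σ, φ)]`. -/
def wilsonExpectationInfty (κ : ℝ) (γ : Chain1) (N : ℕ) : ℝ :=
  gibbsExpectation (weightInfty κ) (wilsonLine N γ)

/-! ### Infinite volume expectations -/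

/-- `⟨L_γ(σ, φ)⟩_{β,κ,∞}`. -/
def wilsonLimit (β κ : ℝ) (γ : Chain1) : ℝ := limUnder atTop (wilsonExpectation β κ γ)

/-- `⟨L_γ(σ, φ)⟩_{∞,κ,∞}`. -/
def wilsonLimitInfty (κ : ℝ) (γ : Chain1) : ℝ := limUnder atTop (wilsonExpectationInfty κ γ)

/-- `H_κ(γ)`. -/
def H (κ : ℝ) (γ : Chain1) : ℝ := wilsonLimitInfty κ γ

/-- `Θ'_{β,κ}(γ)`, computed with the oriented edge `e` (a `1`-chain). The factor
`(1 - ⟨L_e⟩) / 2` is the infinite volume probability of the event `L_e = -1` at `β = ∞`. -/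
def Theta' (β κ : ℝ) (γ e : Chain1) : ℝ :=
  Real.exp (-2 * (γ.support.card : ℝ) * Real.exp (-24 * β - 4 * κ) *
    (1 + (Real.exp (8 * κ) - 1) * ((1 - wilsonLimitInfty κ e) / 2)))

/-! ### Paths -/

/-- Coefficients in `{-1, 0, 1}` and empty boundary. -/
def IsGeneralizedLoop (γ : Chain1) : Prop :=
  (∀ e, γ e ∈ ({-1, 0, 1} : Set ℤ)) ∧ boundary γ = 0

/-- Coefficients in `{-1, 0, 1}` and boundary `x₂ - x₁`. -/
def IsOpenPath (γ : Chain1) (x₁ x₂ : Vertex) : Prop :=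
  (∀ e, γ e ∈ ({-1, 0, 1} : Set ℤ)) ∧
    boundary γ = Finsupp.single x₂ 1 - Finsupp.single x₁ 1

def IsPath (γ : Chain1) : Prop := IsGeneralizedLoop γ ∨ ∃ x₁ x₂, IsOpenPath γ x₁ x₂

/-- The edges on the boundary of the axis-parallel rectangle with corner `a` and sides of length
`ℓ₁` in direction `i` and of length `ℓ₂` in direction `j`. -/
def rectangleEdges (a : Vertex) (i j : Fin 4) (ℓ₁ ℓ₂ : ℕ) : Set PosEdge :=
  {e | (e.2 = i ∧ ∃ s < ℓ₁, e.1 = a + s • unit i ∨ e.1 = a + s • unit i + ℓ₂ • unit j) ∨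
       (e.2 = j ∧ ∃ t < ℓ₂, e.1 = a + t • unit j ∨ e.1 = a + t • unit j + ℓ₁ • unit i)}

/-- `γ` runs along the boundary of some rectangle with side lengths `ℓ₁` and `ℓ₂`. -/
def IsAlongRectangle (γ : Chain1) (ℓ₁ ℓ₂ : ℕ) : Prop :=
  ∃ (a : Vertex) (i j : Fin 4), i ≠ j ∧ (γ.support : Set PosEdge) ⊆ rectangleEdges a i j ℓ₁ ℓ₂

end LatticeHiggs

end

open LatticeHiggs

/-!
In unitary gauge the model is a measure on finite sets `A` of edges, the support of `σ - dφ`, with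
weight `x ^ |A| * y ^ |vort A|`, where `x = exp (-4 κ)`, `y = exp (-4 β)` and `vort A` is the set
of plaquettes that meet `A` in an odd number of edges; `β = ∞` means `y = 0`. The observable along
a path with edge set `Γ` becomes the character `chi Γ A = (-1) ^ |A ∩ Γ|`, so only `Γ` matters
(`wilsonExpectation_eq`, `wilsonExpectationInfty_eq`). Griffiths' inequalities show that its
expectation is non-negative, increases with the box and decreases with `y`
(`average_wt_nonneg`, `average_wt_mono`, `average_wt_anti`). Hence the infinite volume limits
exist, and they are invariant under the symmetries of the lattice (`limit_edge_le`).

Two independent configurations with different plaquette weights may exchange the clusters of their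
union. Where the exchange reverses the sign of a difference of observables, the contributions
cancel (`sum_exchange_eq_zero`); the remainder is the probability of a cluster that contains a
vortex at which the weights differ. As an edge has at most `18` neighbours, there are at most
`18 ^ (2 k)` clusters of size `k + 1` at it, and a Peierls argument bounds this probability by a
geometric series with ratio `18 ^ 2 * (2 x + x ^ 2) < 1` (`sum_cluster_le`).

Geometry supplies powers of `y`. A cluster on a straight piece of the path on which the character
is negative contains a line with an odd number of edges, and each of the six rays orthogonal to
this line ends in a vortex. If one of its vortices is not around an edge of the path, then there
are seven (`Straight.card_vort`). So on short paths the expectation differs little from the one at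
`y = 0` with plaquettes of weight `y` only around the edges of the path
(`abs_average_sub_softWt_le`), which are called soft.

In the latter model a vortex configuration is a union of full stars of six plaquettes around edges
of the path, because of the Bianchi identity (`odd_iff_of_sparse`). Softening the plaquettes
around one more edge `e` therefore adds exactly the configurations obtained by flipping `e`
(`softWt_insert`), each with relative weight `y ^ 6 * x` or `y ^ 6 * x⁻¹`, according to whether `e`
was excited. As the excitation of `e` is nearly independent of the character
(`abs_average_mul_sub_le`), the expectation gets multiplied by about `(1 - r) / (1 + r)`, that is,
by `exp (-2 r)`, with `r = y ^ 6 * x * (1 + (x⁻² - 1) * p)` and `p` the excitation probability at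
`β = ∞`. This is a contraction, so the errors do not accumulate along the path
(`abs_average_softWt_sub_le`), and the product of these factors is `Θ'`.

On long paths, where vortices off the path cannot be neglected, the expectation is at most the one
with soft plaquettes by Griffiths' inequality, and both this and `Θ'` are small
(`abs_boxAverage_sub_le`). Corners and end points cost a convergent sum (`decaySum`), and so does
the boundary of the box, whose contribution vanishes in the limit. With `w = exp (-4 β / 3)` the
total error is a function of `κ` times `w ^ 2`. For `κ < 6 β` this is at most the same function
times `exp (-κ / 9) * exp (-4 (β + κ / 6)) ^ (1 / 4)` (`exp_le_mul_rpow`). The factor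
`exp (-κ / 9)` makes the constant tend to `0`, so that the `o(κ)` in the bound on `K''` suffices.
-/

namespace LatticeHiggs

/-! ### Characters and averages over the subsets of a finite set -/

section Abstract

variable {V ι : Type*} [DecidableEq V]

/-- The character `A ↦ (-1)^{|A ∩ F|}` on finite sets, which are added by symmetric difference.
A finite set `A` stands for the `ℤ/2`-valued function with support `A`. -/
def chi (F A : Finset V) : ℝ := (-1) ^ (A ∩ F).card

/-- The average of `F` over the subsets of `Λ` with respect to the weight `w`. -/
noncomputable def average (Λ : Finset V) (w F : Finset V → ℝ) : ℝ :=
  (∑ A ∈ Λ.powerset, w A * F A) / ∑ A ∈ Λ.powerset, w A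

lemma chi_eq_prod (F A : Finset V) : chi F A = ∏ e ∈ A, if e ∈ F then (-1 : ℝ) else 1 := by
  rw [Finset.prod_ite, Finset.prod_const, Finset.prod_const_one, mul_one, chi,
    Finset.filter_mem_eq_inter]

lemma chi_empty_left (A : Finset V) : chi ∅ A = 1 := by simp [chi]

lemma chi_eq_one_or (F A : Finset V) : chi F A = 1 ∨ chi F A = -1 := neg_one_pow_eq_or ℝ _

lemma abs_chi (F A : Finset V) : |chi F A| = 1 := by
  rcases chi_eq_one_or F A with h | h <;> simp [h]

lemma chi_eq_neg_one_iff (F A : Finset V) : chi F A = -1 ↔ Odd (A ∩ F).card := by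
  rw [chi]
  rcases Nat.even_or_odd (A ∩ F).card with h | h
  · rw [h.neg_one_pow]; simp only [← Nat.not_even_iff_odd, h, not_true_eq_false, iff_false]
    norm_num
  · simp [h.neg_one_pow, h]

lemma chi_eq_ite (F A : Finset V) : chi F A = if Odd (A ∩ F).card then -1 else 1 := by
  split_ifs with h
  · exact (chi_eq_neg_one_iff F A).2 h
  · exact (chi_eq_one_or F A).resolve_right fun h' => h ((chi_eq_neg_one_iff F A).1 h')

lemma chi_union {F A B : Finset V} (h : Disjoint A B) : chi F (A ∪ B) = chi F A * chi F B := by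
  simp only [chi_eq_prod, Finset.prod_union h]

lemma chi_symmDiff (F A B : Finset V) : chi F (symmDiff A B) = chi F A * chi F B := by
  have h1 : chi F A = chi F (A \ B) * chi F (A ∩ B) := by
    rw [← chi_union (Finset.disjoint_sdiff_inter A B), Finset.sdiff_union_inter]
  have h2 : chi F B = chi F (B \ A) * chi F (A ∩ B) := by
    rw [Finset.inter_comm, ← chi_union (Finset.disjoint_sdiff_inter B A),
      Finset.sdiff_union_inter]
  have h3 : chi F (symmDiff A B) = chi F (A \ B) * chi F (B \ A) := by
    rw [← chi_union (Finset.disjoint_left.2 fun a ha hb =>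
      (Finset.mem_sdiff.1 hb).2 (Finset.mem_sdiff.1 ha).1)]
    rfl
  rw [h1, h2, h3]
  rcases chi_eq_one_or F (A ∩ B) with h | h <;> simp [h]

lemma odd_symmDiff_inter (F A B : Finset V) :
    Odd (symmDiff A B ∩ F).card ↔ ¬ (Odd (A ∩ F).card ↔ Odd (B ∩ F).card) := by
  rw [← chi_eq_neg_one_iff, ← chi_eq_neg_one_iff, ← chi_eq_neg_one_iff, chi_symmDiff]
  rcases chi_eq_one_or F A with h | h <;> rcases chi_eq_one_or F B with h' | h' <;>
    rw [h, h'] <;> norm_num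

/-! ### Griffiths' inequalities -/

/-- A product of characters and of functions with values `v i ≤ u i` at odd and even sets has a
nonnegative Fourier expansion, hence a nonnegative sum. -/
lemma sum_prod_nonneg (Λ : Finset V) (I : Finset ι) (S : ι → Finset V) (u v : ι → ℝ)
    (hv : ∀ i, 0 ≤ v i) (huv : ∀ i, v i ≤ u i) (F : Finset V) :
    0 ≤ ∑ A ∈ Λ.powerset, chi F A * ∏ i ∈ I, if Odd (A ∩ S i).card then v i else u i := by
  classical
  induction I using Finset.induction_on generalizing F with
  | empty =>
    simp only [Finset.prod_empty, mul_one, chi_eq_prod]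
    rw [← Finset.prod_one_add]
    refine Finset.prod_nonneg fun e _ => ?_
    split_ifs <;> norm_num
  | insert i I hi ih =>
    have key : ∀ A : Finset V,
        chi F A * ∏ j ∈ insert i I, (if Odd (A ∩ S j).card then v j else u j) =
          (u i + v i) / 2 * (chi F A * ∏ j ∈ I, if Odd (A ∩ S j).card then v j else u j) +
          (u i - v i) / 2 * (chi (symmDiff F (S i)) A *
            ∏ j ∈ I, if Odd (A ∩ S j).card then v j else u j) := by
      intro A
      have hc : chi (symmDiff F (S i)) A = chi F A * chi (S i) A := by
        have := chi_symmDiff A F (S i)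
        simpa only [chi, Finset.inter_comm] using this
      rw [Finset.prod_insert hi, hc, chi_eq_ite (S i) A]
      split_ifs <;> ring
    simp only [key, Finset.sum_add_distrib, ← Finset.mul_sum]
    have h1 := ih F
    have h2 := ih (symmDiff F (S i))
    have h3 := hv i
    have h4 := huv i
    exact add_nonneg (mul_nonneg (by linarith) h1) (mul_nonneg (by linarith) h2)

/-- The product over `i ∈ I` of the factors `q i` for which `A` meets `S i` in an odd number of
points. -/
noncomputable def cellWeight (I : Finset ι) (S : ι → Finset V) (q : ι → ℝ) (A : Finset V) : ℝ :=
  ∏ i ∈ I, if Odd (A ∩ S i).card then q i else 1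

lemma cellWeight_nonneg (I : Finset ι) (S : ι → Finset V) {q : ι → ℝ} (hq : ∀ i, 0 ≤ q i)
    (A : Finset V) : 0 ≤ cellWeight I S q A :=
  Finset.prod_nonneg fun i _ => by split_ifs <;> [exact hq i; exact zero_le_one]

lemma sum_cellWeight_pos (Λ : Finset V) (I : Finset ι) (S : ι → Finset V) {q : ι → ℝ}
    (hq : ∀ i, 0 ≤ q i) : 0 < ∑ A ∈ Λ.powerset, cellWeight I S q A := by
  refine Finset.sum_pos' (fun A _ => cellWeight_nonneg I S hq A)
    ⟨∅, Finset.empty_mem_powerset _, ?_⟩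
  simp [cellWeight]

lemma average_nonneg (Λ : Finset V) (I : Finset ι) (S : ι → Finset V) {q : ι → ℝ}
    (hq : ∀ i, 0 ≤ q i) (hq1 : ∀ i, q i ≤ 1) (F : Finset V) :
    0 ≤ average Λ (cellWeight I S q) (chi F) := by
  refine div_nonneg ?_ (sum_cellWeight_pos Λ I S hq).le
  have := sum_prod_nonneg Λ I S (fun _ => 1) q hq hq1 F
  simpa only [cellWeight, mul_comm] using this

lemma sum_powerset_symmDiff (Λ : Finset V) {A : Finset V} (hA : A ∈ Λ.powerset)
    (f : Finset V → ℝ) :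
    ∑ B ∈ Λ.powerset, f (symmDiff A B) = ∑ B ∈ Λ.powerset, f B := by
  have hmem : ∀ B ∈ Λ.powerset, symmDiff A B ∈ Λ.powerset := by
    intro B hB
    rw [Finset.mem_powerset] at *
    intro e he
    rcases Finset.mem_symmDiff.1 he with h | h
    · exact hA h.1
    · exact hB h.1
  exact Finset.sum_nbij' (fun B => symmDiff A B) (fun B => symmDiff A B) hmem hmem
    (fun B _ => symmDiff_symmDiff_cancel_left A B) (fun B _ => symmDiff_symmDiff_cancel_left A B)
    (fun B _ => rfl)

/-- Griffiths' second inequality: multiplying the weight by further factors `r i ≤ 1` at the odd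
sets increases the average of a character. With two copies `A` and `A ∆ B` of the
configuration, the difference becomes for each fixed `B` a sum of the form `sum_prod_nonneg`. -/
lemma average_mul_le (Λ : Finset V) (I : Finset ι) (S : ι → Finset V) {q r : ι → ℝ}
    (hq : ∀ i, 0 ≤ q i) (hq1 : ∀ i, q i ≤ 1) (hr : ∀ i, 0 ≤ r i) (hr1 : ∀ i, r i ≤ 1)
    (F : Finset V) :
    average Λ (cellWeight I S q) (chi F) ≤
      average Λ (cellWeight I S fun i => q i * r i) (chi F) := by
  have hsplit : ∀ A, cellWeight I S (fun i => q i * r i) A =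
      cellWeight I S q A * cellWeight I S r A := by
    intro A
    rw [cellWeight, cellWeight, cellWeight, ← Finset.prod_mul_distrib]
    refine Finset.prod_congr rfl fun i _ => ?_
    split_ifs <;> simp
  rw [average, average, div_le_div_iff₀ (sum_cellWeight_pos Λ I S hq)
    (sum_cellWeight_pos Λ I S fun i => mul_nonneg (hq i) (hr i)), ← sub_nonneg,
    mul_comm (∑ A ∈ Λ.powerset, cellWeight I S q A * chi F A), Finset.sum_mul_sum,
    Finset.sum_mul_sum, ← Finset.sum_sub_distrib]
  have e1 : ∀ A ∈ Λ.powerset,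
      (∑ B ∈ Λ.powerset, cellWeight I S (fun i => q i * r i) A * chi F A * cellWeight I S q B -
        ∑ B ∈ Λ.powerset, cellWeight I S (fun i => q i * r i) A * (cellWeight I S q B * chi F B))
      = ∑ B ∈ Λ.powerset, (1 - chi F B) * (chi F A *
        (cellWeight I S (fun i => q i * r i) A * cellWeight I S q (symmDiff A B))) := by
    intro A hA
    rw [← Finset.sum_sub_distrib, ← sum_powerset_symmDiff Λ hA]
    refine Finset.sum_congr rfl fun B _ => ?_
    rw [chi_symmDiff]
    ring
  rw [Finset.sum_congr rfl e1, Finset.sum_comm]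
  refine Finset.sum_nonneg fun B _ => ?_
  rw [← Finset.mul_sum]
  refine mul_nonneg (by rcases chi_eq_one_or F B with h | h <;> norm_num [h]) ?_
  have := sum_prod_nonneg Λ I S (fun i => if Odd (B ∩ S i).card then q i else 1)
    (fun i => if Odd (B ∩ S i).card then q i * r i else q i * r i * q i)
    (fun i => by
      have := hq i; have := hr i
      split_ifs <;> positivity)
    (fun i => by
      have h1 := hq i; have h2 := hr i; have h3 := hq1 i; have h4 := hr1 i
      have h5 : q i * r i ≤ q i := mul_le_of_le_one_right h1 h4
      split_ifs
      · exact h5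
      · exact (mul_le_mul h5 h3 h1 h1).trans (by nlinarith)) F
  refine this.trans_eq (Finset.sum_congr rfl fun A _ => ?_)
  congr 1
  simp only [cellWeight]
  rw [← Finset.prod_mul_distrib]
  refine Finset.prod_congr rfl fun i _ => ?_
  have := odd_symmDiff_inter (S i) A B
  by_cases h1 : Odd (A ∩ S i).card <;> by_cases h2 : Odd (B ∩ S i).card <;>
    simp [this, h1, h2]

/-- Monotonicity in the weights of the odd sets. -/
lemma average_le_of_le (Λ : Finset V) (I : Finset ι) (S : ι → Finset V) {q q' : ι → ℝ}
    (hq' : ∀ i, 0 ≤ q' i) (hle : ∀ i, q' i ≤ q i) (hq1 : ∀ i, q i ≤ 1) (F : Finset V) :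
    average Λ (cellWeight I S q) (chi F) ≤ average Λ (cellWeight I S q') (chi F) := by
  have hq : ∀ i, 0 ≤ q i := fun i => (hq' i).trans (hle i)
  have h := average_mul_le Λ I S (r := fun i => q' i / q i) hq hq1
    (fun i => div_nonneg (hq' i) (hq i)) (fun i => div_le_one_of_le₀ (hle i) (hq i)) F
  refine h.trans_eq ?_
  congr 2
  funext i
  rcases (hq i).eq_or_lt with h0 | h0
  · rw [← h0, zero_mul]
    exact le_antisymm (hq' i) (h0 ▸ hle i)
  · exact mul_div_cancel₀ _ h0.ne'

end Abstract

/-! ### Connected clusters and their number -/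

section Clusters

variable {V Q : Type*} [DecidableEq V]

/-- `Animal nbr r C`: the finite set `C` contains `r` and is connected for the neighbour relation
`nbr`; it is built by adding one neighbour at a time. -/
inductive Animal (nbr : V → Finset V) (r : V) : Finset V → Prop
  | root : Animal nbr r {r}
  | step {C : Finset V} {u v : V} : Animal nbr r C → u ∈ C → v ∈ nbr u → v ∉ C →
      Animal nbr r (insert v C)

lemma Animal.root_mem {nbr : V → Finset V} {r : V} {C : Finset V} (h : Animal nbr r C) :
    r ∈ C := by
  induction h with
  | root => simp
  | step _ _ _ _ ih => exact Finset.mem_insert_of_mem ih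

/-- The lists of length `n + 1` that trace a walk ending at `r`. -/
def walks (nbr : V → Finset V) (r : V) : ℕ → Finset (List V)
  | 0 => {[r]}
  | n + 1 => (walks nbr r n).biUnion fun l =>
      (l.head?.elim ∅ nbr).image fun v => v :: l

lemma card_walks_le {nbr : V → Finset V} {Δ : ℕ} (hΔ : ∀ v, (nbr v).card ≤ Δ) (r : V) (n : ℕ) :
    (walks nbr r n).card ≤ Δ ^ n := by
  induction n with
  | zero => simp [walks]
  | succ n ih =>
    rw [walks, pow_succ]
    refine Finset.card_biUnion_le.trans
      ((Finset.sum_le_card_nsmul _ _ Δ fun l _ => Finset.card_image_le.trans ?_).trans ?_)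
    · cases l with
      | nil => simp
      | cons v l => simpa using hΔ v
    · rw [smul_eq_mul]
      exact Nat.mul_le_mul_right _ ih

lemma cons_mem_walks {nbr : V → Finset V} {r u v : V} {l : List V} {n : ℕ}
    (h : u :: l ∈ walks nbr r n) (hv : v ∈ nbr u) : v :: u :: l ∈ walks nbr r (n + 1) := by
  rw [walks, Finset.mem_biUnion]
  exact ⟨u :: l, h, by simpa using hv⟩

/-- A detour `u, v, u` can be inserted at any visited point `u`. -/
lemma exists_walk_insert {nbr : V → Finset V} (hsymm : ∀ u v, v ∈ nbr u → u ∈ nbr v) {r u v : V}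
    (hv : v ∈ nbr u) (n : ℕ) (l : List V) (hl : l ∈ walks nbr r n) (hu : u ∈ l) :
    ∃ l' ∈ walks nbr r (n + 2), l'.head? = l.head? ∧ l'.toFinset = insert v l.toFinset := by
  induction n generalizing l with
  | zero =>
    obtain rfl : l = [r] := by simpa [walks] using hl
    obtain rfl : u = r := by simpa using hu
    exact ⟨[u, v, u], cons_mem_walks (cons_mem_walks hl hv) (hsymm _ _ hv), rfl, by
      ext; simp⟩
  | succ n ih =>
    by_cases hhd : l.head? = some u
    · obtain ⟨l0, rfl⟩ : ∃ l0, l = u :: l0 := by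
        cases l with
        | nil => simp at hhd
        | cons a l0 => exact ⟨l0, by simpa using hhd⟩
      exact ⟨u :: v :: u :: l0, cons_mem_walks (cons_mem_walks hl hv) (hsymm _ _ hv), rfl, by
        ext; simp⟩
    · obtain ⟨l0, hl0, hl'⟩ := Finset.mem_biUnion.1 (by rwa [walks] at hl)
      obtain ⟨w, hw, rfl⟩ := Finset.mem_image.1 hl'
      have hu0 : u ∈ l0 := by
        rcases List.mem_cons.1 hu with rfl | h
        · simp at hhd
        · exact h
      obtain ⟨l1, h1, h2, h3⟩ := ih l0 hl0 hu0
      refine ⟨w :: l1, ?_, rfl, ?_⟩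
      · rw [walks, Finset.mem_biUnion]
        exact ⟨l1, h1, by rw [h2]; exact Finset.mem_image_of_mem _ hw⟩
      · rw [List.toFinset_cons, h3, List.toFinset_cons, Finset.insert_comm]

/-- A connected set of `k` points is traced by a closed walk around a spanning tree. -/
lemma Animal.exists_walk {nbr : V → Finset V} (hsymm : ∀ u v, v ∈ nbr u → u ∈ nbr v) {r : V}
    {C : Finset V} (h : Animal nbr r C) :
    ∃ l ∈ walks nbr r (2 * (C.card - 1)), l.toFinset = C := by
  induction h with
  | root => exact ⟨[r], by simp [walks], by simp⟩
  | @step C u v hC hu hv hvC ih =>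
    obtain ⟨l, hl, rfl⟩ := ih
    obtain ⟨l', h1, -, h3⟩ := exists_walk_insert hsymm hv _ l hl (List.mem_toFinset.1 hu)
    refine ⟨l', ?_, h3⟩
    have hpos : 0 < l.toFinset.card := Finset.card_pos.2 ⟨u, hu⟩
    rw [Finset.card_insert_of_notMem hvC]
    convert h1 using 2
    omega

lemma card_animals_le {nbr : V → Finset V} (hsymm : ∀ u v, v ∈ nbr u → u ∈ nbr v) {Δ : ℕ}
    (hΔ : ∀ v, (nbr v).card ≤ Δ) (r : V) (k : ℕ) (𝒞 : Finset (Finset V))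
    (h𝒞 : ∀ C ∈ 𝒞, Animal nbr r C ∧ C.card = k) : 𝒞.card ≤ Δ ^ (2 * (k - 1)) := by
  have hsub : 𝒞 ⊆ (walks nbr r (2 * (k - 1))).image List.toFinset := by
    intro C hC
    obtain ⟨h1, h2⟩ := h𝒞 C hC
    obtain ⟨l, hl, hlC⟩ := h1.exists_walk hsymm
    exact Finset.mem_image.2 ⟨l, h2 ▸ hl, hlC⟩
  exact (Finset.card_le_card hsub).trans (Finset.card_image_le.trans (card_walks_le hΔ r _))

lemma sum_animals_le {nbr : V → Finset V} (hsymm : ∀ u v, v ∈ nbr u → u ∈ nbr v) {Δ : ℕ}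
    (hΔ : ∀ v, (nbr v).card ≤ Δ) (hΔ0 : 1 ≤ Δ) (r : V) {t : ℝ} (ht : 0 ≤ t)
    (hα : (Δ : ℝ) ^ 2 * t < 1) (k₀ : ℕ) (𝒞 : Finset (Finset V))
    (h𝒞 : ∀ C ∈ 𝒞, Animal nbr r C) :
    ∑ C ∈ 𝒞, (if k₀ ≤ C.card then t ^ C.card else 0) ≤
      ((Δ : ℝ) ^ 2 * t) ^ k₀ / (1 - (Δ : ℝ) ^ 2 * t) := by
  classical
  set α := (Δ : ℝ) ^ 2 * t with hαdef
  have hα0 : 0 ≤ α := by positivity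
  have hD : (1 : ℝ) ≤ Δ := by exact_mod_cast hΔ0
  set M := 𝒞.sup Finset.card + 1
  have hmaps : ∀ C ∈ 𝒞, C.card ∈ Finset.range M := fun C hC =>
    Finset.mem_range.2 (Nat.lt_succ_of_le (Finset.le_sup (f := Finset.card) hC))
  rw [← Finset.sum_fiberwise_of_maps_to hmaps]
  have hterm : ∀ k ∈ Finset.range M,
      ∑ C ∈ 𝒞 with C.card = k, (if k₀ ≤ C.card then t ^ C.card else 0) ≤
        if k₀ ≤ k then α ^ k else 0 := by
    intro k _
    have : ∀ C ∈ 𝒞.filter (fun C => C.card = k),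
        (if k₀ ≤ C.card then t ^ C.card else 0) = if k₀ ≤ k then t ^ k else 0 := by
      intro C hC
      rw [(Finset.mem_filter.1 hC).2]
    rw [Finset.sum_congr rfl this, Finset.sum_const, nsmul_eq_mul]
    split_ifs with hk
    · have hcard := card_animals_le hsymm hΔ r k (𝒞.filter fun C => C.card = k)
        (fun C hC => ⟨h𝒞 C (Finset.mem_filter.1 hC).1, (Finset.mem_filter.1 hC).2⟩)
      have h1 : ((𝒞.filter fun C => C.card = k).card : ℝ) ≤ ((Δ : ℝ) ^ 2) ^ k := by
        calc ((𝒞.filter fun C => C.card = k).card : ℝ) ≤ (Δ : ℝ) ^ (2 * (k - 1)) := by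
              exact_mod_cast hcard
          _ ≤ (Δ : ℝ) ^ (2 * k) := pow_le_pow_right₀ hD (by omega)
          _ = _ := by rw [pow_mul]
      calc _ ≤ ((Δ : ℝ) ^ 2) ^ k * t ^ k := by gcongr
        _ = α ^ k := by rw [hαdef, mul_pow]
    · simp
  refine (Finset.sum_le_sum hterm).trans ?_
  have hs : Summable fun k : ℕ => α ^ k := summable_geometric_of_lt_one hα0 hα
  rw [← Finset.sum_filter]
  have hsub : ((Finset.range M).filter fun k => k₀ ≤ k) ⊆
      (Finset.range M).image fun k => k₀ + k := by
    intro k hk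
    obtain ⟨h1, h2⟩ := Finset.mem_filter.1 hk
    exact Finset.mem_image.2 ⟨k - k₀, Finset.mem_range.2 (by
      have := Finset.mem_range.1 h1; omega), by omega⟩
  calc ∑ k ∈ Finset.range M with k₀ ≤ k, α ^ k
      ≤ ∑ k ∈ (Finset.range M).image (fun k => k₀ + k), α ^ k :=
        Finset.sum_le_sum_of_subset_of_nonneg hsub fun _ _ _ => by positivity
    _ = α ^ k₀ * ∑ k ∈ Finset.range M, α ^ k := by
        rw [Finset.sum_image (fun a _ b _ h => by simpa using h), Finset.mul_sum]
        exact Finset.sum_congr rfl fun k _ => pow_add _ _ _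
    _ ≤ α ^ k₀ * (1 - α)⁻¹ := by
        gcongr
        rw [← tsum_geometric_of_lt_one hα0 hα]
        exact hs.sum_le_tsum _ fun _ _ => by positivity
    _ = _ := by rw [div_eq_mul_inv]

/-- A step inside `S` from a point to one of its neighbours. -/
def Step (nbr : V → Finset V) (S : Finset V) (a b : V) : Prop := b ∈ nbr a ∧ b ∈ S

open Classical in
/-- The connected component of `e` in the finite set `S`. -/
noncomputable def comp (nbr : V → Finset V) (S : Finset V) (e : V) : Finset V :=
  S.filter (Relation.ReflTransGen (Step nbr S) e)

lemma mem_comp {V : Type*} {nbr : V → Finset V} {S : Finset V} {e e' : V} :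
    e' ∈ comp nbr S e ↔
      e' ∈ S ∧ Relation.ReflTransGen (Step nbr S) e e' := by
  simp [comp]

lemma comp_subset {V : Type*} (nbr : V → Finset V) (S : Finset V) (e : V) : comp nbr S e ⊆ S :=
  fun _ h => (mem_comp.1 h).1

lemma self_mem_comp {V : Type*} {nbr : V → Finset V} {S : Finset V} {e : V} (he : e ∈ S) :
    e ∈ comp nbr S e := mem_comp.2 ⟨he, .refl⟩

lemma comp_eq_of_mem {V : Type*} {nbr : V → Finset V} (hsymm : ∀ u v, v ∈ nbr u → u ∈ nbr v)
    {S : Finset V} {e e' : V} (he : e ∈ S) (h : e' ∈ comp nbr S e) :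
    comp nbr S e' = comp nbr S e := by
  have h1 : ∀ a, Relation.ReflTransGen (Step nbr S) e a →
      a ∈ S ∧ Relation.ReflTransGen (Step nbr S) a e := by
    intro a ha
    induction ha with
    | refl => exact ⟨he, .refl⟩
    | tail _ huv ih => exact ⟨huv.2, .head ⟨hsymm _ _ huv.1, ih.1⟩ ih.2⟩
  ext a
  rw [mem_comp, mem_comp]
  have h2 := (mem_comp.1 h).2
  exact ⟨fun ⟨ha, h3⟩ => ⟨ha, h2.trans h3⟩, fun ⟨ha, h3⟩ => ⟨ha, (h1 _ h2).2.trans h3⟩⟩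

lemma animal_comp (nbr : V → Finset V) {S : Finset V} {e : V} (he : e ∈ S) :
    Animal nbr e (comp nbr S e) := by
  classical
  obtain ⟨T, hT, hmax⟩ := Finset.exists_max_image
    ((comp nbr S e).powerset.filter fun T => Animal nbr e T) Finset.card
    ⟨{e}, Finset.mem_filter.2 ⟨Finset.mem_powerset.2
      (Finset.singleton_subset_iff.2 (self_mem_comp he)), .root⟩⟩
  obtain ⟨hTs, hTa⟩ := Finset.mem_filter.1 hT
  have hTs := Finset.mem_powerset.1 hTs
  suffices h : comp nbr S e ⊆ T by rwa [h.antisymm hTs]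
  intro e' he'
  have hp := (mem_comp.1 he').2
  clear he'
  induction hp with
  | refl => exact hTa.root_mem
  | @tail u v hu hv ih =>
    by_contra hvT
    have hv' : v ∈ comp nbr S e := mem_comp.2 ⟨hv.2, hu.tail hv⟩
    have := hmax (insert v T) (Finset.mem_filter.2 ⟨Finset.mem_powerset.2
      (Finset.insert_subset hv' hTs), hTa.step ih hv.1 hvT⟩)
    rw [Finset.card_insert_of_notMem hvT] at this
    omega

end Clusters

/-! ### Vortices, weights and the exchange of clusters between two configurations -/

section Swap

variable {V Q : Type*} [DecidableEq V] (bd : Q → Finset V) (P : Finset Q)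

/-- The plaquettes of `P` whose boundary meets `A` in an odd number of edges, that is, the support
of `dσ` if `A` is the support of `σ`. -/
def vort (A : Finset V) : Finset Q := P.filter fun p => Odd (A ∩ bd p).card

/-- The weight `x^{|A|} ∏ y p`, the product being over the vortices `p` of `A`. The case
`y p = 0` is that of infinite inverse temperature at `p`. -/
noncomputable def wt (x : ℝ) (y : Q → ℝ) (A : Finset V) : ℝ := x ^ A.card * ∏ p ∈ vort bd P A, y p

/-- `T` is a union of connected components of `S`, as far as common plaquettes are concerned. -/
def Saturated (S T : Finset V) : Prop := ∀ p ∈ P, (bd p ∩ T).Nonempty → bd p ∩ S ⊆ T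

variable {bd P}

lemma mem_vort {A : Finset V} {p : Q} : p ∈ vort bd P A ↔ p ∈ P ∧ Odd (A ∩ bd p).card :=
  Finset.mem_filter

lemma vort_empty : vort bd P ∅ = ∅ := by simp [vort]

lemma wt_empty (x : ℝ) (y : Q → ℝ) : wt bd P x y ∅ = 1 := by simp [wt, vort_empty]

lemma wt_nonneg {x : ℝ} (hx : 0 ≤ x) {y : Q → ℝ} (hy : ∀ p, 0 ≤ y p) (A : Finset V) :
    0 ≤ wt bd P x y A :=
  mul_nonneg (pow_nonneg hx _) (Finset.prod_nonneg fun p _ => hy p)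

lemma Saturated.mono {S S' T : Finset V} (h : Saturated bd P S T) (hS : S' ⊆ S) :
    Saturated bd P S' T :=
  fun p hp hT => (Finset.inter_subset_inter_left hS).trans (h p hp hT)

/-- Every plaquette sees only the part of `A` inside or the part outside a saturated set. -/
lemma Saturated.inter_or {A T : Finset V} (h : Saturated bd P A T) {p : Q} (hp : p ∈ P) :
    (A ∩ T ∩ bd p = A ∩ bd p ∧ A \ T ∩ bd p = ∅) ∨
      (A ∩ T ∩ bd p = ∅ ∧ A \ T ∩ bd p = A ∩ bd p) := by
  by_cases hT : (bd p ∩ T).Nonempty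
  · left
    have := h p hp hT
    constructor
    · ext e
      have := @this e
      simp only [Finset.mem_inter] at *
      tauto
    · ext e
      have := @this e
      simp only [Finset.mem_inter, Finset.mem_sdiff, Finset.notMem_empty] at *
      tauto
  · right
    rw [Finset.not_nonempty_iff_eq_empty] at hT
    have hT' : ∀ e, e ∈ bd p → e ∉ T := fun e h1 h2 =>
      Finset.notMem_empty e (hT ▸ Finset.mem_inter.2 ⟨h1, h2⟩)
    constructor
    · ext e
      have := hT' e
      simp only [Finset.mem_inter, Finset.notMem_empty] at *
      tauto
    · ext e
      have := hT' e
      simp only [Finset.mem_inter, Finset.mem_sdiff] at *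
      tauto

lemma wt_split {A T : Finset V} (h : Saturated bd P A T) (x : ℝ) (y : Q → ℝ) :
    wt bd P x y A = wt bd P x y (A ∩ T) * wt bd P x y (A \ T) := by
  have hcard : A.card = (A ∩ T).card + (A \ T).card := by
    rw [add_comm, Finset.card_sdiff_add_card_inter]
  have hprod : ∏ p ∈ vort bd P A, y p =
      (∏ p ∈ vort bd P (A ∩ T), y p) * ∏ p ∈ vort bd P (A \ T), y p := by
    simp only [vort, Finset.prod_filter]
    rw [← Finset.prod_mul_distrib]
    refine Finset.prod_congr rfl fun p hp => ?_
    rcases h.inter_or hp with ⟨h1, h2⟩ | ⟨h1, h2⟩ <;> simp [h1, h2]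
  rw [wt, wt, wt, hprod, hcard, pow_add]
  ring

lemma wt_congr {y y' : Q → ℝ} {A : Finset V} (h : ∀ p ∈ vort bd P A, y p = y' p) (x : ℝ) :
    wt bd P x y A = wt bd P x y' A := by
  rw [wt, wt, Finset.prod_congr rfl h]

/-- The configuration that agrees with `B` on `T` and with `A` elsewhere. -/
def exchange (T A B : Finset V) : Finset V := A \ T ∪ B ∩ T

lemma exchange_inter (T A B : Finset V) : exchange T A B ∩ T = B ∩ T := by
  ext e; simp only [exchange, Finset.mem_inter, Finset.mem_union, Finset.mem_sdiff]; tauto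

lemma exchange_sdiff (T A B : Finset V) : exchange T A B \ T = A \ T := by
  ext e; simp only [exchange, Finset.mem_inter, Finset.mem_union, Finset.mem_sdiff]; tauto

lemma exchange_union_exchange (T A B : Finset V) :
    exchange T A B ∪ exchange T B A = A ∪ B := by
  ext e; simp only [exchange, Finset.mem_inter, Finset.mem_union, Finset.mem_sdiff]; tauto

lemma exchange_exchange (T A B : Finset V) :
    exchange T (exchange T A B) (exchange T B A) = A := by
  ext e; simp only [exchange, Finset.mem_inter, Finset.mem_union, Finset.mem_sdiff]; tauto

lemma exchange_subset {Λ A B : Finset V} (T : Finset V) (hA : A ⊆ Λ) (hB : B ⊆ Λ) :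
    exchange T A B ⊆ Λ :=
  Finset.union_subset (Finset.sdiff_subset.trans hA) (Finset.inter_subset_left.trans hB)

lemma chi_split (F A T : Finset V) : chi F A = chi F (A ∩ T) * chi F (A \ T) := by
  rw [mul_comm, ← chi_union (Finset.disjoint_sdiff_inter A T), Finset.sdiff_union_inter]

/-- Exchanging two configurations on a saturated set `T` is an involution that preserves the
product of the weights, as long as the two weights agree at the vortices in `T`. Hence functions
that it maps to their negatives have sum zero. -/
lemma sum_exchange_eq_zero (Λ : Finset V) (x : ℝ) (y y' : Q → ℝ)
    (T : Finset V → Finset V → Finset V) (good : Finset V → Finset V → Prop)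
    [∀ A B, Decidable (good A B)] (F : Finset V → Finset V → ℝ)
    (hT : ∀ A B, T (exchange (T A B) A B) (exchange (T A B) B A) = T A B)
    (hsat : ∀ A B, Saturated bd P (A ∪ B) (T A B))
    (hgood : ∀ A B, good A B → good (exchange (T A B) A B) (exchange (T A B) B A))
    (hw : ∀ A B, good A B →
      ∀ p, p ∈ vort bd P (A ∩ T A B) ∨ p ∈ vort bd P (B ∩ T A B) → y p = y' p)
    (hF : ∀ A B, good A B →
      F (exchange (T A B) A B) (exchange (T A B) B A) = - F A B) :
    ∑ z ∈ Λ.powerset ×ˢ Λ.powerset,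
      (if good z.1 z.2 then wt bd P x y z.1 * wt bd P x y' z.2 * F z.1 z.2 else 0) = 0 := by
  have hgood' : ∀ A B, good (exchange (T A B) A B) (exchange (T A B) B A) → good A B := by
    intro A B h
    have := hgood _ _ h
    rwa [hT, exchange_exchange, exchange_exchange] at this
  refine Finset.sum_involution
    (fun z _ => (exchange (T z.1 z.2) z.1 z.2, exchange (T z.1 z.2) z.2 z.1)) ?_ ?_ ?_ ?_
  · rintro ⟨A, B⟩ -
    dsimp only
    by_cases hg : good A B
    · rw [if_pos hg, if_pos (hgood A B hg), hF A B hg]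
      have hu := hsat A B
      set T₀ := T A B with hT₀
      have e1 := wt_split (hu.mono Finset.subset_union_left) x y
      have e2 := wt_split (hu.mono Finset.subset_union_right) x y'
      have e3 := wt_split (hu.mono ((Finset.subset_union_left (s₁ := exchange T₀ A B)
        (s₂ := exchange T₀ B A)).trans (exchange_union_exchange T₀ A B).subset)) x y
      have e4 := wt_split (hu.mono ((Finset.subset_union_right (s₁ := exchange T₀ A B)
        (s₂ := exchange T₀ B A)).trans (exchange_union_exchange T₀ A B).subset)) x y'
      rw [exchange_inter, exchange_sdiff] at e3 e4
      have e5 := wt_congr (fun p hp => hw A B hg p (Or.inl hp)) x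
      have e6 := wt_congr (fun p hp => hw A B hg p (Or.inr hp)) x
      rw [e1, e2, e3, e4, e5, e6]
      ring
    · rw [if_neg hg, if_neg fun h => hg (hgood' A B h), add_zero]
  · rintro ⟨A, B⟩ - h heq
    apply h
    dsimp only at *
    by_cases hg : good A B
    · have h1 : exchange (T A B) A B = A := congrArg Prod.fst heq
      have h2 : exchange (T A B) B A = B := congrArg Prod.snd heq
      have h3 := hF A B hg
      rw [h1, h2] at h3
      have h4 : F A B = 0 := by linarith
      rw [if_pos hg, h4, mul_zero]
    · rw [if_neg hg]
  · rintro ⟨A, B⟩ h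
    obtain ⟨hA, hB⟩ := Finset.mem_product.1 h
    rw [Finset.mem_powerset] at hA hB
    exact Finset.mem_product.2 ⟨Finset.mem_powerset.2 (exchange_subset _ hA hB),
      Finset.mem_powerset.2 (exchange_subset _ hB hA)⟩
  · rintro ⟨A, B⟩ -
    dsimp only
    rw [hT, exchange_exchange, exchange_exchange]

lemma saturated_comp {nbr : V → Finset V}
    (hnbr : ∀ p ∈ P, ∀ e ∈ bd p, ∀ e' ∈ bd p, e ≠ e' → e' ∈ nbr e) (S : Finset V) (e : V) :
    Saturated bd P S (comp nbr S e) := by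
  intro p hp ⟨e₁, h₁⟩ e₂ h₂
  rw [Finset.mem_inter] at h₁ h₂
  by_cases h : e₁ = e₂
  · exact h ▸ h₁.2
  · exact mem_comp.2 ⟨h₂.2, (mem_comp.1 h₁.2).2.tail ⟨hnbr p hp _ h₁.1 _ h₂.1 h, h₂.2⟩⟩

/-! ### Probabilities of clusters -/

lemma sum_cover (C : Finset V) (x : ℝ) :
    ∑ z ∈ C.powerset ×ˢ C.powerset, (if z.1 ∪ z.2 = C then x ^ z.1.card * x ^ z.2.card else 0) =
      (2 * x + x ^ 2) ^ C.card := by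
  rw [Finset.sum_product]
  have h : ∀ s ∈ C.powerset, ∑ s' ∈ C.powerset,
      (if s ∪ s' = C then x ^ s.card * x ^ s'.card else 0) =
        (x * (x + 1)) ^ s.card * x ^ (C.card - s.card) := by
    intro s hs
    rw [Finset.mem_powerset] at hs
    have h1 : ∑ t ∈ s.powerset, x ^ t.card = (x + 1) ^ s.card := by
      simpa using Finset.sum_pow_mul_eq_add_pow x 1 s
    rw [mul_pow, ← h1, ← Finset.sum_filter, mul_assoc, Finset.sum_mul, Finset.mul_sum]
    refine Finset.sum_nbij' (fun s' => s' ∩ s) (fun t => t ∪ C \ s) ?_ ?_ ?_ ?_ ?_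
    · intro s' _
      exact Finset.mem_powerset.2 Finset.inter_subset_right
    · intro t ht
      rw [Finset.mem_powerset] at ht
      refine Finset.mem_filter.2 ⟨Finset.mem_powerset.2
        (Finset.union_subset (ht.trans hs) Finset.sdiff_subset), ?_⟩
      ext e
      have := @ht e
      have := @hs e
      simp only [Finset.mem_union, Finset.mem_sdiff]
      tauto
    · intro s' hs'
      obtain ⟨h1, h2⟩ := Finset.mem_filter.1 hs'
      rw [Finset.mem_powerset] at h1
      subst h2
      ext e
      simp only [Finset.mem_union, Finset.mem_sdiff, Finset.mem_inter]
      tauto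
    · intro t ht
      rw [Finset.mem_powerset] at ht
      ext e
      have := @ht e
      simp only [Finset.mem_union, Finset.mem_sdiff, Finset.mem_inter]
      tauto
    · intro s' hs'
      obtain ⟨h1, h2⟩ := Finset.mem_filter.1 hs'
      rw [Finset.mem_powerset] at h1
      subst h2
      have : s'.card = (s' ∩ s).card + ((s ∪ s').card - s.card) := by
        have h3 := Finset.card_union_add_card_inter s s'
        rw [Finset.inter_comm] at h3
        have h4 := Finset.card_le_card hs
        omega
      rw [← pow_add x (s' ∩ s).card, ← this]
  rw [Finset.sum_congr rfl h, Finset.sum_pow_mul_eq_add_pow]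
  ring_nf

/-- A Peierls bound: deleting the cluster `C` of `A ∪ B` at `e` from both configurations shows
that the probability that this cluster is `C`, and splits in a given way, is at most its
weight. -/
lemma sum_fixed_cluster_le (Λ C : Finset V) {x : ℝ} (hx : 0 ≤ x) {y y' : Q → ℝ}
    (hy : ∀ p, 0 ≤ y p) (hy' : ∀ p, 0 ≤ y' p) (R : Finset V → Finset V → Prop)
    [∀ A B, Decidable (R A B)] {g : ℝ}
    (hR : ∀ s s', s ∪ s' = C → R s s' →
      wt bd P x y s * wt bd P x y' s' ≤ g * (x ^ s.card * x ^ s'.card)) (hg : 0 ≤ g)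
    (E : Finset V → Finset V → Prop) [∀ A B, Decidable (E A B)]
    (hE : ∀ A B, E A B → Saturated bd P (A ∪ B) C ∧ C ⊆ A ∪ B ∧ R (A ∩ C) (B ∩ C)) :
    ∑ z ∈ Λ.powerset ×ˢ Λ.powerset,
      (if E z.1 z.2 then wt bd P x y z.1 * wt bd P x y' z.2 else 0) ≤
    g * (2 * x + x ^ 2) ^ C.card *
      ∑ z ∈ Λ.powerset ×ˢ Λ.powerset, wt bd P x y z.1 * wt bd P x y' z.2 := by
  classical
  set W : Finset V × Finset V → ℝ := fun z => wt bd P x y z.1 * wt bd P x y' z.2 with hW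
  have hW0 : ∀ z, 0 ≤ W z := fun z => mul_nonneg (wt_nonneg hx hy _) (wt_nonneg hx hy' _)
  set φ : Finset V × Finset V → (Finset V × Finset V) × (Finset V × Finset V) :=
    fun z => ((z.1 ∩ C, z.2 ∩ C), (z.1 \ C, z.2 \ C)) with hφ
  have hφi : Function.Injective φ := by
    intro z z' h
    have h1 : z.1 ∩ C = z'.1 ∩ C := congrArg (fun t => t.1.1) h
    have h2 : z.2 ∩ C = z'.2 ∩ C := congrArg (fun t => t.1.2) h
    have h3 : z.1 \ C = z'.1 \ C := congrArg (fun t => t.2.1) h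
    have h4 : z.2 \ C = z'.2 \ C := congrArg (fun t => t.2.2) h
    refine Prod.ext ?_ ?_
    · rw [← Finset.sdiff_union_inter z.1 C, h1, h3, Finset.sdiff_union_inter]
    · rw [← Finset.sdiff_union_inter z.2 C, h2, h4, Finset.sdiff_union_inter]
  set D := (C.powerset ×ˢ C.powerset).filter fun z => z.1 ∪ z.2 = C ∧ R z.1 z.2 with hD
  have hsum : ∑ z ∈ (Λ.powerset ×ˢ Λ.powerset).filter (fun z => E z.1 z.2), W z ≤
      ∑ t ∈ D ×ˢ (Λ.powerset ×ˢ Λ.powerset), W t.1 * W t.2 := by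
    have : ∀ z ∈ (Λ.powerset ×ˢ Λ.powerset).filter (fun z => E z.1 z.2),
        W z = W (φ z).1 * W (φ z).2 := by
      intro z hz
      have hs := (hE _ _ (Finset.mem_filter.1 hz).2).1
      simp only [hW, hφ]
      rw [wt_split (hs.mono Finset.subset_union_left), wt_split (hs.mono Finset.subset_union_right)]
      ring
    rw [Finset.sum_congr rfl this,
      ← Finset.sum_image (f := fun t => W t.1 * W t.2) (g := φ) (fun a _ b _ h => hφi h)]
    refine Finset.sum_le_sum_of_subset_of_nonneg ?_ fun t _ _ => mul_nonneg (hW0 _) (hW0 _)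
    intro t ht
    obtain ⟨z, hz, rfl⟩ := Finset.mem_image.1 ht
    obtain ⟨hz1, hz2⟩ := Finset.mem_filter.1 hz
    obtain ⟨-, h2, h3⟩ := hE _ _ hz2
    obtain ⟨hA, hB⟩ := Finset.mem_product.1 hz1
    rw [Finset.mem_powerset] at hA hB
    simp only [hφ, hD, Finset.mem_product, Finset.mem_filter, Finset.mem_powerset]
    refine ⟨⟨⟨Finset.inter_subset_right, Finset.inter_subset_right⟩, ?_, h3⟩,
      Finset.sdiff_subset.trans hA, Finset.sdiff_subset.trans hB⟩
    rw [← Finset.union_inter_distrib_right]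
    exact Finset.inter_eq_right.2 h2
  have hDsum : ∑ z ∈ D, W z ≤ g * (2 * x + x ^ 2) ^ C.card := by
    rw [← sum_cover, Finset.mul_sum, hD, Finset.sum_filter]
    refine Finset.sum_le_sum fun z _ => ?_
    by_cases h1 : z.1 ∪ z.2 = C
    · rw [if_pos h1]
      split_ifs with h2
      · exact hR _ _ h1 h2.2
      · positivity
    · rw [if_neg h1, if_neg fun h => h1 h.1, mul_zero]
  rw [← Finset.sum_filter]
  refine hsum.trans ?_
  rw [Finset.sum_product, ← Finset.sum_mul_sum]
  exact mul_le_mul_of_nonneg_right hDsum (Finset.sum_nonneg fun z _ => hW0 z)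

/-- The probability that the cluster of `e` has the property `R` is at most the sum of the weights
of the connected sets that have it. -/
lemma sum_cluster_le {nbr : V → Finset V} (hsymm : ∀ u v, v ∈ nbr u → u ∈ nbr v) {Δ : ℕ}
    (hΔ : ∀ v, (nbr v).card ≤ Δ) (hΔ0 : 1 ≤ Δ)
    (hnbr : ∀ p ∈ P, ∀ e ∈ bd p, ∀ e' ∈ bd p, e ≠ e' → e' ∈ nbr e)
    (Λ : Finset V) (e : V) {x : ℝ} (hx : 0 ≤ x) {y y' : Q → ℝ}
    (hy : ∀ p, 0 ≤ y p) (hy' : ∀ p, 0 ≤ y' p) (R : Finset V → Finset V → Prop)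
    [∀ A B, Decidable (R A B)] {b₁ b₂ : ℝ} (hb₁ : 0 ≤ b₁) (hb₂ : 0 ≤ b₂) {k₁ k₂ : ℕ}
    (hα : (Δ : ℝ) ^ 2 * (2 * x + x ^ 2) < 1)
    (hR : ∀ C s s', Animal nbr e C → C ⊆ Λ → s ∪ s' = C → R s s' →
      wt bd P x y s * wt bd P x y' s' ≤
        ((if k₁ ≤ C.card then b₁ else 0) + if k₂ ≤ C.card then b₂ else 0) *
          (x ^ s.card * x ^ s'.card)) :
    ∑ z ∈ Λ.powerset ×ˢ Λ.powerset,
      (if e ∈ z.1 ∪ z.2 ∧ R (z.1 ∩ comp nbr (z.1 ∪ z.2) e) (z.2 ∩ comp nbr (z.1 ∪ z.2) e)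
        then wt bd P x y z.1 * wt bd P x y' z.2 else 0) ≤
    (b₁ * (((Δ : ℝ) ^ 2 * (2 * x + x ^ 2)) ^ k₁ / (1 - (Δ : ℝ) ^ 2 * (2 * x + x ^ 2))) +
        b₂ * (((Δ : ℝ) ^ 2 * (2 * x + x ^ 2)) ^ k₂ / (1 - (Δ : ℝ) ^ 2 * (2 * x + x ^ 2)))) *
      ∑ z ∈ Λ.powerset ×ˢ Λ.powerset, wt bd P x y z.1 * wt bd P x y' z.2 := by
  classical
  set t := 2 * x + x ^ 2 with ht
  have ht0 : 0 ≤ t := by positivity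
  set 𝒞 := Λ.powerset.filter fun C => Animal nbr e C with h𝒞
  set Z := ∑ z ∈ Λ.powerset ×ˢ Λ.powerset, wt bd P x y z.1 * wt bd P x y' z.2 with hZ
  have hZ0 : 0 ≤ Z :=
    Finset.sum_nonneg fun z _ => mul_nonneg (wt_nonneg hx hy _) (wt_nonneg hx hy' _)
  set E : Finset V → Finset V → Finset V → Prop := fun C A B => e ∈ A ∪ B ∧
    comp nbr (A ∪ B) e = C ∧ R (A ∩ C) (B ∩ C) with hE
  have hpt : ∀ z ∈ Λ.powerset ×ˢ Λ.powerset,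
      (if e ∈ z.1 ∪ z.2 ∧ R (z.1 ∩ comp nbr (z.1 ∪ z.2) e) (z.2 ∩ comp nbr (z.1 ∪ z.2) e)
        then wt bd P x y z.1 * wt bd P x y' z.2 else 0) =
      ∑ C ∈ 𝒞, if E C z.1 z.2 then wt bd P x y z.1 * wt bd P x y' z.2 else 0 := by
    intro z hz
    obtain ⟨hA, hB⟩ := Finset.mem_product.1 hz
    rw [Finset.mem_powerset] at hA hB
    by_cases h : e ∈ z.1 ∪ z.2 ∧
        R (z.1 ∩ comp nbr (z.1 ∪ z.2) e) (z.2 ∩ comp nbr (z.1 ∪ z.2) e)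
    · rw [if_pos h, Finset.sum_eq_single (comp nbr (z.1 ∪ z.2) e)]
      · rw [if_pos ⟨h.1, rfl, h.2⟩]
      · intro C _ hC
        exact if_neg fun h' => hC h'.2.1.symm
      · intro hn
        exact absurd (Finset.mem_filter.2 ⟨Finset.mem_powerset.2
          ((comp_subset _ _ _).trans (Finset.union_subset hA hB)), animal_comp nbr h.1⟩) hn
    · rw [if_neg h, Finset.sum_eq_zero]
      intro C _
      refine if_neg ?_
      rintro ⟨h1, rfl, h2⟩
      exact h ⟨h1, h2⟩
  rw [Finset.sum_congr rfl hpt, Finset.sum_comm]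
  have hC : ∀ C ∈ 𝒞, ∑ z ∈ Λ.powerset ×ˢ Λ.powerset,
      (if E C z.1 z.2 then wt bd P x y z.1 * wt bd P x y' z.2 else 0) ≤
      (b₁ * (if k₁ ≤ C.card then t ^ C.card else 0) +
        b₂ * (if k₂ ≤ C.card then t ^ C.card else 0)) * Z := by
    intro C hC
    obtain ⟨h1, h2⟩ := Finset.mem_filter.1 hC
    rw [Finset.mem_powerset] at h1
    refine (sum_fixed_cluster_le Λ C hx hy hy' R (fun s s' => hR C s s' h2 h1)
      (by split_ifs <;> positivity) (E C) ?_).trans_eq ?_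
    · rintro A B ⟨-, rfl, h4⟩
      exact ⟨saturated_comp hnbr _ _, comp_subset _ _ _, h4⟩
    · split_ifs <;> ring
  refine (Finset.sum_le_sum hC).trans ?_
  rw [← Finset.sum_mul, Finset.sum_add_distrib, ← Finset.mul_sum, ← Finset.mul_sum]
  have h1 := sum_animals_le hsymm hΔ hΔ0 e ht0 hα k₁ 𝒞 fun C hC => (Finset.mem_filter.1 hC).2
  have h2 := sum_animals_le hsymm hΔ hΔ0 e ht0 hα k₂ 𝒞 fun C hC => (Finset.mem_filter.1 hC).2
  gcongr

end Swap

/-! ### Comparison of two weights by the exchange of clusters -/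

section Compare

variable {V Q : Type*} [DecidableEq V] {bd : Q → Finset V} {P : Finset Q}

/-- The union of the clusters of `A ∪ B` on which one of the configurations has `chi Γ = -1`. -/
noncomputable def negClusters (nbr : V → Finset V) (Γ A B : Finset V) : Finset V :=
  (A ∪ B).filter fun e => Odd (A ∩ comp nbr (A ∪ B) e ∩ Γ).card ∨
    Odd (B ∩ comp nbr (A ∪ B) e ∩ Γ).card

lemma mem_negClusters {nbr : V → Finset V} {Γ A B : Finset V} {e : V} :
    e ∈ negClusters nbr Γ A B ↔ e ∈ A ∪ B ∧ (Odd (A ∩ comp nbr (A ∪ B) e ∩ Γ).card ∨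
    Odd (B ∩ comp nbr (A ∪ B) e ∩ Γ).card) := Finset.mem_filter

lemma mem_negClusters_of_mem_comp {nbr : V → Finset V} (hsymm : ∀ u v, v ∈ nbr u → u ∈ nbr v)
    {Γ A B : Finset V} {e e' : V} (he : e ∈ A ∪ B) (h : e' ∈ comp nbr (A ∪ B) e) :
    e' ∈ negClusters nbr Γ A B ↔ e ∈ negClusters nbr Γ A B := by
  rw [mem_negClusters, mem_negClusters, comp_eq_of_mem hsymm he h]
  simp [he, (mem_comp.1 h).1]

lemma saturated_negClusters {nbr : V → Finset V} (hsymm : ∀ u v, v ∈ nbr u → u ∈ nbr v)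
    (hnbr : ∀ p ∈ P, ∀ e ∈ bd p, ∀ e' ∈ bd p, e ≠ e' → e' ∈ nbr e) (Γ A B : Finset V) :
    Saturated bd P (A ∪ B) (negClusters nbr Γ A B) := by
  intro p hp ⟨e₁, h₁⟩ e₂ h₂
  rw [Finset.mem_inter] at h₁
  have h3 := (mem_negClusters.1 h₁.2).1
  have h4 := saturated_comp hnbr (A ∪ B) e₁ p hp
    ⟨e₁, Finset.mem_inter.2 ⟨h₁.1, self_mem_comp h3⟩⟩ h₂
  exact (mem_negClusters_of_mem_comp hsymm h3 h4).2 h₁.2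

lemma negClusters_exchange {nbr : V → Finset V} (hsymm : ∀ u v, v ∈ nbr u → u ∈ nbr v)
    (Γ A B : Finset V) :
    negClusters nbr Γ (exchange (negClusters nbr Γ A B) A B)
      (exchange (negClusters nbr Γ A B) B A) = negClusters nbr Γ A B := by
  set T := negClusters nbr Γ A B with hT
  ext e
  rw [mem_negClusters, exchange_union_exchange, hT, mem_negClusters, ← hT]
  refine and_congr_right fun he => ?_
  set C := comp nbr (A ∪ B) e with hC
  have hmem : ∀ e' ∈ C, e' ∈ T ↔ e ∈ T := fun e' he' => mem_negClusters_of_mem_comp hsymm he he'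
  by_cases h : e ∈ T
  · have h1 : ∀ A B, exchange T A B ∩ C = B ∩ C := by
      intro A B
      ext e'
      have := hmem e'
      simp only [exchange, Finset.mem_inter, Finset.mem_union, Finset.mem_sdiff]
      tauto
    rw [h1, h1, or_comm]
  · have h1 : ∀ A B, exchange T A B ∩ C = A ∩ C := by
      intro A B
      ext e'
      have := hmem e'
      simp only [exchange, Finset.mem_inter, Finset.mem_union, Finset.mem_sdiff]
      tauto
    rw [h1, h1]

lemma chi_sdiff_negClusters {nbr : V → Finset V} (hsymm : ∀ u v, v ∈ nbr u → u ∈ nbr v)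
    (Γ A B D : Finset V) (hD : D = A ∨ D = B) :
    chi Γ (D \ negClusters nbr Γ A B) = 1 := by
  have hDS : D ⊆ A ∪ B := by
    rcases hD with rfl | rfl
    · exact Finset.subset_union_left
    · exact Finset.subset_union_right
  set T := negClusters nbr Γ A B with hT
  rw [chi_eq_prod, ← Finset.prod_fiberwise_of_maps_to
    (t := (D \ T).image fun e => comp nbr (A ∪ B) e) (g := fun e => comp nbr (A ∪ B) e)
    fun e he => Finset.mem_image_of_mem _ he]
  refine Finset.prod_eq_one fun C hC => ?_
  obtain ⟨e, he, rfl⟩ := Finset.mem_image.1 hC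
  obtain ⟨he1, he2⟩ := Finset.mem_sdiff.1 he
  have heS := hDS he1
  rw [← chi_eq_prod]
  have hfib : (D \ T).filter (fun e' => comp nbr (A ∪ B) e' = comp nbr (A ∪ B) e) =
      D ∩ comp nbr (A ∪ B) e := by
    ext e'
    rw [Finset.mem_filter, Finset.mem_sdiff, Finset.mem_inter]
    constructor
    · rintro ⟨⟨h1, -⟩, h3⟩
      exact ⟨h1, h3 ▸ self_mem_comp (hDS h1)⟩
    · rintro ⟨h1, h2⟩
      exact ⟨⟨h1, fun h => he2 ((mem_negClusters_of_mem_comp hsymm heS h2).1 h)⟩,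
        comp_eq_of_mem hsymm heS h2⟩
  rw [hfib]
  refine (chi_eq_one_or _ _).resolve_right fun h => he2 ?_
  rw [chi_eq_neg_one_iff] at h
  rw [hT, mem_negClusters]
  rcases hD with rfl | rfl
  · exact ⟨heS, Or.inl h⟩
  · exact ⟨heS, Or.inr h⟩

open Classical in
/-- Two weights that differ only in the plaquette factors give to `chi Γ` averages that differ by
at most the probability of a cluster on which `chi Γ` is negative for one of the configurations
and which contains a vortex where the two factors differ. -/
lemma abs_sum_chi_sub_chi_le {nbr : V → Finset V} (hsymm : ∀ u v, v ∈ nbr u → u ∈ nbr v)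
    (hnbr : ∀ p ∈ P, ∀ e ∈ bd p, ∀ e' ∈ bd p, e ≠ e' → e' ∈ nbr e) (Λ Γ : Finset V) {x : ℝ}
    (hx : 0 ≤ x) {y y' : Q → ℝ} (hy : ∀ p, 0 ≤ y p) (hy' : ∀ p, 0 ≤ y' p)
    (R : Finset V → Finset V → Prop)
    (hR : ∀ s s', R s s' ↔ (chi Γ s = -1 ∨ chi Γ s' = -1) ∧
      ∃ p, (p ∈ vort bd P s ∨ p ∈ vort bd P s') ∧ y p ≠ y' p) :
    |∑ z ∈ Λ.powerset ×ˢ Λ.powerset,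
      wt bd P x y z.1 * wt bd P x y' z.2 * (chi Γ z.1 - chi Γ z.2)| ≤
    2 * ∑ e ∈ Γ, ∑ z ∈ Λ.powerset ×ˢ Λ.powerset,
      (if e ∈ z.1 ∪ z.2 ∧ R (z.1 ∩ comp nbr (z.1 ∪ z.2) e) (z.2 ∩ comp nbr (z.1 ∪ z.2) e)
        then wt bd P x y z.1 * wt bd P x y' z.2 else 0) := by
  set T := negClusters nbr Γ with hT
  set good : Finset V → Finset V → Prop := fun A B =>
    ∀ p, p ∈ vort bd P (A ∩ T A B) ∨ p ∈ vort bd P (B ∩ T A B) → y p = y' p with hgood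
  set W : Finset V × Finset V → ℝ := fun z => wt bd P x y z.1 * wt bd P x y' z.2 with hW
  have hW0 : ∀ z, 0 ≤ W z := fun z => mul_nonneg (wt_nonneg hx hy _) (wt_nonneg hx hy' _)
  have hzero := sum_exchange_eq_zero (bd := bd) (P := P) Λ x y y' T good
    (fun A B => chi Γ A - chi Γ B)
    (fun A B => negClusters_exchange hsymm Γ A B)
    (fun A B => saturated_negClusters hsymm hnbr Γ A B)
    (by
      intro A B h p
      simp only [hT, negClusters_exchange hsymm Γ A B, exchange_inter]
      exact fun hp => h p hp.symm)
    (fun A B h => h)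
    (by
      intro A B _
      -- off the exchanged clusters both characters equal `1`, so the exchange swaps them
      have h1 := chi_sdiff_negClusters hsymm Γ A B A (Or.inl rfl)
      have h2 := chi_sdiff_negClusters hsymm Γ A B B (Or.inr rfl)
      rw [chi_split Γ (exchange _ _ _) (T A B), chi_split Γ (exchange (T A B) B A) (T A B),
        exchange_inter, exchange_inter, exchange_sdiff, exchange_sdiff, chi_split Γ A (T A B),
        chi_split Γ B (T A B), hT, h1, h2]
      ring)
  -- a vortex where the weights differ lies in a single cluster, and this cluster meets `Γ`
  have hbad : ∀ A B, ¬ good A B → ∃ e ∈ Γ, e ∈ A ∪ B ∧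
      R (A ∩ comp nbr (A ∪ B) e) (B ∩ comp nbr (A ∪ B) e) := by
    intro A B h
    simp only [hgood, not_forall] at h
    obtain ⟨p, hp, hne⟩ := h
    have key : ∀ D, D = A ∨ D = B → p ∈ vort bd P (D ∩ T A B) → ∃ e₁ ∈ T A B,
        p ∈ vort bd P (D ∩ comp nbr (A ∪ B) e₁) := by
      intro D hD hpD
      obtain ⟨hpP, hodd⟩ := mem_vort.1 hpD
      obtain ⟨e₁, he₁⟩ := Finset.card_pos.1 hodd.pos
      rw [Finset.mem_inter, Finset.mem_inter] at he₁
      have he₁S := (mem_negClusters.1 he₁.1.2).1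
      refine ⟨e₁, he₁.1.2, mem_vort.2 ⟨hpP, ?_⟩⟩
      have hsub := saturated_comp hnbr (A ∪ B) e₁ p hpP
        ⟨e₁, Finset.mem_inter.2 ⟨he₁.2, self_mem_comp he₁S⟩⟩
      convert hodd using 2
      ext e'
      have h1 := @hsub e'
      have h2 : e' ∈ comp nbr (A ∪ B) e₁ → e' ∈ T A B := fun h =>
        (mem_negClusters_of_mem_comp hsymm he₁S h).2 he₁.1.2
      have h3 : e' ∈ D → e' ∈ A ∪ B := by
        rcases hD with rfl | rfl <;> intro h <;> simp [h]
      simp only [Finset.mem_inter] at *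
      tauto
    obtain ⟨e₁, he₁, hp1⟩ : ∃ e₁ ∈ T A B, p ∈ vort bd P (A ∩ comp nbr (A ∪ B) e₁) ∨
        p ∈ vort bd P (B ∩ comp nbr (A ∪ B) e₁) := by
      rcases hp with hp | hp
      · obtain ⟨e₁, h1, h2⟩ := key A (Or.inl rfl) hp
        exact ⟨e₁, h1, Or.inl h2⟩
      · obtain ⟨e₁, h1, h2⟩ := key B (Or.inr rfl) hp
        exact ⟨e₁, h1, Or.inr h2⟩
    obtain ⟨heS, hodd⟩ := mem_negClusters.1 he₁
    obtain ⟨e, heC, heΓ⟩ : ∃ e ∈ comp nbr (A ∪ B) e₁, e ∈ Γ := by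
      rcases hodd with h | h
      all_goals
        obtain ⟨e, he⟩ := Finset.card_pos.1 h.pos
        rw [Finset.mem_inter, Finset.mem_inter] at he
        exact ⟨e, he.1.2, he.2⟩
    refine ⟨e, heΓ, comp_subset _ _ _ heC, ?_⟩
    rw [comp_eq_of_mem hsymm heS heC, hR, chi_eq_neg_one_iff, chi_eq_neg_one_iff]
    exact ⟨hodd, p, hp1, hne⟩
  have hsplit : ∑ z ∈ Λ.powerset ×ˢ Λ.powerset, W z * (chi Γ z.1 - chi Γ z.2) =
      ∑ z ∈ Λ.powerset ×ˢ Λ.powerset,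
        if good z.1 z.2 then 0 else W z * (chi Γ z.1 - chi Γ z.2) := by
    refine Eq.trans ?_ ((congrArg _ hzero).trans (add_zero _))
    rw [← Finset.sum_add_distrib]
    refine Finset.sum_congr rfl fun z _ => ?_
    split_ifs <;> simp [hW]
  rw [hsplit, Finset.sum_comm, Finset.mul_sum]
  refine (Finset.abs_sum_le_sum_abs _ _).trans (Finset.sum_le_sum fun z _ => ?_)
  split_ifs with hg
  · rw [abs_zero]
    refine mul_nonneg zero_le_two (Finset.sum_nonneg fun e _ => ?_)
    split_ifs
    exacts [hW0 z, le_rfl]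
  · obtain ⟨e, he, h⟩ := hbad _ _ hg
    have h1 : |W z * (chi Γ z.1 - chi Γ z.2)| ≤ 2 * W z := by
      rw [abs_mul, abs_of_nonneg (hW0 z), mul_comm]
      refine mul_le_mul_of_nonneg_right ((abs_sub _ _).trans ?_) (hW0 z)
      rw [abs_chi, abs_chi]
      norm_num
    refine h1.trans (mul_le_mul_of_nonneg_left ?_ zero_le_two)
    refine le_trans (le_of_eq ?_) (Finset.single_le_sum (fun e _ => ?_) he)
    · rw [if_pos h]
    · split_ifs
      exacts [hW0 z, le_rfl]

open Classical in
/-- The event `e ∈ A` is independent of `chi Γ`, and has the same probability for two weights that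
differ only in the plaquette factors, up to the probability that the cluster of `e` contains a
vortex where the factors differ or contributes to `chi Γ`. -/
lemma abs_sum_chi_mul_mem_sub_le {nbr : V → Finset V}
    (hnbr : ∀ p ∈ P, ∀ e ∈ bd p, ∀ e' ∈ bd p, e ≠ e' → e' ∈ nbr e) (Λ Γ : Finset V) (e : V)
    {x : ℝ} (hx : 0 ≤ x) {y y' : Q → ℝ} (hy : ∀ p, 0 ≤ y p) (hy' : ∀ p, 0 ≤ y' p)
    (R : Finset V → Finset V → Prop)
    (hR : ∀ s s', R s s' ↔ chi Γ s ≠ chi Γ s' ∨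
      ∃ p, (p ∈ vort bd P s ∨ p ∈ vort bd P s') ∧ y p ≠ y' p) :
    |∑ z ∈ Λ.powerset ×ˢ Λ.powerset, wt bd P x y z.1 * wt bd P x y' z.2 *
      (chi Γ z.1 * ((if e ∈ z.1 then 1 else 0) - if e ∈ z.2 then 1 else 0))| ≤
    ∑ z ∈ Λ.powerset ×ˢ Λ.powerset,
      (if e ∈ z.1 ∪ z.2 ∧ R (z.1 ∩ comp nbr (z.1 ∪ z.2) e) (z.2 ∩ comp nbr (z.1 ∪ z.2) e)
        then wt bd P x y z.1 * wt bd P x y' z.2 else 0) := by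
  set T : Finset V → Finset V → Finset V := fun A B => comp nbr (A ∪ B) e with hT
  set good : Finset V → Finset V → Prop := fun A B => chi Γ (A ∩ T A B) = chi Γ (B ∩ T A B) ∧
    ∀ p, p ∈ vort bd P (A ∩ T A B) ∨ p ∈ vort bd P (B ∩ T A B) → y p = y' p with hgood
  set W : Finset V × Finset V → ℝ := fun z => wt bd P x y z.1 * wt bd P x y' z.2 with hW
  have hW0 : ∀ z, 0 ≤ W z := fun z => mul_nonneg (wt_nonneg hx hy _) (wt_nonneg hx hy' _)
  set F : Finset V → Finset V → ℝ := fun A B =>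
    chi Γ A * ((if e ∈ A then 1 else 0) - if e ∈ B then 1 else 0) with hF
  have hTex : ∀ A B, T (exchange (T A B) A B) (exchange (T A B) B A) = T A B := by
    intro A B
    simp only [hT, exchange_union_exchange]
  have hFout : ∀ A B, e ∉ A ∪ B → F A B = 0 := by
    intro A B h
    rw [Finset.mem_union, not_or] at h
    simp [hF, h.1, h.2]
  have hzero := sum_exchange_eq_zero (bd := bd) (P := P) Λ x y y' T good F hTex
    (fun A B => saturated_comp hnbr _ _)
    (by
      intro A B h
      simp only [hgood, hTex, exchange_inter]
      exact ⟨h.1.symm, fun p hp => h.2 p hp.symm⟩)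
    (fun A B h => h.2)
    (by
      intro A B h
      by_cases he : e ∈ A ∪ B
      · have heT : e ∈ T A B := self_mem_comp he
        have h1 : e ∈ exchange (T A B) A B ↔ e ∈ B := by simp [exchange, heT]
        have h2 : e ∈ exchange (T A B) B A ↔ e ∈ A := by simp [exchange, heT]
        -- the difference of the indicators changes its sign, and the character is preserved
        simp only [hF, h1, h2]
        rw [chi_split Γ (exchange _ _ _) (T A B), exchange_inter, exchange_sdiff,
          chi_split Γ A (T A B), h.1]
        ring
      · rw [hFout A B he, hFout _ _ (by rwa [exchange_union_exchange]), neg_zero])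
  have hsplit : ∑ z ∈ Λ.powerset ×ˢ Λ.powerset, W z * F z.1 z.2 =
      ∑ z ∈ Λ.powerset ×ˢ Λ.powerset, if good z.1 z.2 then 0 else W z * F z.1 z.2 := by
    refine Eq.trans ?_ ((congrArg _ hzero).trans (add_zero _))
    rw [← Finset.sum_add_distrib]
    refine Finset.sum_congr rfl fun z _ => ?_
    split_ifs <;> simp [hW]
  rw [hsplit]
  refine (Finset.abs_sum_le_sum_abs _ _).trans (Finset.sum_le_sum fun z _ => ?_)
  by_cases he : e ∈ z.1 ∪ z.2
  · by_cases hg : good z.1 z.2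
    · rw [if_pos hg, abs_zero]
      split_ifs
      exacts [hW0 z, le_rfl]
    · rw [if_neg hg, if_pos]
      · rw [abs_mul, abs_of_nonneg (hW0 z), abs_mul, abs_chi, one_mul]
        refine mul_le_of_le_one_right (hW0 z) ?_
        split_ifs <;> norm_num
      · refine ⟨he, (hR _ _).2 ?_⟩
        by_contra hcon
        simp only [not_or, not_not, not_exists, not_and] at hcon
        exact hg ⟨hcon.1, hcon.2⟩
  · rw [hFout _ _ he]
    simp [he]

end Compare

/-! ### Plaquettes and neighbouring edges of `ℤ⁴` -/

/-- The plane spanned by two distinct directions, in either order. -/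
def plane (i k : Fin 4) (h : i ≠ k) : {q : Fin 4 × Fin 4 // q.1 < q.2} :=
  if h' : i < k then ⟨(i, k), h'⟩ else ⟨(k, i), lt_of_le_of_ne (not_lt.1 h') h.symm⟩

/-- The four edges of a plaquette. -/
def bdry (p : PosPlaquette) : Finset PosEdge :=
  {(p.1, p.2.1.1), (p.1 + unit p.2.1.1, p.2.1.2), (p.1 + unit p.2.1.2, p.2.1.1), (p.1, p.2.1.2)}

lemma mem_bdry_plane {a : Vertex} {i k : Fin 4} (h : i ≠ k) {e : PosEdge} :
    e ∈ bdry (a, plane i k h) ↔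
      e = (a, i) ∨ e = (a + unit i, k) ∨ e = (a + unit k, i) ∨ e = (a, k) := by
  unfold plane
  split_ifs
  · simp only [bdry, Finset.mem_insert, Finset.mem_singleton]
  · simp only [bdry, Finset.mem_insert, Finset.mem_singleton]
    tauto

lemma plane_injective {i k k' : Fin 4} {h : i ≠ k} {h' : i ≠ k'}
    (hp : plane i k h = plane i k' h') : k = k' := by
  unfold plane at hp
  split_ifs at hp <;> simp only [Subtype.mk.injEq, Prod.mk.injEq] at hp <;> omega

lemma plane_surj (q : {q : Fin 4 × Fin 4 // q.1 < q.2}) : q = plane q.1.1 q.1.2 q.2.ne := by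
  rw [plane, dif_pos q.2]

lemma exists_eq_plane (p : PosPlaquette) : ∃ a i k, ∃ h : i ≠ k, p = (a, plane i k h) :=
  ⟨p.1, p.2.1.1, p.2.1.2, p.2.2.ne, Prod.ext rfl (plane_surj p.2)⟩

lemma plane_comm {i k : Fin 4} (h : i ≠ k) : plane i k h = plane k i h.symm := by
  unfold plane
  split_ifs <;> first | rfl | omega

@[simp] lemma unit_same (i : Fin 4) : unit i i = 1 := by simp [unit]

lemma nsmul_unit_apply (h : ℕ) (k : Fin 4) : (h • unit k) k = h := by
  rw [Pi.smul_apply, unit_same, nsmul_eq_mul, mul_one]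

lemma unit_of_ne {i c : Fin 4} (h : c ≠ i) : unit i c = 0 := by simp [unit, h]

lemma unit_eq (i c : Fin 4) : unit i c = if c = i then 1 else 0 := by
  simp [unit, Pi.single_apply]

/-- The plaquettes through an edge all lie in a plane spanned by it and another direction. -/
lemma exists_plane_of_mem {e : PosEdge} {p : PosPlaquette} (h : e ∈ bdry p) :
    ∃ k, ∃ hk : e.2 ≠ k, p = (e.1, plane e.2 k hk) ∨ p = (e.1 - unit k, plane e.2 k hk) := by
  obtain ⟨a, i, k, hik, rfl⟩ := exists_eq_plane p
  rw [mem_bdry_plane] at h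
  rcases h with rfl | rfl | rfl | rfl
  · exact ⟨k, hik, Or.inl rfl⟩
  · exact ⟨i, hik.symm, Or.inr (by simp [plane_comm hik])⟩
  · exact ⟨k, hik, Or.inr (by simp)⟩
  · exact ⟨i, hik.symm, Or.inl (by simp [plane_comm hik])⟩

/-- The at most `18` edges that share a plaquette with `e`. -/
def nbr (e : PosEdge) : Finset PosEdge :=
  (Finset.univ.erase e.2).biUnion fun k =>
    {(e.1 + unit k, e.2), (e.1, k), (e.1 + unit e.2, k),
      (e.1 - unit k, e.2), (e.1 - unit k, k), (e.1 - unit k + unit e.2, k)}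

lemma mem_nbr {e e' : PosEdge} : e' ∈ nbr e ↔ ∃ k, k ≠ e.2 ∧
    (e' = (e.1 + unit k, e.2) ∨ e' = (e.1, k) ∨ e' = (e.1 + unit e.2, k) ∨
      e' = (e.1 - unit k, e.2) ∨ e' = (e.1 - unit k, k) ∨ e' = (e.1 - unit k + unit e.2, k)) := by
  simp [nbr]

lemma card_nbr_le (e : PosEdge) : (nbr e).card ≤ 18 := by
  have h := Finset.card_biUnion_le_card_mul (Finset.univ.erase e.2) (fun k =>
    ({(e.1 + unit k, e.2), (e.1, k), (e.1 + unit e.2, k),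
      (e.1 - unit k, e.2), (e.1 - unit k, k), (e.1 - unit k + unit e.2, k)} : Finset PosEdge)) 6
    (fun k _ => Finset.card_le_six)
  rw [Finset.card_erase_of_mem (Finset.mem_univ _), Finset.card_univ, Fintype.card_fin] at h
  exact h

lemma nbr_symm (e e' : PosEdge) (h : e' ∈ nbr e) : e ∈ nbr e' := by
  obtain ⟨a, i⟩ := e
  obtain ⟨k, hk, h⟩ := mem_nbr.1 h
  dsimp only at hk h
  rw [mem_nbr]
  rcases h with rfl | rfl | rfl | rfl | rfl | rfl
  · exact ⟨k, hk, by simp⟩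
  · exact ⟨i, hk.symm, by simp⟩
  · exact ⟨i, hk.symm, by simp⟩
  · exact ⟨k, hk, by simp⟩
  · exact ⟨i, hk.symm, by simp⟩
  · refine ⟨i, hk.symm, ?_⟩
    have : a = a - unit k + unit i - unit i + unit k := by abel
    simp only [← this]
    simp

lemma mem_nbr_of_mem_bdry (p : PosPlaquette) (e : PosEdge) (he : e ∈ bdry p) (e' : PosEdge)
    (he' : e' ∈ bdry p) (hne : e ≠ e') : e' ∈ nbr e := by
  obtain ⟨k, hk, rfl | rfl⟩ := exists_plane_of_mem he
  · rw [mem_bdry_plane] at he'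
    refine mem_nbr.2 ⟨k, hk.symm, ?_⟩
    rcases he' with rfl | rfl | rfl | rfl
    · exact absurd rfl hne
    all_goals simp
  · rw [mem_bdry_plane] at he'
    refine mem_nbr.2 ⟨k, hk.symm, ?_⟩
    rcases he' with rfl | rfl | h | rfl
    · simp
    · simp
    · exact absurd (by rw [h]; simp) hne
    · simp

/-! ### Forms with finite support on `ℤ⁴` -/

/-- The indicator function of `s`, as a `ℤ/2`-valued form. -/
def ind (s : Finset PosEdge) (e : PosEdge) : ZMod 2 := if e ∈ s then 1 else 0

/-- The exterior derivative of the indicator function of `s` at the plaquette at `a` in the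
directions `i` and `k`. -/
def curl (s : Finset PosEdge) (a : Vertex) (i k : Fin 4) : ZMod 2 :=
  ind s (a, i) + ind s (a + unit i, k) + ind s (a + unit k, i) + ind s (a, k)

lemma zmod_two_eq (z : ZMod 2) : z = 0 ∨ z = 1 := by revert z; decide

lemma card_inter_eq_sum_ind (s F : Finset PosEdge) :
    ((s ∩ F).card : ZMod 2) = ∑ e ∈ F, ind s e := by
  simp only [ind]
  rw [Finset.sum_boole, Finset.inter_comm, Finset.filter_mem_eq_inter]

lemma unit_ne_zero (i : Fin 4) : unit i ≠ 0 := fun h => by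
  have := congrFun h i
  simp at this

lemma odd_inter_bdry (s : Finset PosEdge) (a : Vertex) {i k : Fin 4} (h : i ≠ k) :
    Odd (s ∩ bdry (a, plane i k h)).card ↔ curl s a i k = 1 := by
  rw [← ZMod.natCast_eq_one_iff_odd, card_inter_eq_sum_ind]
  have : bdry (a, plane i k h) = {(a, i), (a + unit i, k), (a + unit k, i), (a, k)} := by
    ext e
    rw [mem_bdry_plane]
    simp
  have h1 := unit_ne_zero i
  have h2 := unit_ne_zero k
  rw [this, Finset.sum_insert, Finset.sum_insert, Finset.sum_insert, Finset.sum_singleton, curl,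
    add_assoc, add_assoc]
  all_goals simp [h, h.symm, h1, h2]

/-- The sum of the indicator function of `s` over the line through `u` in direction `i`,
restricted to coordinates at most `M` in absolute value. -/
def lineSum (s : Finset PosEdge) (M : ℕ) (i : Fin 4) (u : Vertex) : ZMod 2 :=
  ∑ n ∈ Finset.range (2 * M + 1), ind s (Function.update u i ((n : ℤ) - M), i)

lemma sum_range_add_succ (g : ℕ → ZMod 2) (n : ℕ) :
    ∑ m ∈ Finset.range n, (g (m + 1) + g m) = g n + g 0 := by
  induction n with
  | zero => simp [CharTwo.add_self_eq_zero]
  | succ n ih =>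
    rw [Finset.sum_range_succ, ih]
    linear_combination CharTwo.add_self_eq_zero (g n)

section Lines

variable {s : Finset PosEdge} {M : ℕ} (hs : ∀ e ∈ s, ∀ c, |e.1 c| < M)
include hs

/-- A discrete Stokes theorem on the strip between two neighbouring lines. -/
lemma lineSum_add_lineSum {i k : Fin 4} (hik : i ≠ k) (u : Vertex) :
    lineSum s M i u + lineSum s M i (u + unit k) =
      ∑ n ∈ Finset.range (2 * M + 1), curl s (Function.update u i ((n : ℤ) - M)) i k := by
  have h1 : ∀ n : ℕ, Function.update u i ((n : ℤ) - M) + unit i =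
      Function.update u i (((n + 1 : ℕ) : ℤ) - M) := by
    intro n
    ext c
    by_cases hc : c = i
    · subst hc; simp; ring
    · simp [hc, unit_of_ne hc]
  have h2 : ∀ n : ℕ, Function.update (u + unit k) i ((n : ℤ) - M) =
      Function.update u i ((n : ℤ) - M) + unit k := by
    intro n
    ext c
    by_cases hc : c = i
    · subst hc; simp [unit_of_ne hik]
    · simp [hc]
  have h3 := sum_range_add_succ (fun n => ind s (Function.update u i ((n : ℤ) - M), k)) (2 * M + 1)
  have h4 : ∀ n : ℕ, (n = 0 ∨ n = 2 * M + 1) →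
      ind s (Function.update u i ((n : ℤ) - M), k) = 0 := by
    intro n hn
    rw [ind, if_neg]
    intro hmem
    have := hs _ hmem i
    simp only [Function.update_self, abs_lt] at this
    rcases hn with rfl | rfl
    · push_cast at this; omega
    · push_cast at this; omega
  rw [h4 _ (Or.inl rfl), h4 _ (Or.inr rfl), add_zero] at h3
  simp only [lineSum, curl]
  rw [← Finset.sum_add_distrib, ← add_zero (∑ n ∈ Finset.range (2 * M + 1), _), ← h3,
    ← Finset.sum_add_distrib]
  refine Finset.sum_congr rfl fun n _ => ?_
  rw [h1, h2]
  ring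

lemma exists_curl_of_lineSum_ne {i k : Fin 4} (hik : i ≠ k) {u : Vertex}
    (h : lineSum s M i u + lineSum s M i (u + unit k) ≠ 0) :
    ∃ a, curl s a i k = 1 ∧ ∀ c, c ≠ i → a c = u c := by
  rw [lineSum_add_lineSum hs hik] at h
  obtain ⟨n, -, hn⟩ := Finset.exists_ne_zero_of_sum_ne_zero h
  exact ⟨_, (zmod_two_eq _).resolve_left hn, fun c hc => by simp [hc]⟩

lemma lineSum_eq_zero {i k : Fin 4} (hik : i ≠ k) {u : Vertex} (hu : (M : ℤ) ≤ |u k|) :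
    lineSum s M i u = 0 := by
  refine Finset.sum_eq_zero fun n _ => ?_
  rw [ind, if_neg]
  intro h
  have := hs _ h k
  simp only [Function.update_of_ne hik.symm] at this
  omega

/-- Along a ray orthogonal to a line with odd sum there is a vortex, which is next to the line if
the sum over the neighbouring line is even. -/
lemma exists_curl_pos {i k : Fin 4} (hik : i ≠ k) {u : Vertex} (hu : lineSum s M i u = 1) :
    ∃ a, curl s a i k = 1 ∧ (∀ c, c ≠ i → c ≠ k → a c = u c) ∧ u k ≤ a k ∧
      (lineSum s M i (u + unit k) = 0 → a k = u k) := by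
  have hex : ∃ h : ℕ, lineSum s M i (u + h • unit k) ≠ 1 := by
    refine ⟨M + (u k).natAbs, ?_⟩
    rw [lineSum_eq_zero hs hik]
    · exact zero_ne_one
    · rw [Pi.add_apply, nsmul_unit_apply]
      push_cast
      rw [le_abs]
      left
      have := neg_abs_le (u k)
      omega
  classical
  obtain ⟨h, hh⟩ : ∃ h, Nat.find hex = h + 1 := by
    refine Nat.exists_eq_succ_of_ne_zero fun h0 => Nat.find_spec hex ?_
    rw [h0, zero_smul, add_zero, hu]
  have h1 : lineSum s M i (u + h • unit k) = 1 := by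
    by_contra hc
    have := Nat.find_min' hex hc
    omega
  have h2 : lineSum s M i (u + h • unit k + unit k) = 0 := by
    have := (zmod_two_eq _).resolve_right (Nat.find_spec hex)
    rwa [hh, add_smul, one_smul, ← add_assoc] at this
  obtain ⟨a, ha, hac⟩ := exists_curl_of_lineSum_ne hs hik (u := u + h • unit k) (by
    rw [h1, h2]; decide)
  have hak := hac k hik.symm
  rw [Pi.add_apply, nsmul_unit_apply] at hak
  refine ⟨a, ha, fun c hc hck => ?_, by omega, fun h0 => ?_⟩
  · rw [hac c hc]
    simp [unit_of_ne hck]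
  · have h3 : lineSum s M i (u + 1 • unit k) ≠ 1 := by
      rw [one_smul, h0]; decide
    have := Nat.find_min' hex h3
    obtain rfl : h = 0 := by omega
    simpa using hak

lemma exists_curl_neg {i k : Fin 4} (hik : i ≠ k) {u : Vertex} (hu : lineSum s M i u = 1) :
    ∃ a, curl s a i k = 1 ∧ (∀ c, c ≠ i → c ≠ k → a c = u c) ∧ a k < u k ∧
      (lineSum s M i (u - unit k) = 0 → a k = u k - 1) := by
  have hex : ∃ h : ℕ, lineSum s M i (u - h • unit k) ≠ 1 := by
    refine ⟨M + (u k).natAbs, ?_⟩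
    rw [lineSum_eq_zero hs hik]
    · exact zero_ne_one
    · rw [Pi.sub_apply, nsmul_unit_apply]
      push_cast
      rw [le_abs]
      right
      have := le_abs_self (u k)
      omega
  classical
  obtain ⟨h, hh⟩ : ∃ h, Nat.find hex = h + 1 := by
    refine Nat.exists_eq_succ_of_ne_zero fun h0 => Nat.find_spec hex ?_
    rw [h0, zero_smul, sub_zero, hu]
  have h1 : lineSum s M i (u - h • unit k) = 1 := by
    by_contra hc
    have := Nat.find_min' hex hc
    omega
  have h2 : lineSum s M i (u - (h + 1) • unit k) = 0 := by
    have := (zmod_two_eq _).resolve_right (Nat.find_spec hex)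
    rwa [hh] at this
  have h3 : u - (h + 1) • unit k + unit k = u - h • unit k := by
    rw [add_smul, one_smul]; abel
  obtain ⟨a, ha, hac⟩ := exists_curl_of_lineSum_ne hs hik (u := u - (h + 1) • unit k) (by
    rw [h3, h1, h2]; decide)
  have hak := hac k hik.symm
  rw [Pi.sub_apply, nsmul_unit_apply] at hak
  push_cast at hak
  refine ⟨a, ha, fun c hc hck => ?_, by omega, fun h0 => ?_⟩
  · rw [hac c hc]
    simp [unit_of_ne hck]
  · have h4 : lineSum s M i (u - 1 • unit k) ≠ 1 := by
      rw [one_smul, h0]; decide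
    have := Nat.find_min' hex h4
    obtain rfl : h = 0 := by omega
    simpa using hak

/-- The vortices on the six rays orthogonal to a line with odd sum. -/
lemma exists_six_vortices {i : Fin 4} {u : Vertex} (hu : lineSum s M i u = 1) :
    ∃ a : {k : Fin 4 // i ≠ k} × Bool → Vertex, ∀ t,
      curl s (a t) i t.1 = 1 ∧ (∀ c, c ≠ i → c ≠ t.1 → a t c = u c) ∧
      (t.2 = true → u t.1 ≤ a t t.1) ∧ (t.2 = false → a t t.1 < u t.1) ∧
      (t.2 = true → lineSum s M i (u + unit t.1) = 0 → a t t.1 = u t.1) ∧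
      (t.2 = false → lineSum s M i (u - unit t.1) = 0 → a t t.1 = u t.1 - 1) := by
  have : ∀ t : {k : Fin 4 // i ≠ k} × Bool, ∃ a : Vertex,
      curl s a i t.1 = 1 ∧ (∀ c, c ≠ i → c ≠ t.1 → a c = u c) ∧
      (t.2 = true → u t.1 ≤ a t.1) ∧ (t.2 = false → a t.1 < u t.1) ∧
      (t.2 = true → lineSum s M i (u + unit t.1) = 0 → a t.1 = u t.1) ∧
      (t.2 = false → lineSum s M i (u - unit t.1) = 0 → a t.1 = u t.1 - 1) := by
    rintro ⟨⟨k, hk⟩, b⟩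
    cases b
    · obtain ⟨a, h1, h2, h3, h4⟩ := exists_curl_neg hs hk hu
      exact ⟨a, h1, h2, by simp, fun _ => h3, by simp, fun _ => h4⟩
    · obtain ⟨a, h1, h2, h3, h4⟩ := exists_curl_pos hs hk hu
      exact ⟨a, h1, h2, fun _ => h3, by simp, fun _ => h4, by simp⟩
  choose a ha using this
  exact ⟨a, ha⟩

/-- If the sum over some line is odd, there are at least six vortices, and at least seven if
there is one that does not touch the line. -/
lemma card_vortices {i : Fin 4} {u : Vertex} (hu : lineSum s M i u = 1)
    {W : Finset PosPlaquette} (hW : ∀ p, Odd (s ∩ bdry p).card → p ∈ W) :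
    6 ≤ W.card ∧ ∀ p₀ ∈ W,
      (∀ e ∈ bdry p₀, e.2 = i → ∃ c, c ≠ i ∧ e.1 c ≠ u c) → 7 ≤ W.card := by
  obtain ⟨a, ha⟩ := exists_six_vortices hs hu
  set p : {k : Fin 4 // i ≠ k} × Bool → PosPlaquette := fun t => (a t, plane i t.1 t.1.2) with hp
  have hpW : ∀ t, p t ∈ W := fun t => hW _ ((odd_inter_bdry s _ _).2 (ha t).1)
  have hpi : Function.Injective p := by
    rintro ⟨k, b⟩ ⟨k', b'⟩ h
    have h1 : a (k, b) = a (k', b') := congrArg Prod.fst h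
    have h2 : k = k' := Subtype.ext
      (plane_injective (h := k.2) (h' := k'.2) (congrArg Prod.snd h))
    subst h2
    obtain ⟨-, -, h3, h4, -⟩ := ha (k, b)
    obtain ⟨-, -, h5, h6, -⟩ := ha (k, b')
    rw [h1] at h3 h4
    cases b <;> cases b' <;> simp at *
    · exact absurd h4 (not_lt.2 h5)
    · exact absurd h6 (not_lt.2 h3)
  have hcard : Fintype.card ({k : Fin 4 // i ≠ k} × Bool) = 6 := by
    clear * -
    revert i; decide
  have h6 : (Finset.univ.image p).card = 6 := by
    rw [Finset.card_image_of_injective _ hpi, Finset.card_univ, hcard]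
  have hsub : Finset.univ.image p ⊆ W := by
    intro q hq
    obtain ⟨t, -, rfl⟩ := Finset.mem_image.1 hq
    exact hpW t
  refine ⟨h6 ▸ Finset.card_le_card hsub, fun p₀ hp₀ hline => ?_⟩
  -- A seventh vortex: either all six vortices found so far are next to the line, and `p₀` is
  -- not, or a neighbouring line is odd as well and sends out rays of its own.
  obtain ⟨p₁, hp₁, hne⟩ : ∃ p₁ ∈ W, ∀ t, p t ≠ p₁ := by
    by_cases hnear : ∀ k, i ≠ k → lineSum s M i (u + unit k) = 0 ∧ lineSum s M i (u - unit k) = 0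
    · refine ⟨p₀, hp₀, ?_⟩
      rintro ⟨⟨k, hk⟩, b⟩ rfl
      obtain ⟨-, h2, -, -, h5, h6⟩ := ha (⟨k, hk⟩, b)
      cases b
      · have h7 := h6 rfl (hnear k hk).2
        obtain ⟨c, hc, hc'⟩ := hline (a (⟨k, hk⟩, false) + unit k, i)
          ((mem_bdry_plane hk).2 (by simp)) rfl
        apply hc'
        by_cases hck : c = k
        · subst hck; simp only [Pi.add_apply, unit_same]; rw [h7]; ring
        · simp only [Pi.add_apply, unit_of_ne hck, add_zero]; exact h2 c hc hck
      · have h7 := h5 rfl (hnear k hk).1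
        obtain ⟨c, hc, hc'⟩ := hline (a (⟨k, hk⟩, true), i)
          ((mem_bdry_plane hk).2 (by simp)) rfl
        apply hc'
        by_cases hck : c = k
        · subst hck; exact h7
        · exact h2 c hc hck
    · push Not at hnear
      obtain ⟨k, hk, hk'⟩ := hnear
      obtain ⟨v, hv, hvk⟩ : ∃ v : Vertex, lineSum s M i v = 1 ∧ v k ≠ u k := by
        by_cases h0 : lineSum s M i (u + unit k) = 0
        · exact ⟨u - unit k, (zmod_two_eq _).resolve_left (hk' h0), by simp⟩
        · exact ⟨u + unit k, (zmod_two_eq _).resolve_left h0, by simp⟩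
      obtain ⟨l, hil, hlk⟩ : ∃ l : Fin 4, i ≠ l ∧ k ≠ l := by
        clear * -
        revert i k; decide
      obtain ⟨a', h1, h2, -⟩ := exists_curl_pos hs hil hv
      refine ⟨(a', plane i l hil), hW _ ((odd_inter_bdry s _ _).2 h1), ?_⟩
      rintro ⟨⟨k', hk''⟩, b⟩ h
      have h3 : a (⟨k', hk''⟩, b) = a' := congrArg Prod.fst h
      have h4 : k' = l := plane_injective (h := hk'') (h' := hil) (congrArg Prod.snd h)
      subst h4
      have h5 := (ha (⟨k', hk''⟩, b)).2.1 k hk.symm hlk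
      rw [h3, h2 k hk.symm hlk] at h5
      exact hvk h5
  have hnot : p₁ ∉ Finset.univ.image p := fun h => by
    obtain ⟨t, -, ht⟩ := Finset.mem_image.1 h
    exact hne t ht
  calc 7 = (insert p₁ (Finset.univ.image p)).card := by
        rw [Finset.card_insert_of_notMem hnot, h6]
    _ ≤ W.card := Finset.card_le_card (Finset.insert_subset hp₁ hsub)

end Lines

/-! ### Distances -/

lemma unit_eq_zero_or_one (i c : Fin 4) : unit i c = 0 ∨ unit i c = 1 := by
  rw [unit_eq]; split_ifs <;> simp

/-- The supremum distance on `ℤ⁴`. -/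
def supDist (v w : Vertex) : ℕ := Finset.univ.sup fun c => (v c - w c).natAbs

lemma supDist_le {v w : Vertex} {k : ℕ} : supDist v w ≤ k ↔ ∀ c, |v c - w c| ≤ k := by
  simp only [supDist, Finset.sup_le_iff, Finset.mem_univ, true_implies]
  exact forall_congr' fun c => by rw [Int.abs_eq_natAbs]; omega

lemma abs_sub_le_supDist (v w : Vertex) (c : Fin 4) : |v c - w c| ≤ supDist v w :=
  supDist_le.1 le_rfl c

lemma supDist_self (v : Vertex) : supDist v v = 0 :=
  Nat.le_zero.1 (supDist_le.2 fun c => by simp)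

lemma supDist_triangle (u v w : Vertex) : supDist u w ≤ supDist u v + supDist v w := by
  rw [supDist_le]
  intro c
  have h1 := abs_sub_le_supDist u v c
  have h2 := abs_sub_le_supDist v w c
  push_cast
  exact (abs_sub_le _ (v c) _).trans (add_le_add h1 h2)

lemma supDist_le_one_of_mem_nbr {e e' : PosEdge} (h : e' ∈ nbr e) : supDist e.1 e'.1 ≤ 1 := by
  obtain ⟨k, hk, h⟩ := mem_nbr.1 h
  rw [supDist_le]
  intro c
  have h1 := unit_eq_zero_or_one e.2 c
  have h2 := unit_eq_zero_or_one k c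
  rw [abs_le]
  rcases h with rfl | rfl | rfl | rfl | rfl | rfl <;>
    simp only [Pi.add_apply, Pi.sub_apply] <;> push_cast <;> omega

lemma supDist_le_one_of_mem_bdry {p : PosPlaquette} {e e' : PosEdge} (h : e ∈ bdry p)
    (h' : e' ∈ bdry p) : supDist e.1 e'.1 ≤ 1 := by
  by_cases hne : e = e'
  · rw [hne, supDist_self]; exact zero_le_one
  · exact supDist_le_one_of_mem_nbr (mem_nbr_of_mem_bdry p e h e' h' hne)

lemma Animal.supDist_lt {e e' : PosEdge} {C : Finset PosEdge} (h : Animal nbr e C) (he' : e' ∈ C) :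
    supDist e.1 e'.1 < C.card := by
  induction h generalizing e' with
  | root => rw [Finset.mem_singleton.1 he', supDist_self]; simp
  | @step C u v _ hu hv hvC ih =>
    rw [Finset.card_insert_of_notMem hvC]
    rcases Finset.mem_insert.1 he' with rfl | h
    · have h1 := ih hu
      have h2 := supDist_le_one_of_mem_nbr hv
      have h3 := supDist_triangle e.1 u.1 e'.1
      omega
    · exact (ih h).trans (Nat.lt_succ_self _)

lemma mem_box {N : ℕ} {v : Vertex} : v ∈ box N ↔ ∀ c, |v c| ≤ N := by
  simp only [box, Finset.mem_Icc, Pi.le_def, abs_le]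
  exact forall_and.symm

lemma mem_boxEdges {N : ℕ} {e : PosEdge} :
    e ∈ boxEdges N ↔ e.1 ∈ box N ∧ e.1 + unit e.2 ∈ box N := by
  simp [boxEdges]

lemma mem_boxPlaquettes {N : ℕ} {a : Vertex} {i k : Fin 4} (h : i ≠ k) :
    (a, plane i k h) ∈ boxPlaquettes N ↔
      a ∈ box N ∧ a + unit i ∈ box N ∧ a + unit k ∈ box N ∧ a + unit i + unit k ∈ box N := by
  unfold plane
  split_ifs
  · simp [boxPlaquettes]
  · simp only [boxPlaquettes, Finset.mem_filter, Finset.mem_product, Finset.mem_univ, and_true]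
    rw [add_right_comm a (unit k)]
    tauto

lemma bdry_subset_boxEdges {N : ℕ} {p : PosPlaquette} (h : p ∈ boxPlaquettes N) :
    bdry p ⊆ boxEdges N := by
  obtain ⟨a, i, k, hik, rfl⟩ := exists_eq_plane p
  rw [mem_boxPlaquettes] at h
  intro e he
  rw [mem_bdry_plane] at he
  rw [mem_boxEdges]
  obtain ⟨h1, h2, h3, h4⟩ := h
  rcases he with rfl | rfl | rfl | rfl
  · exact ⟨h1, h2⟩
  · exact ⟨h2, h4⟩
  · exact ⟨h3, by rwa [add_right_comm] at h4⟩
  · exact ⟨h1, h3⟩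

lemma mem_boxEdges_of_abs_le {N : ℕ} {e : PosEdge} (h : ∀ c, |e.1 c| + 1 ≤ N) :
    e ∈ boxEdges N := by
  rw [mem_boxEdges, mem_box, mem_box]
  refine ⟨fun c => by have := h c; omega, fun c => ?_⟩
  have := h c
  simp only [Pi.add_apply, unit_eq]
  split_ifs <;> rw [abs_le] <;> constructor <;> have := abs_le.1 (le_refl |e.1 c|) <;> omega

lemma mem_boxPlaquettes_of_mem_bdry {N : ℕ} {e : PosEdge} {p : PosPlaquette} (he : e ∈ bdry p)
    (h : ∀ c, |e.1 c| + 2 ≤ N) : p ∈ boxPlaquettes N := by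
  have key : ∀ v : Vertex, (∀ c, |v c - e.1 c| ≤ 2) → v ∈ box N := by
    intro v hv
    rw [mem_box]
    intro c
    have h1 := h c
    have h2 := hv c
    have h3 := abs_add_le (v c - e.1 c) (e.1 c)
    rw [sub_add_cancel] at h3
    omega
  have key2 : ∀ b k (hk : e.2 ≠ k), (b = 0 ∨ b = 1) →
      (e.1 - (b : ℤ) • unit k, plane e.2 k hk) ∈ boxPlaquettes N := by
    intro b k hk hb
    rw [mem_boxPlaquettes]
    have hz := unit_eq_zero_or_one e.2
    have hz' := unit_eq_zero_or_one k
    refine ⟨key _ fun c => ?_, key _ fun c => ?_, key _ fun c => ?_, key _ fun c => ?_⟩ <;>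
      rcases hb with rfl | rfl <;> rcases hz c with h1 | h1 <;> rcases hz' c with h2 | h2 <;>
      simp only [Pi.add_apply, Pi.sub_apply, Pi.smul_apply, h1, h2, smul_eq_mul] <;>
      rw [abs_le] <;> constructor <;> omega
  obtain ⟨k, hk, rfl | rfl⟩ := exists_plane_of_mem he
  · simpa using key2 0 k hk (Or.inl rfl)
  · simpa using key2 1 k hk (Or.inr rfl)

/-! ### Clusters on a straight piece of a path -/

/-- Outside the exceptional set `X`, the path with edge set `Γ` goes straight ahead. -/
def Straight (Γ : Finset PosEdge) (X : Finset Vertex) : Prop :=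
  ∀ v ∉ X, ∀ i, (v - unit i, i) ∈ Γ ↔ (v, i) ∈ Γ

lemma Straight.mem_iff {Γ : Finset PosEdge} {X : Finset Vertex} (h : Straight Γ X) {i : Fin 4}
    {a v v' : Vertex} {R : ℕ} (hvv' : ∀ c, c ≠ i → v c = v' c) (hv : supDist a v ≤ R)
    (hv' : supDist a v' ≤ R) (hX : ∀ w ∈ X, R < supDist a w) : (v, i) ∈ Γ ↔ (v', i) ∈ Γ := by
  have key : ∀ (n : ℕ) (u : Vertex), supDist a u ≤ R → supDist a (u + n • unit i) ≤ R →
      ((u, i) ∈ Γ ↔ (u + n • unit i, i) ∈ Γ) := by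
    intro n
    induction n with
    | zero => simp
    | succ n ih =>
      intro u hu hu'
      have hmid : supDist a (u + n • unit i) ≤ R := by
        rw [supDist_le] at *
        intro c
        have h1 := hu c
        have h2 := hu' c
        by_cases hc : c = i
        · subst hc
          rw [Pi.add_apply, nsmul_unit_apply] at *
          rw [abs_le] at *
          push_cast at *
          constructor <;> omega
        · have h3 : ∀ m : ℕ, (m • unit i) c = 0 := fun m => by
            rw [Pi.smul_apply, unit_of_ne hc, smul_zero]
          rw [Pi.add_apply, h3] at *
          simpa using h1
      rw [ih u hu hmid]
      have hn : u + (n + 1) • unit i ∉ X := fun hmem => absurd (hX _ hmem) (not_lt.2 hu')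
      rw [← h _ hn i]
      rw [add_smul, one_smul, ← add_assoc, add_sub_cancel_right]
  have heq : ∀ u u' : Vertex, (∀ c, c ≠ i → u c = u' c) → u i ≤ u' i →
      u' = u + (u' i - u i).toNat • unit i := by
    intro u u' huu' hle
    ext c
    by_cases hc : c = i
    · subst hc
      rw [Pi.add_apply, nsmul_unit_apply]
      omega
    · rw [Pi.add_apply, Pi.smul_apply, unit_of_ne hc, smul_zero, add_zero, huu' c hc]
  rcases le_total (v i) (v' i) with hle | hle
  · have h1 := heq v v' hvv' hle
    rw [h1] at hv' ⊢
    exact key _ v hv hv'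
  · have h1 := heq v' v (fun c hc => (hvv' c hc).symm) hle
    rw [h1] at hv ⊢
    exact (key _ v' hv' hv).symm

/-- The sum over a line is the parity of the number of its edges in `s`. -/
lemma lineSum_eq_card {s : Finset PosEdge} {M : ℕ} (hs : ∀ e ∈ s, ∀ c, |e.1 c| < M) (i : Fin 4)
    (u : Vertex) :
    lineSum s M i u = ((s.filter fun e => e.2 = i ∧ ∀ c, c ≠ i → e.1 c = u c).card : ZMod 2) := by
  simp only [lineSum, ind]
  rw [Finset.sum_boole]
  congr 1
  refine Finset.card_bij (fun n _ => (Function.update u i ((n : ℤ) - M), i)) ?_ ?_ ?_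
  · intro n hn
    refine Finset.mem_filter.2 ⟨(Finset.mem_filter.1 hn).2, rfl, fun c hc => by simp [hc]⟩
  · intro n _ m _ h
    have := congrFun (congrArg Prod.fst h) i
    simpa using this
  · intro e he
    obtain ⟨h1, h2, h3⟩ := Finset.mem_filter.1 he
    have h4 := abs_lt.1 (hs e h1 i)
    have h5 : e = (Function.update u i ((((e.1 i + M).toNat : ℕ) : ℤ) - M), i) := by
      refine Prod.ext ?_ h2
      ext c
      by_cases hc : c = i
      · subst hc; simp; omega
      · simp [hc, h3 c hc]
    refine ⟨(e.1 i + M).toNat, Finset.mem_filter.2 ⟨Finset.mem_range.2 (by omega), ?_⟩, h5.symm⟩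
    rwa [← h5]

/-- A cluster near a straight piece of `Γ`, and away from the boundary of the box, on which
`chi Γ` is negative, carries at least six vortices, and at least seven if one of them does not
touch an edge of `Γ` far from the exceptional points. -/
lemma Straight.card_vort {Γ G : Finset PosEdge} {X : Finset Vertex} (h : Straight Γ X)
    (hG : ∀ e ∈ Γ, (∀ v ∈ X, 4 ≤ supDist e.1 v) → e ∈ G) {N : ℕ} {e₀ : PosEdge}
    {C s : Finset PosEdge} (hC : Animal nbr e₀ C) (hsC : s ⊆ C)
    (hX : ∀ v ∈ X, C.card + 5 ≤ supDist e₀.1 v) (hN : ∀ c, |e₀.1 c| + C.card + 5 ≤ N)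
    (hchi : chi Γ s = -1) :
    6 ≤ (vort bdry (boxPlaquettes N) s).card ∧
      ∀ p ∈ vort bdry (boxPlaquettes N) s, (∀ e ∈ bdry p, e ∉ G) →
        7 ≤ (vort bdry (boxPlaquettes N) s).card := by
  classical
  have hdist : ∀ e ∈ s, supDist e₀.1 e.1 < C.card := fun e he => hC.supDist_lt (hsC he)
  have habs : ∀ (v : Vertex) (k : ℕ), supDist e₀.1 v ≤ k → ∀ c, |v c| ≤ |e₀.1 c| + k := by
    intro v k hk c
    have h1 := (supDist_le.1 hk) c
    have h2 := abs_sub_abs_le_abs_sub (v c) (e₀.1 c)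
    rw [abs_sub_comm] at h2
    omega
  have hs : ∀ e ∈ s, ∀ c, |e.1 c| < N := by
    intro e he c
    have h1 := habs _ _ (hdist e he).le c
    have h2 := hN c
    omega
  -- some line meets `s ∩ Γ` in an odd number of edges
  set lab : PosEdge → Fin 4 × Vertex := fun e => (e.2, Function.update e.1 e.2 0) with hlab
  obtain ⟨e₁, he₁, hodd⟩ : ∃ e₁ ∈ s, Odd (s.filter (fun e => lab e = lab e₁) ∩ Γ).card := by
    by_contra hcon
    push Not at hcon
    have : chi Γ s = 1 := by
      rw [chi_eq_prod, ← Finset.prod_fiberwise_of_maps_to (t := s.image lab) (g := lab)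
        fun e he => Finset.mem_image_of_mem _ he]
      refine Finset.prod_eq_one fun L hL => ?_
      obtain ⟨e, he, rfl⟩ := Finset.mem_image.1 hL
      rw [← chi_eq_prod]
      exact (chi_eq_one_or _ _).resolve_right fun h' =>
        hcon e he ((chi_eq_neg_one_iff _ _).1 h')
    rw [this] at hchi
    norm_num at hchi
  obtain ⟨e₂, he₂⟩ := Finset.card_pos.1 hodd.pos
  obtain ⟨he₂', he₂Γ⟩ := Finset.mem_inter.1 he₂
  obtain ⟨he₂s, he₂l⟩ := Finset.mem_filter.1 he₂'
  have hlab' : ∀ e, lab e = lab e₁ ↔ e.2 = e₂.2 ∧ ∀ c, c ≠ e₂.2 → e.1 c = e₂.1 c := by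
    intro e
    rw [← he₂l]
    simp only [hlab, Prod.mk.injEq]
    constructor
    · rintro ⟨h1, h2⟩
      refine ⟨h1, fun c hc => ?_⟩
      have := congrFun h2 c
      rwa [Function.update_of_ne (h1 ▸ hc), Function.update_of_ne hc] at this
    · rintro ⟨h1, h2⟩
      refine ⟨h1, ?_⟩
      ext c
      rw [h1]
      by_cases hc : c = e₂.2
      · subst hc; simp
      · simp [hc, h2 c hc]
  have hlineΓ : ∀ e : PosEdge, supDist e₀.1 e.1 ≤ C.card → e.2 = e₂.2 →
      (∀ c, c ≠ e₂.2 → e.1 c = e₂.1 c) → e ∈ Γ := by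
    intro e h1 h2 h3
    have := (h.mem_iff (fun c hc => (h3 c hc).symm) (hdist e₂ he₂s).le h1
      fun w hw => by have := hX w hw; omega).1 he₂Γ
    rwa [← h2] at this
  have hline : lineSum s N e₂.2 e₂.1 = 1 := by
    rw [lineSum_eq_card hs, ZMod.natCast_eq_one_iff_odd]
    convert hodd using 2
    ext e
    rw [Finset.mem_inter, Finset.mem_filter, Finset.mem_filter, hlab']
    exact ⟨fun h' => ⟨h', hlineΓ e (hdist e h'.1).le h'.2.1 h'.2.2⟩, fun h' => h'.1⟩
  have hW : ∀ p, Odd (s ∩ bdry p).card → p ∈ vort bdry (boxPlaquettes N) s := by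
    intro p hp
    refine mem_vort.2 ⟨?_, hp⟩
    obtain ⟨e, he⟩ := Finset.card_pos.1 hp.pos
    obtain ⟨h1, h2⟩ := Finset.mem_inter.1 he
    refine mem_boxPlaquettes_of_mem_bdry h2 fun c => ?_
    have h3 := habs _ _ (hdist e h1).le c
    have h4 := hN c
    omega
  obtain ⟨h6, h7⟩ := card_vortices hs hline hW
  refine ⟨h6, fun p hp hpG => h7 p hp fun e he hei => ?_⟩
  by_contra hcon
  push Not at hcon
  obtain ⟨e₃, he₃⟩ := Finset.card_pos.1 (mem_vort.1 hp).2.pos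
  obtain ⟨h1, h2⟩ := Finset.mem_inter.1 he₃
  have h3 : supDist e₀.1 e.1 ≤ C.card := by
    have h4 := supDist_triangle e₀.1 e₃.1 e.1
    have h5 := hdist e₃ h1
    have h6 := supDist_le_one_of_mem_bdry h2 he
    omega
  refine hpG e he (hG e (hlineΓ e h3 hei hcon) fun v hv => ?_)
  have h4 := hX v hv
  have h5 := supDist_triangle e₀.1 e.1 v
  omega

/-! ### The model with soft plaquettes around a set of edges -/

/-- The weight at infinite inverse temperature, except that a vortex at a plaquette through an edge
of `G` has weight `y`. -/
def softWeight (y : ℝ) (G : Finset PosEdge) (p : PosPlaquette) : ℝ :=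
  if (bdry p ∩ G).Nonempty then y else 0

lemma softWeight_nonneg {y : ℝ} (hy : 0 ≤ y) (G : Finset PosEdge) (p : PosPlaquette) :
    0 ≤ softWeight y G p := by
  unfold softWeight; split_ifs <;> [exact hy; exact le_rfl]

lemma softWeight_le {y : ℝ} (hy : 0 ≤ y) (G : Finset PosEdge) (p : PosPlaquette) :
    softWeight y G p ≤ y := by
  unfold softWeight; split_ifs <;> [exact le_rfl; exact hy]

lemma softWeight_empty (y : ℝ) (p : PosPlaquette) : softWeight y ∅ p = 0 := by simp [softWeight]

section Weights

variable {V Q : Type*} [DecidableEq V] {bd : Q → Finset V} {P : Finset Q}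

lemma wt_eq_zero {x : ℝ} {y : Q → ℝ} {A : Finset V} {p : Q} (hp : p ∈ vort bd P A)
    (hy : y p = 0) : wt bd P x y A = 0 := by
  rw [wt, Finset.prod_eq_zero hp hy, mul_zero]

lemma wt_le_pow {x : ℝ} (hx : 0 ≤ x) {y : Q → ℝ} {y₀ : ℝ} (hy : ∀ p, 0 ≤ y p)
    (hy₀ : ∀ p, y p ≤ y₀) (h1 : y₀ ≤ 1) {A : Finset V} {k : ℕ} (hk : k ≤ (vort bd P A).card) :
    wt bd P x y A ≤ y₀ ^ k * x ^ A.card := by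
  rw [wt, mul_comm]
  refine mul_le_mul_of_nonneg_right ?_ (pow_nonneg hx _)
  by_cases hne : (vort bd P A).Nonempty
  · obtain ⟨p, -⟩ := hne
    have h0 : 0 ≤ y₀ := (hy p).trans (hy₀ p)
    calc ∏ p ∈ vort bd P A, y p ≤ ∏ _p ∈ vort bd P A, y₀ :=
          Finset.prod_le_prod (fun p _ => hy p) fun p _ => hy₀ p
      _ = y₀ ^ (vort bd P A).card := by rw [Finset.prod_const]
      _ ≤ y₀ ^ k := pow_le_pow_of_le_one h0 h1 hk
  · rw [Finset.not_nonempty_iff_eq_empty] at hne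
    rw [hne, Finset.card_empty, Nat.le_zero] at hk
    simp [hne, hk]

lemma sum_wt_pos (Λ : Finset V) {x : ℝ} (hx : 0 ≤ x) {y : Q → ℝ} (hy : ∀ p, 0 ≤ y p) :
    0 < ∑ A ∈ Λ.powerset, wt bd P x y A :=
  Finset.sum_pos' (fun A _ => wt_nonneg hx hy A) ⟨∅, Finset.empty_mem_powerset _, by
    rw [wt_empty]; exact zero_lt_one⟩

lemma vort_symmDiff_singleton (A : Finset V) (e : V) (p : Q) :
    p ∈ vort bd P (symmDiff A {e}) ↔ p ∈ P ∧ ¬(Odd (A ∩ bd p).card ↔ e ∈ bd p) := by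
  rw [mem_vort, odd_symmDiff_inter]
  have : Odd (({e} : Finset V) ∩ bd p).card ↔ e ∈ bd p := by
    by_cases h : e ∈ bd p
    · rw [Finset.singleton_inter_of_mem h]; simp [h]
    · rw [Finset.singleton_inter_of_notMem h]; simp [h]
  rw [this]

end Weights

/-- Edges of `G` at distance at most `1` lie on a common line. -/
def Sparse (G : Finset PosEdge) : Prop :=
  ∀ e ∈ G, ∀ e' ∈ G, supDist e.1 e'.1 ≤ 1 → e'.2 = e.2 ∧ ∀ c, c ≠ e.2 → e'.1 c = e.1 c

lemma Sparse.mono {G G' : Finset PosEdge} (h : Sparse G) (hG : G' ⊆ G) : Sparse G' :=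
  fun e he e' he' => h e (hG he) e' (hG he')

/-- The boundary of a cube has even intersection with the vortices. -/
lemma curl_cube (s : Finset PosEdge) (b : Vertex) (i k l : Fin 4) :
    curl s b i k + curl s (b + unit l) i k + curl s b i l + curl s (b + unit k) i l +
      curl s b k l + curl s (b + unit i) k l = 0 := by
  simp only [curl, add_right_comm b (unit l) (unit i), add_right_comm b (unit l) (unit k),
    add_right_comm b (unit k) (unit i)]
  have h2 : (2 : ZMod 2) = 0 := rfl
  linear_combination (ind s (b, i) + ind s (b, k) + ind s (b, l) + ind s (b + unit i, k) +
    ind s (b + unit k, i) + ind s (b + unit l, i) + ind s (b + unit l, k) +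
    ind s (b + unit i, l) + ind s (b + unit k, l) + ind s (b + unit i + unit l, k) +
    ind s (b + unit k + unit l, i) + ind s (b + unit i + unit k, l)) * h2

lemma bdry_inter_eq_empty {G : Finset PosEdge} {e : PosEdge} (hG : Sparse G) (he : e ∈ G)
    {p : PosPlaquette} (hp : ∀ e' ∈ bdry p, supDist e.1 e'.1 ≤ 1 ∧
      (e'.2 = e.2 → ∃ c, c ≠ e.2 ∧ e'.1 c ≠ e.1 c)) : ¬ (bdry p ∩ G).Nonempty := by
  rintro ⟨e', h⟩
  obtain ⟨h1, h2⟩ := Finset.mem_inter.1 h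
  obtain ⟨h3, h4⟩ := hp e' h1
  obtain ⟨h5, h6⟩ := hG e he e' h2 h3
  obtain ⟨c, hc, hc'⟩ := h4 h5
  exact hc' (h6 c hc)

/-- If all vortices of `s` are at plaquettes through edges of a sparse set `G`, then the six
plaquettes through an edge of `G` are either all vortices or none of them is: two of these
plaquettes that belong to a common cube are the only faces of the cube where a vortex is
possible. -/
lemma odd_iff_of_sparse {G : Finset PosEdge} (hG : Sparse G) {e : PosEdge} (he : e ∈ G) {N : ℕ}
    (hN : ∀ c, |e.1 c| + 4 ≤ N) {s : Finset PosEdge}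
    (hs : ∀ p ∈ vort bdry (boxPlaquettes N) s, (bdry p ∩ G).Nonempty) {p p' : PosPlaquette}
    (hp : e ∈ bdry p) (hp' : e ∈ bdry p') :
    Odd (s ∩ bdry p).card ↔ Odd (s ∩ bdry p').card := by
  obtain ⟨a, i⟩ := e
  dsimp only at hN
  have hzero : ∀ (b : Vertex) (k l : Fin 4) (hkl : k ≠ l), (∀ c, |a c - b c| ≤ 1) →
      (∀ e' ∈ bdry (b, plane k l hkl), supDist a e'.1 ≤ 1 ∧
        (e'.2 = i → ∃ c, c ≠ i ∧ e'.1 c ≠ a c)) → curl s b k l = 0 := by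
    intro b k l hkl hb h
    refine (zmod_two_eq _).resolve_right fun h1 => ?_
    rw [← odd_inter_bdry s b hkl] at h1
    refine bdry_inter_eq_empty hG he h (hs _ (mem_vort.2 ⟨?_, h1⟩))
    refine mem_boxPlaquettes_of_mem_bdry (e := (b, k)) ((mem_bdry_plane hkl).2 (by simp))
      fun c => ?_
    have h2 := hN c
    have h3 := hb c
    have h4 := abs_sub_abs_le_abs_sub (b c) (a c)
    rw [abs_sub_comm] at h4
    dsimp only
    omega
  -- the faces of the cubes at `b = a` and `b = a - unit k` that do not contain the edge
  have hu := fun j c => unit_eq_zero_or_one j c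
  have cube : ∀ (b : Vertex) (k l : Fin 4), i ≠ k → i ≠ l → k ≠ l →
      (∀ c, |a c - b c| ≤ 1) → (∀ c, |a c - (b + unit i) c| ≤ 1) →
      curl s b k l = 0 ∧ curl s (b + unit i) k l = 0 ∨ ¬ (∀ c, b c ≤ a c ∧ a c ≤ b c + unit k c) := by
    intro b k l hik hil hkl hb hbi
    by_cases hbk : ∀ c, b c ≤ a c ∧ a c ≤ b c + unit k c
    · left
      refine ⟨hzero b k l hkl hb ?_, hzero _ k l hkl hbi ?_⟩
      · intro e' he'
        rw [mem_bdry_plane] at he'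
        rcases he' with rfl | rfl | rfl | rfl
        all_goals
          refine ⟨supDist_le.2 fun c => ?_, fun h => ?_⟩
          · have h1 := hu k c
            have h2 := hu l c
            have h3 := hbk c
            simp only [Pi.add_apply, abs_le]
            push_cast
            omega
          · first | exact absurd h.symm hik | exact absurd h.symm hil
      · intro e' he'
        rw [mem_bdry_plane] at he'
        have hik' : ∀ c, unit i c = 1 → unit k c = 0 ∧ unit l c = 0 := by
          intro c hc
          have : c = i := by
            by_contra h
            rw [unit_of_ne h] at hc
            exact zero_ne_one hc
          subst this
          exact ⟨unit_of_ne hik, unit_of_ne hil⟩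
        rcases he' with rfl | rfl | rfl | rfl
        all_goals
          refine ⟨supDist_le.2 fun c => ?_, fun h => ?_⟩
          · have h0 := hik' c
            have h1 := hu k c
            have h2 := hu l c
            have h3 := hbk c
            have h4 := hu i c
            simp only [Pi.add_apply, abs_le]
            push_cast
            omega
          · first | exact absurd h.symm hik | exact absurd h.symm hil
    · exact Or.inr hbk
  have par : ∀ (b : Vertex) (k l : Fin 4), i ≠ k → i ≠ l → k ≠ l → (∀ c, |a c - b c| ≤ 1) →
      (∀ c, (b c = a c ∨ b c = a c - unit k c)) → curl s (b + unit l) i k = 0 := by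
    intro b k l hik hil hkl hb hbk
    have hl : b l = a l := by
      rcases hbk l with h | h
      · exact h
      · rw [h, unit_of_ne hkl.symm, sub_zero]
    have hi : b i = a i := by
      rcases hbk i with h | h
      · exact h
      · rw [h, unit_of_ne hik, sub_zero]
    have hkl' : ∀ c, unit l c = 1 → unit k c = 0 ∧ unit i c = 0 := by
      intro c hc
      have : c = l := by
        by_contra h
        rw [unit_of_ne h] at hc
        exact zero_ne_one hc
      subst this
      exact ⟨unit_of_ne hkl.symm, unit_of_ne hil.symm⟩
    have hki' : ∀ c, unit i c = 1 → unit k c = 0 := by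
      intro c hc
      have : c = i := by
        by_contra h
        rw [unit_of_ne h] at hc
        exact zero_ne_one hc
      subst this
      exact unit_of_ne hik
    refine hzero _ i k hik (fun c => ?_) ?_
    · have h1 := hkl' c
      have h2 := hu l c
      have h3 := hbk c
      have h4 := hu k c
      rw [Pi.add_apply, abs_le]
      omega
    · intro e' he'
      rw [mem_bdry_plane] at he'
      rcases he' with rfl | rfl | rfl | rfl
      all_goals
        refine ⟨supDist_le.2 fun c => ?_, fun h => ?_⟩
        · have h1 := hkl' c
          have h2 := hu l c
          have h3 := hbk c
          have h4 := hu k c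
          have h5 := hu i c
          have h6 := hki' c
          simp only [Pi.add_apply, abs_le]
          push_cast
          omega
        · first
          | exact absurd h.symm hik
          | (refine ⟨l, hil.symm, ?_⟩
             simp only [Pi.add_apply, unit_same, unit_of_ne hkl.symm, hl]
             omega)
  have far : ∀ (k l : Fin 4), i ≠ k → i ≠ l → k ≠ l → curl s (a - unit k) i l = 0 := by
    intro k l hik hil hkl
    have hki' : ∀ j c, j ≠ k → unit j c = 1 → unit k c = 0 := by
      intro j c hjk hc
      have : c = j := by
        by_contra h
        rw [unit_of_ne h] at hc
        exact zero_ne_one hc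
      subst this
      exact unit_of_ne hjk
    have hli' : ∀ c, unit i c = 1 → unit l c = 0 := by
      intro c hc
      have : c = i := by
        by_contra h
        rw [unit_of_ne h] at hc
        exact zero_ne_one hc
      subst this
      exact unit_of_ne hil
    refine hzero _ i l hil (fun c => ?_) ?_
    · have h4 := hu k c
      rw [Pi.sub_apply, abs_le]
      omega
    · intro e' he'
      rw [mem_bdry_plane] at he'
      rcases he' with rfl | rfl | rfl | rfl
      all_goals
        refine ⟨supDist_le.2 fun c => ?_, fun h => ?_⟩
        · have h1 := hki' i c hik
          have h2 := hki' l c hkl.symm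
          have h3 := hu k c
          have h4 := hu l c
          have h5 := hu i c
          have h6 := hli' c
          simp only [Pi.add_apply, Pi.sub_apply, abs_le]
          push_cast
          omega
        · first
          | exact absurd h.symm hil
          | (refine ⟨k, hik.symm, ?_⟩
             simp only [Pi.add_apply, Pi.sub_apply, unit_same, unit_of_ne hkl]
             omega)
  -- two plaquettes at `a`, and a plaquette at `a - unit k` and one at `a`
  have c2 : ∀ z : ZMod 2, z + z = 0 := CharTwo.add_self_eq_zero
  have base : ∀ (k l : Fin 4), i ≠ k → i ≠ l → curl s a i k = curl s a i l := by
    intro k l hik hil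
    by_cases hkl : k = l
    · rw [hkl]
    have h1 := curl_cube s a i k l
    rw [par a k l hik hil hkl (by simp) (by simp), par a l k hil hik (Ne.symm hkl) (by simp)
      (by simp)] at h1
    rcases cube a k l hik hil hkl (by simp) (fun c => by
      have := hu i c
      rw [Pi.add_apply, abs_le]; omega) with ⟨h2, h3⟩ | h2
    · rw [h2, h3] at h1
      linear_combination h1 - c2 (curl s a i l)
    · exact absurd (fun c => ⟨le_rfl, by have := hu k c; omega⟩) h2
  have back : ∀ (k l : Fin 4), i ≠ k → i ≠ l → k ≠ l →
      curl s (a - unit k) i k = curl s a i l := by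
    intro k l hik hil hkl
    have h1 := curl_cube s (a - unit k) i k l
    have hb : ∀ c, |a c - (a - unit k) c| ≤ 1 := fun c => by
      have := hu k c
      rw [Pi.sub_apply, abs_le]; omega
    rw [par (a - unit k) k l hik hil hkl hb (by simp), far k l hik hil hkl,
      sub_add_cancel] at h1
    rcases cube (a - unit k) k l hik hil hkl hb (fun c => by
      have := hu k c
      have := hu i c
      rw [Pi.add_apply, Pi.sub_apply, abs_le]; omega) with ⟨h2, h3⟩ | h2
    · rw [h2, h3] at h1
      linear_combination h1 - c2 (curl s a i l)
    · exact absurd (fun c => by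
        have := hu k c
        rw [Pi.sub_apply]
        constructor <;> omega) h2
  have all : ∀ p, (a, i) ∈ bdry p → ∀ l, i ≠ l → (Odd (s ∩ bdry p).card ↔ curl s a i l = 1) := by
    intro p hp l hil
    obtain ⟨k, hk, rfl | rfl⟩ := exists_plane_of_mem hp
    · rw [odd_inter_bdry, base k l hk hil]
    · rw [odd_inter_bdry]
      dsimp only at hk ⊢
      obtain ⟨l', hil', hkl'⟩ : ∃ l' : Fin 4, i ≠ l' ∧ k ≠ l' := by
        clear * -
        revert i k; decide
      rw [back k l' hk hil' hkl', base l' l hil' hil]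
  obtain ⟨l, hil⟩ : ∃ l : Fin 4, i ≠ l := by
    clear * -
    revert i; decide
  rw [all p hp l hil, all p' hp' l hil]

/-! ### Softening the plaquettes around one more edge -/

/-- The plaquettes of the box through the edge `e`. -/
noncomputable def star (N : ℕ) (e : PosEdge) : Finset PosPlaquette :=
  (boxPlaquettes N).filter fun p => e ∈ bdry p

lemma mem_star {N : ℕ} {e : PosEdge} {p : PosPlaquette} :
    p ∈ star N e ↔ p ∈ boxPlaquettes N ∧ e ∈ bdry p := Finset.mem_filter

lemma card_star {N : ℕ} {e : PosEdge} (hN : ∀ c, |e.1 c| + 2 ≤ N) : (star N e).card = 6 := by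
  obtain ⟨a, i⟩ := e
  set p : {k : Fin 4 // i ≠ k} × Bool → PosPlaquette := fun t =>
    (if t.2 then a else a - unit t.1, plane i t.1 t.1.2) with hp
  have hpi : Function.Injective p := by
    rintro ⟨k, b⟩ ⟨k', b'⟩ h
    have h2 : k = k' := Subtype.ext
      (plane_injective (h := k.2) (h' := k'.2) (congrArg Prod.snd h))
    subst h2
    have h1 : (if b then a else a - unit k) = if b' then a else a - unit k := congrArg Prod.fst h
    have h0 := unit_ne_zero k
    cases b <;> cases b' <;> simp [h0, sub_eq_self, eq_comm (a := a)] at h1 ⊢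
  have hcard : Fintype.card ({k : Fin 4 // i ≠ k} × Bool) = 6 := by
    clear * -
    revert i; decide
  have : star N (a, i) = Finset.univ.image p := by
    ext q
    rw [mem_star, Finset.mem_image]
    constructor
    · rintro ⟨-, hq⟩
      obtain ⟨k, hk, rfl | rfl⟩ := exists_plane_of_mem hq
      · exact ⟨(⟨k, hk⟩, true), Finset.mem_univ _, by simp [hp]⟩
      · exact ⟨(⟨k, hk⟩, false), Finset.mem_univ _, by simp [hp]⟩
    · rintro ⟨⟨⟨k, hk⟩, b⟩, -, rfl⟩
      have : (a, i) ∈ bdry (p (⟨k, hk⟩, b)) := by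
        simp only [hp]
        rw [mem_bdry_plane]
        cases b <;> simp
      exact ⟨mem_boxPlaquettes_of_mem_bdry this hN, this⟩
  rw [this, Finset.card_image_of_injective _ hpi, Finset.card_univ, hcard]

lemma Sparse.eq_of_mem_bdry {G : Finset PosEdge} (hG : Sparse G) {e e' : PosEdge} (he : e ∈ G)
    (he' : e' ∈ G) {p : PosPlaquette} (hp : e ∈ bdry p) (hp' : e' ∈ bdry p) : e' = e := by
  obtain ⟨h1, h2⟩ := hG e he e' he' (supDist_le_one_of_mem_bdry hp hp')
  obtain ⟨k, hk, rfl | rfl⟩ := exists_plane_of_mem hp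
  · rw [mem_bdry_plane] at hp'
    rcases hp' with rfl | rfl | rfl | rfl
    · rfl
    · exact absurd h1.symm hk
    · have := h2 k hk.symm; simp at this
    · exact absurd h1.symm hk
  · rw [mem_bdry_plane] at hp'
    rcases hp' with rfl | rfl | rfl | rfl
    · have := h2 k hk.symm; simp at this
    · exact absurd h1.symm hk
    · simp
    · exact absurd h1.symm hk

/-- The weight of the configuration at `β = ∞`, except for soft plaquettes around `G`. -/
noncomputable def softWt (N : ℕ) (x y : ℝ) (G A : Finset PosEdge) : ℝ :=
  wt bdry (boxPlaquettes N) x (softWeight y G) A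

lemma softWt_nonneg (N : ℕ) {x y : ℝ} (hx : 0 ≤ x) (hy : 0 ≤ y) (G A : Finset PosEdge) :
    0 ≤ softWt N x y G A := wt_nonneg hx (softWeight_nonneg hy G) A

/-- The weight of a vortex around the edge `e` relative to the configuration `A` without it. -/
noncomputable def vortexWeight (x y : ℝ) (e : PosEdge) (A : Finset PosEdge) : ℝ :=
  y ^ 6 * if e ∈ A then x⁻¹ else x

lemma mem_vort_symmDiff {N : ℕ} {A : Finset PosEdge} {e : PosEdge} {p : PosPlaquette} :
    p ∈ vort bdry (boxPlaquettes N) (symmDiff A {e}) ↔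
      p ∈ boxPlaquettes N ∧ ¬ (p ∈ vort bdry (boxPlaquettes N) A ↔ p ∈ star N e) := by
  rw [vort_symmDiff_singleton, mem_vort, mem_star]
  tauto

/-- Softening the plaquettes around one more edge allows for a vortex around this edge, that is,
for adding `1` to the configuration there. -/
lemma softWt_insert {N : ℕ} {x y : ℝ} (hx : 0 < x) {G : Finset PosEdge} {e : PosEdge}
    (he : e ∉ G) (hG : Sparse (insert e G)) (hN : ∀ c, |e.1 c| + 4 ≤ N) (A : Finset PosEdge) :
    softWt N x y (insert e G) A = softWt N x y G A +
      vortexWeight x y e (symmDiff A {e}) * softWt N x y G (symmDiff A {e}) := by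
  have hstar0 : ∀ p ∈ star N e, softWeight y G p = 0 := by
    intro p hp
    rw [softWeight, if_neg]
    rintro ⟨e', h⟩
    obtain ⟨h1, h2⟩ := Finset.mem_inter.1 h
    have := hG.eq_of_mem_bdry (Finset.mem_insert_self e G) (Finset.mem_insert_of_mem h2)
      (mem_star.1 hp).2 h1
    exact he (this ▸ h2)
  have hstar1 : ∀ p ∈ star N e, softWeight y (insert e G) p = y := by
    intro p hp
    rw [softWeight, if_pos ⟨e, Finset.mem_inter.2 ⟨(mem_star.1 hp).2, Finset.mem_insert_self _ _⟩⟩]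
  have hoff : ∀ p, e ∉ bdry p → softWeight y (insert e G) p = softWeight y G p := by
    intro p hp
    rw [softWeight, softWeight, Finset.inter_insert_of_notMem hp]
  have hcard : (star N e).card = 6 := card_star fun c => by have := hN c; omega
  obtain ⟨p₀, hp₀⟩ : (star N e).Nonempty := Finset.card_pos.1 (by omega)
  have hvP : ∀ B p, p ∈ vort bdry (boxPlaquettes N) B → p ∈ boxPlaquettes N :=
    fun B p h => (mem_vort.1 h).1
  -- without a vortex at `e`
  have hfree : ∀ B, (∀ p ∈ star N e, p ∉ vort bdry (boxPlaquettes N) B) →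
      softWt N x y (insert e G) B = softWt N x y G B ∧
        softWt N x y G (symmDiff B {e}) = 0 := by
    intro B hB
    constructor
    · exact wt_congr (fun p hp => hoff p fun h => hB p (mem_star.2 ⟨hvP _ _ hp, h⟩) hp) x
    · refine wt_eq_zero (p := p₀) (mem_vort_symmDiff.2 ⟨(mem_star.1 hp₀).1, ?_⟩) (hstar0 _ hp₀)
      exact fun h => hB p₀ hp₀ (h.2 hp₀)
  by_cases h0 : ∀ p ∈ star N e, p ∉ vort bdry (boxPlaquettes N) A
  · obtain ⟨h1, h2⟩ := hfree A h0
    rw [h1, h2, mul_zero, add_zero]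
  push Not at h0
  obtain ⟨p₁, hp₁, hp₁A⟩ := h0
  have hA0 : softWt N x y G A = 0 := wt_eq_zero hp₁A (hstar0 _ hp₁)
  rw [hA0, zero_add]
  by_cases h1 : ∀ p ∈ star N e, p ∈ vort bdry (boxPlaquettes N) A
  · set B := symmDiff A {e} with hB
    have hBA : A = symmDiff B {e} := by rw [hB, symmDiff_symmDiff_cancel_right]
    have hBfree : ∀ p ∈ star N e, p ∉ vort bdry (boxPlaquettes N) B := by
      intro p hp hpB
      have h2 := (mem_vort_symmDiff.1 hpB).2
      exact h2 ⟨fun _ => hp, fun _ => h1 p hp⟩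
    rw [← (hfree B hBfree).1, softWt, softWt, wt, wt]
    have hunion : vort bdry (boxPlaquettes N) A = vort bdry (boxPlaquettes N) B ∪ star N e := by
      ext p
      conv_lhs => rw [hBA]
      rw [mem_vort_symmDiff, Finset.mem_union]
      constructor
      · rintro ⟨-, h⟩
        by_cases hs : p ∈ star N e
        · exact Or.inr hs
        · exact Or.inl (by_contra fun h' => h ⟨fun h2 => absurd h2 h', fun h2 => absurd h2 hs⟩)
      · rintro (h | h)
        · exact ⟨hvP B p h, fun h' => hBfree p (h'.1 h) h⟩
        · exact ⟨(mem_star.1 h).1, fun h' => hBfree p h (h'.2 h)⟩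
    have hdisj : Disjoint (vort bdry (boxPlaquettes N) B) (star N e) :=
      Finset.disjoint_left.2 fun p hp hp' => hBfree p hp' hp
    rw [hunion, Finset.prod_union hdisj, Finset.prod_congr rfl hstar1, Finset.prod_const, hcard,
      vortexWeight]
    by_cases heA : e ∈ A
    · have heB : e ∉ B := by rw [hB, Finset.mem_symmDiff]; simp [heA]
      have hAB : A = insert e B := by
        rw [hBA]
        ext e'
        simp only [Finset.mem_symmDiff, Finset.mem_singleton, Finset.mem_insert]
        by_cases h : e' = e
        · subst h; simp [heB]
        · simp [h]
      have hc : A.card = B.card + 1 := by rw [hAB, Finset.card_insert_of_notMem heB]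
      rw [if_neg heB, hc, pow_succ]
      ring
    · have heB : e ∈ B := by rw [hB, Finset.mem_symmDiff]; simp [heA]
      have hAB : B = insert e A := by
        rw [hB]
        ext e'
        simp only [Finset.mem_symmDiff, Finset.mem_singleton, Finset.mem_insert]
        by_cases h : e' = e
        · subst h; simp [heA]
        · simp [h]
      have hc : B.card = A.card + 1 := by rw [hAB, Finset.card_insert_of_notMem heA]
      rw [if_pos heB, hc, pow_succ]
      field_simp
      ring
  · push Not at h1
    obtain ⟨p₂, hp₂, hp₂A⟩ := h1
    have hB0 : softWt N x y G (symmDiff A {e}) = 0 := by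
      refine wt_eq_zero (p := p₂) (mem_vort_symmDiff.2 ⟨(mem_star.1 hp₂).1, ?_⟩) (hstar0 _ hp₂)
      exact fun h => hp₂A (h.2 hp₂)
    rw [hB0, mul_zero]
    by_contra hne
    have hsoft : ∀ p ∈ vort bdry (boxPlaquettes N) A, (bdry p ∩ insert e G).Nonempty := by
      intro p hp
      by_contra hemp
      exact hne (wt_eq_zero hp (by rw [softWeight, if_neg hemp]))
    have := odd_iff_of_sparse hG (Finset.mem_insert_self e G) hN hsoft (mem_star.1 hp₁).2
      (mem_star.1 hp₂).2
    rw [mem_vort] at hp₁A hp₂A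
    exact hp₂A ⟨(mem_star.1 hp₂).1, this.1 hp₁A.2⟩

lemma sum_softWt_insert {N : ℕ} {x y : ℝ} (hx : 0 < x) {G : Finset PosEdge} {e : PosEdge}
    (he : e ∉ G) (hG : Sparse (insert e G)) (hN : ∀ c, |e.1 c| + 4 ≤ N)
    (F : Finset PosEdge → ℝ) :
    ∑ A ∈ (boxEdges N).powerset, softWt N x y (insert e G) A * F A =
      ∑ A ∈ (boxEdges N).powerset,
        softWt N x y G A * (F A + vortexWeight x y e A * F (symmDiff {e} A)) := by
  have heΛ : {e} ∈ (boxEdges N).powerset := by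
    rw [Finset.mem_powerset, Finset.singleton_subset_iff]
    exact mem_boxEdges_of_abs_le fun c => by have := hN c; omega
  have h := sum_powerset_symmDiff (boxEdges N) heΛ fun A =>
    vortexWeight x y e A * softWt N x y G A * F (symmDiff {e} A)
  simp only [softWt_insert hx he hG hN, add_mul, mul_add, Finset.sum_add_distrib]
  congr 1
  refine Eq.trans ?_ (h.trans ?_)
  · refine Finset.sum_congr rfl fun A _ => ?_
    rw [symmDiff_symmDiff_cancel_left, symmDiff_comm {e} A]
  · exact Finset.sum_congr rfl fun A _ => by ring

/-! ### Peierls estimates for the averages -/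

section Averages

variable {V : Type*} {Λ : Finset V}

lemma average_sub_average {w w' : Finset V → ℝ} (hw : 0 < ∑ A ∈ Λ.powerset, w A)
    (hw' : 0 < ∑ A ∈ Λ.powerset, w' A) (F F' : Finset V → ℝ) :
    average Λ w F - average Λ w' F' =
      (∑ z ∈ Λ.powerset ×ˢ Λ.powerset, w z.1 * w' z.2 * (F z.1 - F' z.2)) /
        ∑ z ∈ Λ.powerset ×ˢ Λ.powerset, w z.1 * w' z.2 := by
  rw [average, average, div_sub_div _ _ hw.ne' hw'.ne']
  congr 1
  · rw [Finset.sum_product, Finset.sum_mul_sum, Finset.sum_mul_sum, ← Finset.sum_sub_distrib]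
    refine Finset.sum_congr rfl fun A _ => ?_
    rw [← Finset.sum_sub_distrib]
    exact Finset.sum_congr rfl fun B _ => by ring
  · rw [Finset.sum_product, Finset.sum_mul_sum]

lemma average_mul_average (w w' F F' : Finset V → ℝ) :
    average Λ w F * average Λ w' F' =
      (∑ z ∈ Λ.powerset ×ˢ Λ.powerset, w z.1 * w' z.2 * (F z.1 * F' z.2)) /
        ∑ z ∈ Λ.powerset ×ˢ Λ.powerset, w z.1 * w' z.2 := by
  rw [average, average, div_mul_div_comm]
  congr 1
  · rw [Finset.sum_product, Finset.sum_mul_sum]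
    exact Finset.sum_congr rfl fun A _ => Finset.sum_congr rfl fun B _ => by ring
  · rw [Finset.sum_product, Finset.sum_mul_sum]

lemma abs_average_le {w F : Finset V → ℝ} (hw : ∀ A, 0 ≤ w A) (hF : ∀ A, |F A| ≤ 1) :
    |average Λ w F| ≤ 1 := by
  rw [average, abs_div, abs_of_nonneg (Finset.sum_nonneg fun A _ => hw A)]
  refine div_le_one_of_le₀ ((Finset.abs_sum_le_sum_abs _ _).trans
    (Finset.sum_le_sum fun A _ => ?_)) (Finset.sum_nonneg fun A _ => hw A)
  rw [abs_mul, abs_of_nonneg (hw A)]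
  exact mul_le_of_le_one_right (hw A) (hF A)

lemma average_one {w : Finset V → ℝ} (hw : 0 < ∑ A ∈ Λ.powerset, w A) :
    average Λ w (fun _ => 1) = 1 := by
  simp only [average, mul_one]
  exact div_self hw.ne'

lemma average_add (w F F' : Finset V → ℝ) :
    average Λ w (fun A => F A + F' A) = average Λ w F + average Λ w F' := by
  simp only [average, mul_add, Finset.sum_add_distrib, add_div]

lemma average_const_mul (w : Finset V → ℝ) (c : ℝ) (F : Finset V → ℝ) :
    average Λ w (fun A => c * F A) = c * average Λ w F := by
  simp only [average, mul_left_comm _ c, ← Finset.mul_sum, mul_div_assoc]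

end Averages

/-- The parameter of the convergent cluster expansion. -/
noncomputable def rate (x : ℝ) : ℝ := (18 : ℕ) ^ 2 * (2 * x + x ^ 2)

lemma rate_nonneg {x : ℝ} (hx : 0 ≤ x) : 0 ≤ rate x := by unfold rate; positivity

/-- The ball of radius `D` around `e` lies in the box of size `N` and does not contain a point
of `X`. -/
def Clear (X : Finset Vertex) (N : ℕ) (e : PosEdge) (D : ℕ) : Prop :=
  (∀ v ∈ X, D ≤ supDist e.1 v) ∧ ∀ c, |e.1 c| + D ≤ N

lemma Clear.cases {X : Finset Vertex} {N : ℕ} {e : PosEdge} {D : ℕ} (h : Clear X N e D) (k : ℕ) :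
    D - 4 ≤ k ∨ ((∀ v ∈ X, k + 5 ≤ supDist e.1 v) ∧ ∀ c, |e.1 c| + k + 5 ≤ N) := by
  by_cases hk : D - 4 ≤ k
  · exact Or.inl hk
  · refine Or.inr ⟨fun v hv => ?_, fun c => ?_⟩
    · have := h.1 v hv; omega
    · have := h.2 c; omega

lemma bound_nonneg {b₁ b₂ x : ℝ} (hb₁ : 0 ≤ b₁) (hb₂ : 0 ≤ b₂) (hx : 0 ≤ x) (p q : Prop)
    [Decidable p] [Decidable q] (m n : ℕ) :
    0 ≤ ((if p then b₁ else 0) + if q then b₂ else 0) * (x ^ m * x ^ n) := by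
  split_ifs <;> positivity

/-- The expectations of the character at finite `β` and with soft plaquettes around `G` only
differ little: a vortex off `G` in a cluster on which the character is negative costs a
factor `y ^ 7`, or the cluster is large. -/
lemma abs_average_sub_softWt_le {Γ G : Finset PosEdge} {X : Finset Vertex} (hΓ : Straight Γ X)
    (hG : ∀ e ∈ Γ, (∀ v ∈ X, 4 ≤ supDist e.1 v) → e ∈ G) {N : ℕ} {D : PosEdge → ℕ}
    (hD : ∀ e ∈ Γ, Clear X N e (D e)) {x y : ℝ} (hx : 0 ≤ x) (hy : 0 ≤ y) (hy1 : y ≤ 1)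
    (hα : rate x < 1) :
    |average (boxEdges N) (wt bdry (boxPlaquettes N) x fun _ => y) (chi Γ) -
      average (boxEdges N) (softWt N x y G) (chi Γ)| ≤
    2 * ∑ e ∈ Γ, (y ^ 7 * (rate x ^ 1 / (1 - rate x)) +
      y * (rate x ^ (D e - 4) / (1 - rate x))) := by
  classical
  have hy' : ∀ p, 0 ≤ softWeight y G p := softWeight_nonneg hy G
  have hZ := sum_wt_pos (bd := bdry) (P := boxPlaquettes N) (boxEdges N) hx
    (y := fun _ => y) fun _ => hy
  have hZ' := sum_wt_pos (bd := bdry) (P := boxPlaquettes N) (boxEdges N) hx hy'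
  have hnbr : ∀ p ∈ boxPlaquettes N, ∀ e ∈ bdry p, ∀ e' ∈ bdry p, e ≠ e' → e' ∈ nbr e :=
    fun p _ => mem_nbr_of_mem_bdry p
  unfold softWt
  rw [average_sub_average hZ hZ', abs_div]
  have hZZ : 0 < ∑ z ∈ (boxEdges N).powerset ×ˢ (boxEdges N).powerset,
      wt bdry (boxPlaquettes N) x (fun _ => y) z.1 *
        wt bdry (boxPlaquettes N) x (softWeight y G) z.2 := by
    rw [Finset.sum_product, ← Finset.sum_mul_sum]
    exact mul_pos hZ hZ'
  rw [abs_of_pos hZZ, div_le_iff₀ hZZ]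
  obtain ⟨R, hR⟩ : ∃ R : Finset PosEdge → Finset PosEdge → Prop, ∀ s s', R s s' ↔
      (chi Γ s = -1 ∨ chi Γ s' = -1) ∧
      ∃ p, (p ∈ vort bdry (boxPlaquettes N) s ∨ p ∈ vort bdry (boxPlaquettes N) s') ∧
        y ≠ softWeight y G p := ⟨_, fun _ _ => Iff.rfl⟩
  refine (abs_sum_chi_sub_chi_le nbr_symm hnbr (boxEdges N) Γ hx (fun _ => hy) hy' R
    hR).trans ?_
  rw [mul_assoc, Finset.sum_mul]
  refine mul_le_mul_of_nonneg_left (Finset.sum_le_sum fun e he => ?_) zero_le_two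
  refine sum_cluster_le nbr_symm card_nbr_le (by norm_num) hnbr (boxEdges N) e hx (fun _ => hy)
    hy' R (pow_nonneg hy 7) hy hα ?_
  intro C s s' hC _ hss hRs
  obtain ⟨hchi, p, hp, hyp⟩ := (hR s s').1 hRs
  have hcard : 1 ≤ C.card := Finset.card_pos.2 ⟨e, hC.root_mem⟩
  by_cases h0 : wt bdry (boxPlaquettes N) x (softWeight y G) s' = 0
  · rw [h0, mul_zero]
    exact bound_nonneg (pow_nonneg hy 7) hy hx _ _ _ _
  rw [if_pos hcard]
  have hpG : ¬ (bdry p ∩ G).Nonempty := fun h => hyp (by rw [softWeight, if_pos h])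
  have hps : p ∈ vort bdry (boxPlaquettes N) s := by
    refine hp.resolve_right fun h => h0 (wt_eq_zero h ?_)
    rw [softWeight, if_neg hpG]
  have hle : ∀ k k', k ≤ (vort bdry (boxPlaquettes N) s).card →
      k' ≤ (vort bdry (boxPlaquettes N) s').card →
      wt bdry (boxPlaquettes N) x (fun _ => y) s *
        wt bdry (boxPlaquettes N) x (softWeight y G) s' ≤
      y ^ (k + k') * (x ^ s.card * x ^ s'.card) := by
    intro k k' hk hk'
    have h1 := wt_le_pow hx (fun _ => hy) (fun _ => le_rfl) hy1 hk
    have h2 := wt_le_pow hx hy' (softWeight_le hy G) hy1 hk'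
    calc _ ≤ (y ^ k * x ^ s.card) * (y ^ k' * x ^ s'.card) :=
          mul_le_mul h1 h2 (wt_nonneg hx hy' _)
            (mul_nonneg (pow_nonneg hy _) (pow_nonneg hx _))
      _ = _ := by rw [pow_add]; ring
  have hone : 1 ≤ (vort bdry (boxPlaquettes N) s).card := Finset.card_pos.2 ⟨p, hps⟩
  rcases (hD e he).cases C.card with hk | ⟨hX, hN⟩
  · rw [if_pos hk]
    refine (hle 1 0 hone (Nat.zero_le _)).trans ?_
    rw [add_zero, pow_one]
    refine mul_le_mul_of_nonneg_right ?_ (mul_nonneg (pow_nonneg hx _) (pow_nonneg hx _))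
    linarith [pow_nonneg hy 7]
  · have hsC : s ⊆ C := hss ▸ Finset.subset_union_left
    have hsC' : s' ⊆ C := hss ▸ Finset.subset_union_right
    have h7 : wt bdry (boxPlaquettes N) x (fun _ => y) s *
        wt bdry (boxPlaquettes N) x (softWeight y G) s' ≤
        y ^ 7 * (x ^ s.card * x ^ s'.card) := by
      rcases hchi with hchi | hchi
      · refine hle 7 0 ((hΓ.card_vort hG hC hsC hX hN hchi).2 p hps fun e' he' he'G => ?_)
          (Nat.zero_le _)
        exact hpG ⟨e', Finset.mem_inter.2 ⟨he', he'G⟩⟩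
      · exact hle 1 6 hone (hΓ.card_vort hG hC hsC' hX hN hchi).1
    refine h7.trans (mul_le_mul_of_nonneg_right ?_
      (mul_nonneg (pow_nonneg hx _) (pow_nonneg hx _)))
    split_ifs <;> linarith

/-- The indicator of an edge. -/
def edgeInd (e : PosEdge) (A : Finset PosEdge) : ℝ := if e ∈ A then 1 else 0

lemma exists_vort_singleton {N : ℕ} {e : PosEdge} (hN : ∀ c, |e.1 c| + 4 ≤ N) :
    ∃ p, p ∈ vort bdry (boxPlaquettes N) {e} := by
  obtain ⟨p, hp⟩ : (star N e).Nonempty := Finset.card_pos.1 (by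
    rw [card_star fun c => by have := hN c; omega]; norm_num)
  refine ⟨p, mem_vort.2 ⟨(mem_star.1 hp).1, ?_⟩⟩
  rw [Finset.singleton_inter_of_mem (mem_star.1 hp).2, Finset.card_singleton]
  exact odd_one

lemma subset_singleton_cases {e : PosEdge} {C s : Finset PosEdge} (he : e ∈ C)
    (hC : ¬ 2 ≤ C.card) (hs : s ⊆ C) : s = ∅ ∨ s = {e} := by
  have : C = {e} := by
    obtain ⟨e', he'⟩ := Finset.card_eq_one.1
      (le_antisymm (by omega) (Finset.card_pos.2 ⟨e, he⟩) : C.card = 1)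
    rw [he'] at he ⊢
    rw [Finset.mem_singleton.1 he]
  exact Finset.subset_singleton_iff.1 (this ▸ hs)

/-- With soft plaquettes around `G`, the character and the indicator of an edge off `G` are
almost independent, and the indicator has almost the same expectation as at `β = ∞`. -/
lemma abs_average_mul_sub_le {Γ G : Finset PosEdge} {X : Finset Vertex} (hΓ : Straight Γ X)
    {N D : ℕ} {e : PosEdge} (hN : ∀ c, |e.1 c| + 4 ≤ N) (hD : Clear X N e D)
    (he : e ∉ G) (hG : Sparse (insert e G)) {x y : ℝ} (hx : 0 ≤ x) (hy : 0 ≤ y)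
    (hy1 : y ≤ 1) (hα : rate x < 1) :
    |average (boxEdges N) (softWt N x y G) (fun A => chi Γ A * edgeInd e A) -
      average (boxEdges N) (softWt N x y G) (chi Γ) *
        average (boxEdges N) (softWt N x y ∅) (edgeInd e)| ≤
    y * (rate x ^ 2 / (1 - rate x)) + 1 * (rate x ^ (max 2 (D - 4)) / (1 - rate x)) := by
  classical
  have hy' : ∀ G p, 0 ≤ softWeight y G p := softWeight_nonneg hy
  have hZ : ∀ G, 0 < ∑ A ∈ (boxEdges N).powerset,
    softWt N x y G A := fun G => sum_wt_pos (boxEdges N) hx (hy' G)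
  have hnbr : ∀ p ∈ boxPlaquettes N, ∀ e ∈ bdry p, ∀ e' ∈ bdry p, e ≠ e' → e' ∈ nbr e :=
    fun p _ => mem_nbr_of_mem_bdry p
  have hZZ : 0 < ∑ z ∈ (boxEdges N).powerset ×ˢ (boxEdges N).powerset,
      softWt N x y G z.1 * softWt N x y ∅ z.2 := by
    rw [Finset.sum_product, ← Finset.sum_mul_sum]
    exact mul_pos (hZ _) (hZ _)
  have heq : average (boxEdges N) (softWt N x y G) (fun A => chi Γ A * edgeInd e A) -
      average (boxEdges N) (softWt N x y G) (chi Γ) *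
        average (boxEdges N) (softWt N x y ∅) (edgeInd e) =
      (∑ z ∈ (boxEdges N).powerset ×ˢ (boxEdges N).powerset,
        softWt N x y G z.1 * softWt N x y ∅ z.2 *
          (chi Γ z.1 * (edgeInd e z.1 - edgeInd e z.2))) /
      ∑ z ∈ (boxEdges N).powerset ×ˢ (boxEdges N).powerset,
        softWt N x y G z.1 * softWt N x y ∅ z.2 := by
    rw [average_mul_average, ← mul_one (average _ _ fun A => chi Γ A * edgeInd e A),
      ← average_one (Λ := boxEdges N) (hZ ∅), average_mul_average, ← sub_div,
      ← Finset.sum_sub_distrib]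
    congr 1
    exact Finset.sum_congr rfl fun z _ => by ring
  rw [heq, abs_div, abs_of_pos hZZ, div_le_iff₀ hZZ]
  obtain ⟨R, hR⟩ : ∃ R : Finset PosEdge → Finset PosEdge → Prop, ∀ s s', R s s' ↔
      chi Γ s ≠ chi Γ s' ∨
      ∃ p, (p ∈ vort bdry (boxPlaquettes N) s ∨ p ∈ vort bdry (boxPlaquettes N) s') ∧
        softWeight y G p ≠ softWeight y ∅ p := ⟨_, fun _ _ => Iff.rfl⟩
  refine (abs_sum_chi_mul_mem_sub_le hnbr (boxEdges N) Γ e hx (hy' G) (hy' ∅) R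
    hR).trans ?_
  refine sum_cluster_le nbr_symm card_nbr_le (by norm_num) hnbr (boxEdges N) e hx (hy' G)
    (hy' ∅) R hy zero_le_one hα ?_
  rintro C s s' hC - hss hRs
  by_cases h0 : wt bdry (boxPlaquettes N) x (softWeight y G) s = 0
  · rw [h0, zero_mul]
    exact bound_nonneg hy zero_le_one hx _ _ _ _
  by_cases h0' : wt bdry (boxPlaquettes N) x (softWeight y ∅) s' = 0
  · rw [h0', mul_zero]
    exact bound_nonneg hy zero_le_one hx _ _ _ _
  have hsC : s ⊆ C := hss ▸ Finset.subset_union_left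
  have hsC' : s' ⊆ C := hss ▸ Finset.subset_union_right
  have heC := hC.root_mem
  have hs' : ∀ p, p ∉ vort bdry (boxPlaquettes N) s' := fun p hp =>
    h0' (wt_eq_zero hp (softWeight_empty y p))
  have hsoft : ∀ p ∈ vort bdry (boxPlaquettes N) s, (bdry p ∩ G).Nonempty := fun p hp => by
    by_contra h
    exact h0 (wt_eq_zero hp (by rw [softWeight, if_neg h]))
  -- the edge `e` alone would have vortices which are not allowed
  have hse : s ≠ {e} := by
    rintro rfl
    obtain ⟨p, hp⟩ := exists_vort_singleton hN
    obtain ⟨e', he'⟩ := hsoft p hp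
    obtain ⟨h1, h2⟩ := Finset.mem_inter.1 he'
    have h3 : e ∈ bdry p := by
      by_contra h
      have := (mem_vort.1 hp).2
      rw [Finset.singleton_inter_of_notMem h] at this
      simp at this
    have h4 := hG.eq_of_mem_bdry (Finset.mem_insert_self e G) (Finset.mem_insert_of_mem h2) h3 h1
    exact he (h4 ▸ h2)
  have hse' : s' ≠ {e} := by
    rintro rfl
    obtain ⟨p, hp⟩ := exists_vort_singleton hN
    exact hs' p hp
  have hle : ∀ k, k ≤ (vort bdry (boxPlaquettes N) s).card →
      wt bdry (boxPlaquettes N) x (softWeight y G) s *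
        wt bdry (boxPlaquettes N) x (softWeight y ∅) s' ≤
      y ^ k * (x ^ s.card * x ^ s'.card) := by
    intro k hk
    have h1 := wt_le_pow hx (hy' G) (softWeight_le hy G) hy1 hk
    have h2 := wt_le_pow hx (hy' ∅) (softWeight_le hy ∅) hy1
      (Nat.zero_le (vort bdry (boxPlaquettes N) s').card)
    calc _ ≤ (y ^ k * x ^ s.card) * (y ^ 0 * x ^ s'.card) :=
          mul_le_mul h1 h2 (wt_nonneg hx (hy' ∅) _)
            (mul_nonneg (pow_nonneg hy _) (pow_nonneg hx _))
      _ = _ := by rw [pow_zero]; ring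
  have h2 : 2 ≤ C.card := by
    by_contra h2
    have h3 := (subset_singleton_cases heC h2 hsC).resolve_right hse
    have h4 := (subset_singleton_cases heC h2 hsC').resolve_right hse'
    rw [← hss, h3, h4] at heC
    simp at heC
  rw [if_pos h2]
  by_cases hv : 1 ≤ (vort bdry (boxPlaquettes N) s).card
  · refine (hle 1 hv).trans (mul_le_mul_of_nonneg_right ?_
      (mul_nonneg (pow_nonneg hx _) (pow_nonneg hx _)))
    rw [pow_one]
    split_ifs <;> linarith
  · have hvs : ∀ p, p ∉ vort bdry (boxPlaquettes N) s := fun p hp =>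
      hv (Finset.card_pos.2 ⟨p, hp⟩)
    have hchi : chi Γ s ≠ chi Γ s' := by
      refine ((hR s s').1 hRs).resolve_right ?_
      rintro ⟨p, hp | hp, -⟩
      · exact hvs p hp
      · exact hs' p hp
    have hk : D - 4 ≤ C.card := by
      refine (hD.cases C.card).resolve_right ?_
      rintro ⟨hX, hN'⟩
      have hG0 : ∀ e ∈ Γ, (∀ v ∈ X, 4 ≤ supDist e.1 v) → e ∈ Γ := fun e he _ => he
      rcases chi_eq_one_or Γ s with h | h
      · rcases chi_eq_one_or Γ s' with h' | h'
        · exact hchi (h.trans h'.symm)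
        · have := (hΓ.card_vort hG0 hC hsC' hX hN' h').1
          obtain ⟨p, hp⟩ := Finset.card_pos.1 (lt_of_lt_of_le (by norm_num) this)
          exact hs' p hp
      · have := (hΓ.card_vort hG0 hC hsC hX hN' h).1
        exact hv (by omega)
    rw [if_pos (max_le h2 hk)]
    refine (hle 0 (Nat.zero_le _)).trans (mul_le_mul_of_nonneg_right ?_
      (mul_nonneg (pow_nonneg hx _) (pow_nonneg hx _)))
    rw [pow_zero]
    linarith

/-- At `β = ∞` an edge is rarely excited. -/
lemma average_edgeInd_le {N : ℕ} {e : PosEdge} (hN : ∀ c, |e.1 c| + 4 ≤ N) {x y : ℝ} (hx : 0 ≤ x)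
    (hy : 0 ≤ y) (hα : rate x < 1) :
    average (boxEdges N) (softWt N x y ∅) (edgeInd e) ≤ rate x ^ 2 / (1 - rate x) := by
  classical
  have hy' : ∀ p, 0 ≤ softWeight y ∅ p := softWeight_nonneg hy ∅
  have hZ : 0 < ∑ A ∈ (boxEdges N).powerset,
    softWt N x y ∅ A := sum_wt_pos (boxEdges N) hx hy'
  have hZZ : 0 < ∑ z ∈ (boxEdges N).powerset ×ˢ (boxEdges N).powerset,
      softWt N x y ∅ z.1 * softWt N x y ∅ z.2 := by
    rw [Finset.sum_product, ← Finset.sum_mul_sum]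
    exact mul_pos hZ hZ
  have hnbr : ∀ p ∈ boxPlaquettes N, ∀ e ∈ bdry p, ∀ e' ∈ bdry p, e ≠ e' → e' ∈ nbr e :=
    fun p _ => mem_nbr_of_mem_bdry p
  have hmul : average (boxEdges N) (softWt N x y ∅) (edgeInd e) =
      average (boxEdges N) (softWt N x y ∅) (edgeInd e) *
        average (boxEdges N) (softWt N x y ∅) fun _ => 1 := by rw [average_one hZ, mul_one]
  rw [hmul, average_mul_average, div_le_iff₀ hZZ]
  refine Eq.trans_le ?_ ((sum_cluster_le nbr_symm card_nbr_le (by norm_num) hnbr (boxEdges N) e hx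
    hy' hy' (fun s _ => e ∈ s) zero_le_one le_rfl (k₁ := 2) (k₂ := 0) hα ?_).trans_eq ?_)
  · refine Finset.sum_congr rfl fun z _ => ?_
    by_cases h : e ∈ z.1
    · have h1 : e ∈ z.1 ∪ z.2 := Finset.mem_union_left _ h
      rw [if_pos ⟨h1, Finset.mem_inter.2 ⟨h, self_mem_comp h1⟩⟩, edgeInd, if_pos h]
      simp [softWt]
    · rw [if_neg fun h' => h (Finset.mem_inter.1 h'.2).1, edgeInd, if_neg h]
      simp
  · rintro C s s' hC - hss hs
    by_cases h0 : wt bdry (boxPlaquettes N) x (softWeight y ∅) s = 0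
    · rw [h0, zero_mul]
      exact bound_nonneg zero_le_one le_rfl hx _ _ _ _
    have h2 : 2 ≤ C.card := by
      by_contra h2
      rcases subset_singleton_cases hC.root_mem h2
        (hss ▸ Finset.subset_union_left : s ⊆ C) with h | h
      · rw [h] at hs; simp at hs
      · obtain ⟨p, hp⟩ := exists_vort_singleton hN
        exact h0 (wt_eq_zero (h ▸ hp) (softWeight_empty y p))
    rw [if_pos h2]
    have hle : ∀ s, wt bdry (boxPlaquettes N) x (softWeight y ∅) s ≤ x ^ s.card := by
      intro s
      have := wt_le_pow (y₀ := 1) hx hy' (fun p => by rw [softWeight_empty]; exact zero_le_one)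
        le_rfl (Nat.zero_le (vort bdry (boxPlaquettes N) s).card)
      simpa using this
    have := mul_le_mul (hle s) (hle s') (wt_nonneg hx hy' _) (pow_nonneg hx _)
    simpa using this
  · rw [zero_mul, add_zero, one_mul, rate]
    rfl

/-! ### Peeling off the soft edges one by one -/

/-- Comparison of one step of the recursion with the map `d ↦ d (1 - r) / (1 + r)`. -/
lemma abs_step_sub_le {d u v p ε a Δ : ℝ} (ha : 0 ≤ a) (hΔ : 0 ≤ Δ) (hp : 0 ≤ p) (hv : 0 ≤ v)
    (hd : |d| ≤ 1) (hu : |u - d * p| ≤ ε) (hvp : |v - p| ≤ ε) :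
    |(d * (1 - a) - Δ * u) / (1 + a + Δ * v) -
      (1 - (a + Δ * p)) / (1 + (a + Δ * p)) * d| ≤ 2 * Δ * ε := by
  have hr : 0 ≤ a + Δ * p := by positivity
  set r := a + Δ * p with hr'
  have hden : 1 ≤ 1 + a + Δ * v := by nlinarith [mul_nonneg hΔ hv]
  have heq : (d * (1 - a) - Δ * u) / (1 + a + Δ * v) - (1 - r) / (1 + r) * d =
      (-(Δ * (u - d * p)) - (1 - r) / (1 + r) * d * (Δ * (v - p))) / (1 + a + Δ * v) := by
    rw [eq_div_iff (by positivity), sub_mul, div_mul_cancel₀ _ (by positivity)]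
    have h1 : 1 + r ≠ 0 := by positivity
    field_simp
    rw [hr']
    ring
  have h1 : |(1 - r) / (1 + r) * d| ≤ 1 := by
    rw [abs_mul, abs_div, abs_of_pos (by positivity : 0 < 1 + r)]
    refine mul_le_one₀ (div_le_one_of_le₀ (abs_le.2 ⟨by linarith, by linarith⟩) (by positivity))
      (abs_nonneg _) hd
  have hε : 0 ≤ ε := (abs_nonneg _).trans hu
  rw [heq, abs_div, abs_of_pos (by positivity : 0 < 1 + a + Δ * v)]
  refine (div_le_self (abs_nonneg _) hden).trans ((abs_sub _ _).trans ?_)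
  rw [abs_neg, abs_mul, abs_mul _ (Δ * (v - p)), abs_mul Δ (v - p), abs_of_nonneg hΔ]
  have h2 : Δ * |u - d * p| ≤ Δ * ε := mul_le_mul_of_nonneg_left hu hΔ
  have h3 : Δ * |v - p| ≤ Δ * ε := mul_le_mul_of_nonneg_left hvp hΔ
  have h4 := mul_le_mul h1 h3 (mul_nonneg hΔ (abs_nonneg _)) zero_le_one
  linarith

lemma exp_neg_le_quadratic {t : ℝ} (ht : 0 ≤ t) : Real.exp (-t) ≤ 1 - t + t ^ 2 / 2 := by
  have h1 := Real.quadratic_le_exp_of_nonneg ht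
  rw [Real.exp_neg, inv_le_iff_one_le_mul₀ (Real.exp_pos t)]
  have h2 : 0 ≤ 1 - t + t ^ 2 / 2 := by nlinarith [sq_nonneg (t - 1)]
  have h3 := mul_le_mul_of_nonneg_left h1 h2
  nlinarith [sq_nonneg (t ^ 2)]

lemma abs_div_sub_exp_le {r : ℝ} (hr : 0 ≤ r) :
    |(1 - r) / (1 + r) - Real.exp (-2 * r)| ≤ 2 * r ^ 2 := by
  have h1 := exp_neg_le_quadratic (mul_nonneg zero_le_two hr)
  have h2 := Real.add_one_le_exp (-(2 * r))
  rw [neg_mul]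
  have h3 : 1 - 2 * r ≤ (1 - r) / (1 + r) := by
    rw [le_div_iff₀ (by positivity)]; nlinarith [sq_nonneg r]
  have h4 : (1 - r) / (1 + r) ≤ 1 - 2 * r + 2 * r ^ 2 := by
    rw [div_le_iff₀ (by positivity)]
    nlinarith [pow_nonneg hr 3]
  rw [abs_le]
  constructor <;> nlinarith

lemma half_le_one_sub_exp {r : ℝ} (hr : 0 ≤ r) (hr1 : r ≤ 1) :
    r / 2 ≤ 1 - Real.exp (-2 * r) := by
  have h1 := exp_neg_le_quadratic (mul_nonneg zero_le_two hr)
  have h2 := Real.add_one_le_exp (2 * r)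
  have h3 : Real.exp (-2 * r) ≤ (1 + 2 * r)⁻¹ := by
    rw [neg_mul, Real.exp_neg]
    exact inv_anti₀ (by positivity) (by linarith)
  have h4 : (1 + 2 * r)⁻¹ ≤ 1 - r / 2 := by
    rw [inv_le_iff_one_le_mul₀ (by positivity)]
    nlinarith
  linarith

lemma vortexWeight_eq (x y : ℝ) (e : PosEdge) (A : Finset PosEdge) :
    vortexWeight x y e A = y ^ 6 * x + y ^ 6 * (x⁻¹ - x) * edgeInd e A := by
  unfold vortexWeight edgeInd
  split_ifs <;> ring

lemma chi_symmDiff_singleton {Γ : Finset PosEdge} {e : PosEdge} (he : e ∈ Γ)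
    (A : Finset PosEdge) : chi Γ (symmDiff {e} A) = -chi Γ A := by
  rw [chi_symmDiff, chi, Finset.singleton_inter_of_mem he, Finset.card_singleton, pow_one,
    neg_one_mul]

lemma average_softWt_insert {N : ℕ} {x y : ℝ} (hx : 0 < x) (hy : 0 ≤ y) {Γ G : Finset PosEdge}
    {e : PosEdge} (heΓ : e ∈ Γ) (he : e ∉ G) (hG : Sparse (insert e G))
    (hN : ∀ c, |e.1 c| + 4 ≤ N) :
    average (boxEdges N) (softWt N x y (insert e G)) (chi Γ) =
      (average (boxEdges N) (softWt N x y G) (chi Γ) * (1 - y ^ 6 * x) -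
        y ^ 6 * (x⁻¹ - x) *
          average (boxEdges N) (softWt N x y G) (fun A => chi Γ A * edgeInd e A)) /
      (1 + y ^ 6 * x +
        y ^ 6 * (x⁻¹ - x) * average (boxEdges N) (softWt N x y G) (edgeInd e)) := by
  have hZ : 0 < ∑ A ∈ (boxEdges N).powerset, softWt N x y G A :=
    sum_wt_pos (boxEdges N) hx.le (softWeight_nonneg hy G)
  have h1 := sum_softWt_insert (x := x) (y := y) hx he hG hN (chi Γ)
  have h2 := sum_softWt_insert (x := x) (y := y) hx he hG hN (fun _ => 1)
  have h3 : ∀ A, chi Γ A + vortexWeight x y e A * chi Γ (symmDiff {e} A) =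
      (1 - y ^ 6 * x) * chi Γ A + -(y ^ 6 * (x⁻¹ - x)) * (chi Γ A * edgeInd e A) := by
    intro A
    rw [chi_symmDiff_singleton heΓ, vortexWeight_eq]
    ring
  have h4 : ∀ A, 1 + vortexWeight x y e A * 1 =
      (1 + y ^ 6 * x) * 1 + y ^ 6 * (x⁻¹ - x) * edgeInd e A := by
    intro A
    rw [vortexWeight_eq]
    ring
  simp only [h3] at h1
  simp only [h4] at h2
  have h5 : average (boxEdges N) (softWt N x y (insert e G)) (chi Γ) =
      average (boxEdges N) (softWt N x y G) (fun A => (1 - y ^ 6 * x) * chi Γ A +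
        -(y ^ 6 * (x⁻¹ - x)) * (chi Γ A * edgeInd e A)) /
      average (boxEdges N) (softWt N x y G) (fun A => (1 + y ^ 6 * x) * 1 +
        y ^ 6 * (x⁻¹ - x) * edgeInd e A) := by
    simp only [average] at h1 h2 ⊢
    rw [← h1, ← h2, div_div_div_cancel_right₀ hZ.ne']
    simp only [mul_one]
  rw [h5, average_add, average_add, average_const_mul, average_const_mul, average_const_mul,
    average_const_mul, average_one hZ]
  ring

lemma edgeInd_nonneg (e : PosEdge) (A : Finset PosEdge) : 0 ≤ edgeInd e A := by
  unfold edgeInd; split_ifs <;> norm_num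

lemma straight_empty (X : Finset Vertex) : Straight ∅ X := fun _ _ _ => by simp

/-- Softening the edges of `G` multiplies the expectation of the character by approximately
`exp (-2 r)` for each edge. The errors accumulate at most geometrically, since the steps are
contractions. -/
lemma abs_average_softWt_sub_le {Γ : Finset PosEdge} {X : Finset Vertex} (hΓ : Straight Γ X)
    {N : ℕ} {D : PosEdge → ℕ} {x y : ℝ} (hx : 0 < x) (hx1 : x ≤ 1) (hy : 0 < y) (hy1 : y ≤ 1)
    (hyx : y ^ 6 ≤ x) (hα : rate x < 1) {p δ : ℝ} (hp : 0 ≤ p) (hp1 : p ≤ 1)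
    {r : ℝ} (hr : r = y ^ 6 * x + y ^ 6 * (x⁻¹ - x) * p) (G : Finset PosEdge) (hGΓ : G ⊆ Γ)
    (hG : Sparse G) (hN : ∀ e ∈ G, ∀ c, |e.1 c| + 4 ≤ N) (hD : ∀ e ∈ G, Clear X N e (D e))
    (hδ : ∀ e ∈ G, |average (boxEdges N) (softWt N x y ∅) (edgeInd e) - p| ≤ δ) :
    |average (boxEdges N) (softWt N x y G) (chi Γ) -
      Real.exp (-2 * r) ^ G.card * average (boxEdges N) (softWt N x y ∅) (chi Γ)| ≤
    (4 * r + 4 * (y ^ 6 * (x⁻¹ - x)) * (y * (rate x ^ 2 / (1 - rate x))) / r) +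
      2 * (y ^ 6 * (x⁻¹ - x)) *
        ∑ e ∈ G, (rate x ^ (max 2 (D e - 4)) / (1 - rate x) + δ) := by
  have hxinv : 1 ≤ x⁻¹ := (one_le_inv₀ hx).2 hx1
  set Δ := y ^ 6 * (x⁻¹ - x) with hΔ
  have hΔ0 : 0 ≤ Δ := mul_nonneg (by positivity) (by linarith)
  have hr0 : 0 < r := by rw [hr]; positivity
  have hr1 : r ≤ 1 := by
    have h1 : Δ * p ≤ Δ := mul_le_of_le_one_right hΔ0 hp1
    have h2 : y ^ 6 * x⁻¹ ≤ 1 := by rw [← div_eq_mul_inv]; exact div_le_one_of_le₀ hyx hx.le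
    rw [hr]
    calc _ ≤ y ^ 6 * x + Δ := by linarith
      _ = y ^ 6 * x⁻¹ := by rw [hΔ]; ring
      _ ≤ 1 := h2
  set α := rate x with hα'
  have hα0 : 0 ≤ α := rate_nonneg hx.le
  set c := y * (α ^ 2 / (1 - α)) with hc
  have h1α : 0 < 1 - α := by linarith
  have hc0 : 0 ≤ c := by positivity
  set B := 4 * r + 4 * Δ * c / r with hB
  have hB0 : 0 ≤ B := by positivity
  set ρ := Real.exp (-2 * r) with hρ
  have hρ0 : 0 < ρ := Real.exp_pos _
  have hρ1 : ρ ≤ 1 := Real.exp_le_one_iff.2 (by linarith)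
  have hBρ : 2 * r ^ 2 + 2 * Δ * c ≤ (1 - ρ) * B := by
    calc 2 * r ^ 2 + 2 * Δ * c = r / 2 * B := by rw [hB]; field_simp; ring
      _ ≤ (1 - ρ) * B := mul_le_mul_of_nonneg_right (half_le_one_sub_exp hr0.le hr1) hB0
  have hδ0 : ∀ e ∈ G, 0 ≤ δ := fun e he => (abs_nonneg _).trans (hδ e he)
  clear_value B c
  induction G using Finset.induction_on with
  | empty => simpa using hB0
  | insert e G he ih =>
    specialize ih ((Finset.subset_insert e G).trans hGΓ) (hG.mono (Finset.subset_insert e G))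
      (fun e' he' => hN e' (Finset.mem_insert_of_mem he'))
      (fun e' he' => hD e' (Finset.mem_insert_of_mem he'))
      (fun e' he' => hδ e' (Finset.mem_insert_of_mem he'))
      (fun e' he' => hδ0 e' (Finset.mem_insert_of_mem he'))
    have hself := Finset.mem_insert_self e G
    have hw : ∀ G A, 0 ≤ softWt N x y G A := softWt_nonneg N hx.le hy.le
    have hZ : 0 < ∑ A ∈ (boxEdges N).powerset, softWt N x y G A :=
      sum_wt_pos (boxEdges N) hx.le (softWeight_nonneg hy.le G)
    set d := average (boxEdges N) (softWt N x y G) (chi Γ) with hd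
    set u := average (boxEdges N) (softWt N x y G) (fun A => chi Γ A * edgeInd e A) with hu
    set v := average (boxEdges N) (softWt N x y G) (edgeInd e) with hv
    set pN := average (boxEdges N) (softWt N x y ∅) (edgeInd e) with hpN
    set d₀ := average (boxEdges N) (softWt N x y ∅) (chi Γ) with hd₀
    set η := α ^ (max 2 (D e - 4)) / (1 - α) with hη
    have hη0 : 0 ≤ η := by positivity
    have hd1 : |d| ≤ 1 := abs_average_le (hw G) fun A => (abs_chi Γ A).le
    have hv0 : 0 ≤ v := div_nonneg (Finset.sum_nonneg fun A _ =>
      mul_nonneg (hw G A) (edgeInd_nonneg e A)) hZ.le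
    have hpp := hδ e hself
    have h1 : |u - d * pN| ≤ c + η := by
      have := abs_average_mul_sub_le hΓ (hN e hself) (hD e hself) he hG hx.le hy.le hy1 hα
      rwa [one_mul, ← hα', ← hc] at this
    have h2 : |v - pN| ≤ c + η := by
      have := abs_average_mul_sub_le (straight_empty X) (hN e hself) (hD e hself) he hG hx.le
        hy.le hy1 hα
      have hchi : chi (∅ : Finset PosEdge) = fun _ => 1 := funext chi_empty_left
      simp only [hchi, one_mul] at this
      rwa [average_one hZ, one_mul, ← hα', ← hc] at this
    have h3 : |u - d * p| ≤ c + η + δ := by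
      have h4 : u - d * p = (u - d * pN) + d * (pN - p) := by ring
      rw [h4]
      refine (abs_add_le _ _).trans (add_le_add h1 ?_)
      rw [abs_mul]
      exact (mul_le_of_le_one_left (abs_nonneg _) hd1).trans hpp
    have h4 : |v - p| ≤ c + η + δ := by
      have h4 : v - p = (v - pN) + (pN - p) := by ring
      rw [h4]
      exact (abs_add_le _ _).trans (add_le_add h2 hpp)
    have h5 := abs_step_sub_le (a := y ^ 6 * x) (by positivity) hΔ0 hp hv0 hd1 h3 h4
    rw [average_softWt_insert hx hy.le (hGΓ hself) he hG (hN e hself)]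
    rw [← hr] at h5
    rw [Finset.card_insert_of_notMem he, Finset.sum_insert he]
    have h6 : |(1 - r) / (1 + r) * d - ρ * d| ≤ 2 * r ^ 2 := by
      rw [← sub_mul, abs_mul]
      exact (mul_le_of_le_one_right (abs_nonneg _) hd1).trans (abs_div_sub_exp_le hr0.le)
    have h7 : |ρ * d - ρ * (ρ ^ G.card * d₀)| ≤
        ρ * (B + 2 * Δ * ∑ e ∈ G, (α ^ (max 2 (D e - 4)) / (1 - α) + δ)) := by
      rw [← mul_sub, abs_mul, abs_of_pos hρ0]
      exact mul_le_mul_of_nonneg_left ih hρ0.le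
    set S := ∑ e ∈ G, (α ^ (max 2 (D e - 4)) / (1 - α) + δ) with hS
    have hS0 : 0 ≤ S := Finset.sum_nonneg fun e' he' =>
      add_nonneg (div_nonneg (pow_nonneg hα0 _) h1α.le) (hδ0 e' (Finset.mem_insert_of_mem he'))
    have h8 : ρ * (2 * Δ * S) ≤ 2 * Δ * S :=
      mul_le_of_le_one_left (mul_nonneg (mul_nonneg zero_le_two hΔ0) hS0) hρ1
    have h12 : ρ ^ (G.card + 1) * d₀ = ρ * (ρ ^ G.card * d₀) := by ring
    rw [h12]
    refine (abs_sub_le _ ((1 - r) / (1 + r) * d) _).trans ?_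
    refine (add_le_add h5 ((abs_sub_le _ (ρ * d) _).trans (add_le_add h6 h7))).trans ?_
    rw [mul_add ρ]
    simp only [← hη]
    linarith

/-! ### Monotonicity in the box and in the couplings -/

section Monotone

variable {V Q : Type*} [DecidableEq V]

/-- The average of a function does not see points on which neither it nor the weight depends. -/
lemma average_eq_of_subset {Λ Λ' : Finset V} (h : Λ ⊆ Λ') {w F : Finset V → ℝ}
    (hw : ∀ A, w A = w (A ∩ Λ)) (hF : ∀ A, F A = F (A ∩ Λ)) :
    average Λ' w F = average Λ w F := by
  obtain ⟨S, rfl, hS⟩ : ∃ S, Λ' = Λ ∪ S ∧ Disjoint Λ S :=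
    ⟨Λ' \ Λ, (Finset.union_sdiff_of_subset h).symm, Finset.disjoint_sdiff⟩
  clear h
  induction S using Finset.induction_on with
  | empty => rw [Finset.union_empty]
  | insert a S ha ih =>
    rw [Finset.disjoint_insert_right] at hS
    rw [← ih hS.2, Finset.union_insert]
    have haΛ : a ∉ Λ ∪ S := by simp [hS.1, ha]
    have key : ∀ f : Finset V → ℝ, (∀ A, f A = f (A ∩ Λ)) →
        ∑ A ∈ (insert a (Λ ∪ S)).powerset, f A = 2 * ∑ A ∈ (Λ ∪ S).powerset, f A := by
      intro f hf
      rw [Finset.sum_powerset_insert haΛ, two_mul]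
      congr 1
      refine Finset.sum_congr rfl fun A _ => ?_
      rw [hf, Finset.insert_inter_of_notMem hS.1, ← hf]
    rw [average, average, key w hw, key (fun A => w A * F A) fun A => by rw [hw A, hF A],
      mul_div_mul_left _ _ two_ne_zero]

lemma chi_inter {Λ F : Finset V} (h : F ⊆ Λ) (A : Finset V) : chi F A = chi F (A ∩ Λ) := by
  rw [chi, chi, Finset.inter_assoc, Finset.inter_eq_right.2 h]

lemma average_congr {V : Type*} {Λ : Finset V} {w w' F F' : Finset V → ℝ} (h : ∀ A ⊆ Λ, w A = w' A)
    (hF : ∀ A ⊆ Λ, F A = F' A) : average Λ w F = average Λ w' F' := by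
  unfold average
  congr 1
  · exact Finset.sum_congr rfl fun A hA => by
      rw [h A (Finset.mem_powerset.1 hA), hF A (Finset.mem_powerset.1 hA)]
  · exact Finset.sum_congr rfl fun A hA => h A (Finset.mem_powerset.1 hA)

lemma wt_eq_cellWeight {bd : Q → Finset V} {Λ : Finset V} (P : Finset Q) (x : ℝ) (y : Q → ℝ)
    {A : Finset V} (hA : A ⊆ Λ) :
    wt bd P x y A = cellWeight (Λ.disjSum P) (Sum.elim (fun e => {e}) bd)
      (Sum.elim (fun _ => x) y) A := by
  rw [cellWeight, Finset.prod_disjSum, wt, vort, Finset.prod_filter]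
  congr 1
  simp only [Sum.elim_inl]
  have : ∀ e, Odd (A ∩ {e}).card ↔ e ∈ A := by
    intro e
    by_cases h : e ∈ A
    · simp [Finset.inter_singleton_of_mem h, h]
    · simp [Finset.inter_singleton_of_notMem h, h]
  simp only [this]
  rw [Finset.prod_ite_mem, Finset.prod_const, Finset.inter_eq_right.2 hA]

lemma average_wt_nonneg {bd : Q → Finset V} (Λ : Finset V) (P : Finset Q) {x : ℝ} (hx : 0 ≤ x)
    (hx1 : x ≤ 1) {y : Q → ℝ} (hy : ∀ p, 0 ≤ y p) (hy1 : ∀ p, y p ≤ 1) (F : Finset V) :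
    0 ≤ average Λ (wt bd P x y) (chi F) := by
  rw [average_congr (fun A hA => wt_eq_cellWeight P x y hA) fun _ _ => rfl]
  refine average_nonneg Λ _ _ ?_ ?_ F
  · rintro (i | i) <;> simp [hx, hy]
  · rintro (i | i) <;> simp [hx1, hy1]

/-- The expectation of a character decreases with the weights of the vortices. -/
lemma average_wt_anti {bd : Q → Finset V} (Λ : Finset V) (P : Finset Q) {x : ℝ} (hx : 0 ≤ x)
    (hx1 : x ≤ 1) {y y' : Q → ℝ} (hy : ∀ p, 0 ≤ y' p) (hle : ∀ p, y' p ≤ y p)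
    (hy1 : ∀ p, y p ≤ 1) (F : Finset V) :
    average Λ (wt bd P x y) (chi F) ≤ average Λ (wt bd P x y') (chi F) := by
  rw [average_congr (fun A hA => wt_eq_cellWeight P x y hA) fun _ _ => rfl,
    average_congr (fun A hA => wt_eq_cellWeight P x y' hA) fun _ _ => rfl]
  refine average_le_of_le Λ _ _ ?_ ?_ ?_ F
  · rintro (i | i) <;> simp [hx, hy]
  · rintro (i | i) <;> simp [hle]
  · rintro (i | i) <;> simp [hx1, hy1]

/-- The expectation of a character increases with the box. -/
lemma average_wt_mono [DecidableEq Q] {bd : Q → Finset V} {Λ Λ' : Finset V} {P P' : Finset Q}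
    (hΛ : Λ ⊆ Λ') (hP : P ⊆ P') (hbd : ∀ p ∈ P, bd p ⊆ Λ) {x : ℝ} (hx : 0 ≤ x) (hx1 : x ≤ 1)
    {y : Q → ℝ} (hy : ∀ p, 0 ≤ y p) (hy1 : ∀ p, y p ≤ 1) {F : Finset V} (hF : F ⊆ Λ) :
    average Λ (wt bd P x y) (chi F) ≤ average Λ' (wt bd P' x y) (chi F) := by
  set S : V ⊕ Q → Finset V := Sum.elim (fun e => {e}) bd with hS
  set q : V ⊕ Q → ℝ := Sum.elim (fun _ => x) y with hq
  have hq0 : ∀ i, 0 ≤ q i := by rintro (i | i) <;> simp [hq, hx, hy]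
  have hq1 : ∀ i, q i ≤ 1 := by rintro (i | i) <;> simp [hq, hx1, hy1]
  have hI : Λ.disjSum P ⊆ Λ'.disjSum P' := Finset.disjSum_mono hΛ hP
  have hSΛ : ∀ i ∈ Λ.disjSum P, S i ⊆ Λ := by
    rintro (i | i) hi
    · simpa [hS] using hi
    · exact hbd i (by simpa using hi)
  rw [average_congr (fun A hA => wt_eq_cellWeight P x y hA) fun _ _ => rfl,
    average_congr (fun A hA => wt_eq_cellWeight P' x y hA) fun _ _ => rfl,
    ← average_eq_of_subset hΛ _ (chi_inter hF)]
  · -- switch off the couplings outside the smaller box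
    have hext : cellWeight (Λ.disjSum P) S q =
        cellWeight (Λ'.disjSum P') S fun i => if i ∈ Λ.disjSum P then q i else 1 := by
      funext A
      rw [cellWeight, cellWeight, ← Finset.prod_subset hI]
      · exact Finset.prod_congr rfl fun i hi => by rw [if_pos hi]
      · intro i _ hi
        rw [if_neg hi, ite_self]
    rw [hext]
    refine average_le_of_le Λ' _ S hq0 (fun i => ?_) (fun i => ?_) F
    · split_ifs
      exacts [le_rfl, hq1 i]
    · split_ifs
      exacts [hq1 i, le_rfl]
  · intro A
    refine Finset.prod_congr rfl fun i hi => ?_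
    rw [Finset.inter_assoc, Finset.inter_eq_right.2 (hSΛ i hi)]

lemma sum_powerset_map {V : Type*} (Λ : Finset V) (f : V ↪ V) (φ : Finset V → ℝ) :
    ∑ A ∈ (Λ.map f).powerset, φ A = ∑ A ∈ Λ.powerset, φ (A.map f) := by
  symm
  refine Finset.sum_bij (fun A _ => A.map f) ?_ ?_ ?_ ?_
  · intro A hA
    rw [Finset.mem_powerset] at hA ⊢
    exact Finset.map_subset_map.2 hA
  · exact fun A _ B _ h => Finset.map_injective f h
  · intro B hB
    obtain ⟨A, hA, rfl⟩ := Finset.subset_map_iff.1 (Finset.mem_powerset.1 hB)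
    exact ⟨A, Finset.mem_powerset.2 hA, rfl⟩
  · exact fun _ _ => rfl

/-- Relabelling of the points and the plaquettes. -/
lemma average_wt_map {bd : Q → Finset V} {Λ : Finset V} {P : Finset Q} (f : V ↪ V) (g : Q ↪ Q)
    (hfg : ∀ p, bd (g p) = (bd p).map f) (x y : ℝ) (F : Finset V) :
    average (Λ.map f) (wt bd (P.map g) x fun _ => y) (chi (F.map f)) =
      average Λ (wt bd P x fun _ => y) (chi F) := by
  have hchi : ∀ A, chi (F.map f) (A.map f) = chi F A := fun A => by
    rw [chi, chi, ← Finset.map_inter, Finset.card_map]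
  have hwt : ∀ A, wt bd (P.map g) x (fun _ => y) (A.map f) = wt bd P x (fun _ => y) A := by
    intro A
    have : vort bd (P.map g) (A.map f) = (vort bd P A).map g := by
      ext p
      simp only [mem_vort, Finset.mem_map]
      constructor
      · rintro ⟨⟨p, hp, rfl⟩, h⟩
        rw [hfg, ← Finset.map_inter, Finset.card_map] at h
        exact ⟨p, ⟨hp, h⟩, rfl⟩
      · rintro ⟨p, ⟨hp, h⟩, rfl⟩
        rw [hfg, ← Finset.map_inter, Finset.card_map]
        exact ⟨⟨p, hp, rfl⟩, h⟩
    rw [wt, wt, this, Finset.card_map, Finset.prod_map]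
  rw [average, average, sum_powerset_map, sum_powerset_map]
  simp only [hchi, hwt]

end Monotone

/-- The expectation in the box of size `N` of the character of `F`, for vortices of weight `y`. -/
noncomputable def boxAverage (x y : ℝ) (F : Finset PosEdge) (N : ℕ) : ℝ :=
  average (boxEdges N) (wt bdry (boxPlaquettes N) x fun _ => y) (chi F)

lemma box_mono {N M : ℕ} (h : N ≤ M) : box N ⊆ box M := fun v hv => by
  rw [mem_box] at hv ⊢
  intro c
  have := hv c
  omega

lemma boxEdges_mono {N M : ℕ} (h : N ≤ M) : boxEdges N ⊆ boxEdges M := fun e he => by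
  rw [mem_boxEdges] at he ⊢
  exact ⟨box_mono h he.1, box_mono h he.2⟩

lemma boxPlaquettes_mono {N M : ℕ} (h : N ≤ M) : boxPlaquettes N ⊆ boxPlaquettes M := by
  intro p hp
  obtain ⟨a, i, k, hik, rfl⟩ := exists_eq_plane p
  rw [mem_boxPlaquettes] at hp ⊢
  exact ⟨box_mono h hp.1, box_mono h hp.2.1, box_mono h hp.2.2.1, box_mono h hp.2.2.2⟩

lemma boxAverage_mono {x y : ℝ} (hx : 0 ≤ x) (hx1 : x ≤ 1) (hy : 0 ≤ y) (hy1 : y ≤ 1)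
    {F : Finset PosEdge} {N M : ℕ} (h : N ≤ M) (hF : F ⊆ boxEdges N) :
    boxAverage x y F N ≤ boxAverage x y F M :=
  average_wt_mono (boxEdges_mono h) (boxPlaquettes_mono h) (fun _ => bdry_subset_boxEdges) hx hx1
    (fun _ => hy) (fun _ => hy1) hF

lemma boxAverage_nonneg {x y : ℝ} (hx : 0 ≤ x) (hx1 : x ≤ 1) (hy : 0 ≤ y) (hy1 : y ≤ 1)
    (F : Finset PosEdge) (N : ℕ) : 0 ≤ boxAverage x y F N :=
  average_wt_nonneg _ _ hx hx1 (fun _ => hy) (fun _ => hy1) F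

lemma boxAverage_le_one {x y : ℝ} (hx : 0 ≤ x) (hy : 0 ≤ y) (F : Finset PosEdge) (N : ℕ) :
    boxAverage x y F N ≤ 1 :=
  (le_abs_self _).trans (abs_average_le (fun A => wt_nonneg hx (fun _ => hy) A)
    fun A => (abs_chi F A).le)

lemma exists_subset_boxEdges (F : Finset PosEdge) (R : ℕ) :
    ∃ N₀ : ℕ, ∀ N : ℕ, N₀ ≤ N → ∀ e ∈ F, ∀ c, |e.1 c| + R ≤ N := by
  refine ⟨(F.sup fun e => supDist e.1 0) + R, fun N hN e he c => ?_⟩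
  have h1 := Finset.le_sup (f := fun e : PosEdge => supDist e.1 0) he
  have h2 := abs_sub_le_supDist e.1 0 c
  rw [Pi.zero_apply, sub_zero] at h2
  omega

/-- The infinite volume limits exist. -/
lemma exists_tendsto_boxAverage {x y : ℝ} (hx : 0 ≤ x) (hx1 : x ≤ 1) (hy : 0 ≤ y) (hy1 : y ≤ 1)
    (F : Finset PosEdge) : ∃ l, Tendsto (boxAverage x y F) atTop (𝓝 l) := by
  obtain ⟨N₀, hN₀⟩ := exists_subset_boxEdges F 1
  have hF : ∀ n, F ⊆ boxEdges (n + N₀) := fun n e he =>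
    mem_boxEdges_of_abs_le (hN₀ (n + N₀) (Nat.le_add_left _ _) e he)
  have hmono : Monotone fun n => boxAverage x y F (n + N₀) := fun n m h =>
    boxAverage_mono hx hx1 hy hy1 (Nat.add_le_add_right h _) (hF n)
  refine ⟨⨆ n, boxAverage x y F (n + N₀), (tendsto_add_atTop_iff_nat N₀).1
    (tendsto_atTop_ciSup hmono ⟨1, ?_⟩)⟩
  rintro _ ⟨n, rfl⟩
  exact boxAverage_le_one hx hy F _

/-! ### Symmetries of the lattice -/

/-- A symmetry of the lattice that distorts the boxes by a bounded amount only preserves infinite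
volume expectations. -/
lemma limit_le_of_embedding {x y : ℝ} (hx : 0 ≤ x) (hx1 : x ≤ 1) (hy : 0 ≤ y) (hy1 : y ≤ 1)
    (f : PosEdge ↪ PosEdge) (g : PosPlaquette ↪ PosPlaquette)
    (hfg : ∀ p, bdry (g p) = (bdry p).map f) {k : ℕ}
    (hf : ∀ N, ∀ e ∈ boxEdges N, f e ∈ boxEdges (N + k))
    (hg : ∀ N, ∀ p ∈ boxPlaquettes N, g p ∈ boxPlaquettes (N + k)) {F : Finset PosEdge}
    {l l' : ℝ} (hl : Tendsto (boxAverage x y F) atTop (𝓝 l))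
    (hl' : Tendsto (boxAverage x y (F.map f)) atTop (𝓝 l')) : l ≤ l' := by
  refine le_of_tendsto_of_tendsto hl ((tendsto_add_atTop_iff_nat k).2 hl') ?_
  obtain ⟨N₀, hN₀⟩ := exists_subset_boxEdges F 1
  filter_upwards [eventually_ge_atTop N₀] with N hN
  have hF : F ⊆ boxEdges N := fun e he => mem_boxEdges_of_abs_le (hN₀ N hN e he)
  rw [boxAverage, ← average_wt_map f g hfg]
  refine average_wt_mono ?_ ?_ ?_ hx hx1 (fun _ => hy) (fun _ => hy1) (Finset.map_subset_map.2 hF)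
  · intro e he
    obtain ⟨e, he', rfl⟩ := Finset.mem_map.1 he
    exact hf N e he'
  · intro p hp
    obtain ⟨p, hp', rfl⟩ := Finset.mem_map.1 hp
    exact hg N p hp'
  · intro p hp
    obtain ⟨p, hp', rfl⟩ := Finset.mem_map.1 hp
    rw [hfg]
    exact Finset.map_subset_map.2 (bdry_subset_boxEdges hp')

section Symmetry

variable (σ : Equiv.Perm (Fin 4)) (t : Vertex)

/-- Permutation of the coordinates by `σ`, followed by translation by `t`. -/
def affine (v : Vertex) : Vertex := fun c => v (σ.symm c) + t c

lemma affine_injective : Function.Injective (affine σ t) := by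
  intro v w h
  funext c
  have := congrFun h (σ c)
  simpa [affine] using this

lemma affine_add_unit (v : Vertex) (i : Fin 4) :
    affine σ t (v + unit i) = affine σ t v + unit (σ i) := by
  funext c
  have : unit i (σ.symm c) = unit (σ i) c := by
    rw [unit_eq, unit_eq]
    simp only [Equiv.symm_apply_eq]
  simp only [affine, Pi.add_apply, this]
  ring

/-- The action of `affine` on edges. -/
def affineEdge : PosEdge ↪ PosEdge where
  toFun e := (affine σ t e.1, σ e.2)
  inj' _ _ h := Prod.ext (affine_injective σ t (congrArg Prod.fst h))
    (σ.injective (congrArg Prod.snd h))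

/-- The action of `affine` on plaquettes. -/
def affinePlaquette : PosPlaquette ↪ PosPlaquette where
  toFun p := (affine σ t p.1, plane (σ p.2.1.1) (σ p.2.1.2) fun h => p.2.2.ne (σ.injective h))
  inj' p p' h := by
    refine Prod.ext (affine_injective σ t (congrArg Prod.fst h)) ?_
    have h2 := congrArg Prod.snd h
    obtain ⟨_, ⟨i, k⟩, hik⟩ := p
    obtain ⟨_, ⟨i', k'⟩, hik'⟩ := p'
    dsimp only at h2 hik hik' ⊢
    unfold plane at h2
    have h3 := hik.le
    have h4 := hik'.le
    split_ifs at h2 <;> simp only [Subtype.mk.injEq, Prod.mk.injEq, σ.injective.eq_iff] at h2 ⊢ <;>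
      omega

lemma affinePlaquette_plane (a : Vertex) {i k : Fin 4} (h : i ≠ k) :
    affinePlaquette σ t (a, plane i k h) =
      (affine σ t a, plane (σ i) (σ k) fun h' => h (σ.injective h')) := by
  refine Prod.ext rfl ?_
  rcases lt_or_gt_of_ne h with h1 | h1
  · have : plane i k h = ⟨(i, k), h1⟩ := by rw [plane, dif_pos h1]
    rw [this]
    rfl
  · have : plane i k h = ⟨(k, i), h1⟩ := by rw [plane, dif_neg h1.not_gt]
    rw [this, plane_comm]
    rfl

lemma bdry_affinePlaquette (p : PosPlaquette) :
    bdry (affinePlaquette σ t p) = (bdry p).map (affineEdge σ t) := by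
  obtain ⟨a, i, k, h, rfl⟩ := exists_eq_plane p
  rw [affinePlaquette_plane]
  ext e
  rw [mem_bdry_plane, Finset.mem_map]
  have key : ∀ b j, affineEdge σ t (b, j) = (affine σ t b, σ j) := fun _ _ => rfl
  simp only [mem_bdry_plane]
  constructor
  · rintro (rfl | rfl | rfl | rfl)
    · exact ⟨(a, i), by simp, rfl⟩
    · exact ⟨(a + unit i, k), by simp, by rw [key, affine_add_unit]⟩
    · exact ⟨(a + unit k, i), by simp, by rw [key, affine_add_unit]⟩
    · exact ⟨(a, k), by simp, rfl⟩
  · rintro ⟨e, rfl | rfl | rfl | rfl, rfl⟩ <;> simp [key, affine_add_unit]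

lemma affine_mem_box {N : ℕ} {v : Vertex} (hv : v ∈ box N) :
    affine σ t v ∈ box (N + supDist t 0) := by
  rw [mem_box] at hv ⊢
  intro c
  have h1 := hv (σ.symm c)
  have h2 := abs_sub_le_supDist t 0 c
  rw [Pi.zero_apply, sub_zero] at h2
  refine (abs_add_le _ _).trans ?_
  push_cast
  omega

/-- All edges have the same infinite volume expectation. -/
lemma limit_edge_le {x y : ℝ} (hx : 0 ≤ x) (hx1 : x ≤ 1) (hy : 0 ≤ y) (hy1 : y ≤ 1)
    {e e' : PosEdge} {l l' : ℝ} (hl : Tendsto (boxAverage x y {e}) atTop (𝓝 l))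
    (hl' : Tendsto (boxAverage x y {e'}) atTop (𝓝 l')) : l ≤ l' := by
  set σ := Equiv.swap e.2 e'.2 with hσ
  set t : Vertex := fun c => e'.1 c - e.1 (σ.symm c) with ht
  have he : affineEdge σ t e = e' := by
    refine Prod.ext (funext fun c => ?_) (Equiv.swap_apply_left _ _)
    change e.1 (σ.symm c) + (e'.1 c - e.1 (σ.symm c)) = e'.1 c
    ring
  refine limit_le_of_embedding hx hx1 hy hy1 (affineEdge σ t) (affinePlaquette σ t)
    (bdry_affinePlaquette σ t) (k := supDist t 0) ?_ ?_ hl (l' := l') ?_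
  · intro N e he
    rw [mem_boxEdges] at he ⊢
    refine ⟨affine_mem_box σ t he.1, ?_⟩
    have := affine_mem_box σ t he.2
    rwa [affine_add_unit] at this
  · intro N p hp
    obtain ⟨a, i, k, hik, rfl⟩ := exists_eq_plane p
    rw [mem_boxPlaquettes] at hp
    rw [affinePlaquette_plane, mem_boxPlaquettes, ← affine_add_unit, ← affine_add_unit,
      ← affine_add_unit]
    exact ⟨affine_mem_box σ t hp.1, affine_mem_box σ t hp.2.1, affine_mem_box σ t hp.2.2.1,
      affine_mem_box σ t hp.2.2.2⟩
  · rwa [Finset.map_singleton, he]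

end Symmetry

/-! ### Unitary gauge -/

/-- The value of a `1`-form at an edge, which is `0` outside the box. -/
noncomputable def Form1.val {N : ℕ} (σ : Form1 N) (e : PosEdge) : ZMod 2 :=
  if h : e ∈ boxEdges N then σ ⟨e, h⟩ else 0

/-- The value of a `0`-form at a vertex, which is `0` outside the box. -/
noncomputable def Form0.val {N : ℕ} (φ : Form0 N) (v : Vertex) : ZMod 2 :=
  if h : v ∈ box N then φ ⟨v, h⟩ else 0

lemma Form1.eval_eq {N : ℕ} (σ : Form1 N) (q : Chain1) :
    σ.eval q = Finsupp.linearCombination ℤ σ.val q := by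
  rw [Finsupp.linearCombination_apply]
  rfl

lemma Form0.eval_eq {N : ℕ} (φ : Form0 N) (q : Chain0) :
    φ.eval q = Finsupp.linearCombination ℤ φ.val q := by
  rw [Finsupp.linearCombination_apply]
  rfl

lemma boundary_eq (q : Chain1) : boundary q = Finsupp.linearCombination ℤ edgeBoundary q := by
  rw [Finsupp.linearCombination_apply]
  rfl

/-- The exterior derivative of a `0`-form. -/
noncomputable def Form0.grad {N : ℕ} (φ : Form0 N) : Form1 N :=
  fun e => φ.val (e.1.1 + unit e.1.2) - φ.val e.1.1

lemma Form0.val_grad {N : ℕ} (φ : Form0 N) {e : PosEdge} (he : e ∈ boxEdges N) :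
    φ.grad.val e = φ.eval (edgeBoundary e) := by
  rw [Form1.val, dif_pos he, Form0.eval_eq, edgeBoundary, map_sub, Finsupp.linearCombination_single,
    Finsupp.linearCombination_single, one_smul, one_smul]
  rfl

/-- Stokes' theorem. -/
lemma Form0.eval_boundary {N : ℕ} (φ : Form0 N) {q : Chain1} (hq : q.support ⊆ boxEdges N) :
    φ.eval (boundary q) = φ.grad.eval q := by
  rw [Form1.eval_eq, Finsupp.linearCombination_apply, boundary, Form0.eval_eq, map_finsuppSum]
  refine Finsupp.sum_congr fun e he => ?_
  rw [map_smul, φ.val_grad (hq he), Form0.eval_eq]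

lemma Form1.val_sub {N : ℕ} (σ τ : Form1 N) (e : PosEdge) : (σ - τ).val e = σ.val e - τ.val e := by
  unfold Form1.val
  split_ifs <;> simp

lemma Form1.eval_sub {N : ℕ} (σ τ : Form1 N) (q : Chain1) :
    (σ - τ).eval q = σ.eval q - τ.eval q := by
  have h : (σ - τ).val = σ.val - τ.val := funext fun e => σ.val_sub τ e
  rw [Form1.eval_eq, Form1.eval_eq, Form1.eval_eq, h]
  simp only [Finsupp.linearCombination_apply, Pi.sub_apply, smul_sub, Finsupp.sum_sub]

lemma covariantEval_eq {N : ℕ} (σ : Form1 N) (φ : Form0 N) {q : Chain1}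
    (hq : q.support ⊆ boxEdges N) : covariantEval σ φ q = (σ - φ.grad).eval q := by
  rw [covariantEval, φ.eval_boundary hq, Form1.eval_sub]

lemma d_eq {N : ℕ} (σ : Form1 N) (p : PosPlaquette) :
    σ.d p = σ.val (p.1, p.2.1.1) + σ.val (p.1 + unit p.2.1.1, p.2.1.2) -
      σ.val (p.1 + unit p.2.1.2, p.2.1.1) - σ.val (p.1, p.2.1.2) := by
  rw [Form1.d, Form1.eval_eq, plaquetteBoundary]
  simp only [map_sub, map_add, Finsupp.linearCombination_single, one_smul]

lemma d_grad {N : ℕ} (φ : Form0 N) {p : PosPlaquette} (hp : p ∈ boxPlaquettes N) :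
    φ.grad.d p = 0 := by
  have h : ∀ e ∈ bdry p, φ.grad.val e = φ.val (e.1 + unit e.2) - φ.val e.1 := fun e he => by
    rw [Form1.val, dif_pos (bdry_subset_boxEdges hp he)]
    rfl
  rw [d_eq, h _ (by simp [bdry]), h _ (by simp [bdry]), h _ (by simp [bdry]),
    h _ (by simp [bdry])]
  dsimp only
  rw [add_right_comm p.1 (unit p.2.1.2)]
  ring

lemma d_sub_grad {N : ℕ} (σ : Form1 N) (φ : Form0 N) {p : PosPlaquette}
    (hp : p ∈ boxPlaquettes N) : (σ - φ.grad).d p = σ.d p := by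
  rw [Form1.d, Form1.eval_sub, ← Form1.d, ← Form1.d, d_grad φ hp, sub_zero]

/-! ### Configurations as sets of edges -/

/-- The set of edges where a `1`-form does not vanish. -/
noncomputable def Form1.supp {N : ℕ} (σ : Form1 N) : Finset PosEdge :=
  (boxEdges N).filter fun e => σ.val e ≠ 0

lemma Form1.val_eq_ind {N : ℕ} (σ : Form1 N) (e : PosEdge) : σ.val e = ind σ.supp e := by
  by_cases h : e ∈ boxEdges N
  · rcases zmod_two_eq (σ.val e) with h1 | h1 <;> simp [ind, Form1.supp, h, h1]
  · simp [ind, Form1.supp, h, Form1.val]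

lemma rho_eq_ite (z : ZMod 2) : rho z = if z = 1 then -1 else 1 := by
  rcases zmod_two_eq z with rfl | rfl <;> simp [rho]

lemma rho_add (z w : ZMod 2) : rho (z + w) = rho z * rho w := by
  have : (1 : ZMod 2) + 1 = 0 := rfl
  rcases zmod_two_eq z with rfl | rfl <;> rcases zmod_two_eq w with rfl | rfl <;> simp [rho, this]

lemma rho_sum {ι : Type*} (S : Finset ι) (f : ι → ZMod 2) :
    rho (∑ i ∈ S, f i) = ∏ i ∈ S, rho (f i) := by
  classical
  induction S using Finset.induction_on with
  | empty => simp [rho]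
  | insert a S ha ih => rw [Finset.sum_insert ha, Finset.prod_insert ha, rho_add, ih]

lemma rho_units_smul (s : ℤˣ) (z : ZMod 2) : rho ((s : ℤ) • z) = rho z := by
  rcases Int.units_eq_one_or s with rfl | rfl
  · simp
  · simp [ZMod.neg_eq_self_mod_two]

lemma rho_eval {N : ℕ} (σ : Form1 N) {γ : Chain1} (hγ : ∀ e, γ e ∈ ({-1, 0, 1} : Set ℤ)) :
    rho (σ.eval γ) = chi γ.support σ.supp := by
  rw [Form1.eval_eq, Finsupp.linearCombination_apply, Finsupp.sum, rho_sum, chi, Finset.inter_comm,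
    ← chi, chi_eq_prod]
  refine Finset.prod_congr rfl fun e he => ?_
  have h : γ e = 1 ∨ γ e = -1 := by
    have h0 := Finsupp.mem_support_iff.1 he
    rcases hγ e with h | h | h
    · exact Or.inr h
    · exact absurd h h0
    · exact Or.inl h
  have h1 : rho (γ e • σ.val e) = rho (σ.val e) := by
    rcases h with h | h <;> simp [h, ZMod.neg_eq_self_mod_two]
  rw [h1, Form1.val_eq_ind, rho_eq_ite, ind]
  by_cases h2 : e ∈ σ.supp <;> simp [h2]

lemma rho_d {N : ℕ} (σ : Form1 N) (p : PosPlaquette) :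
    rho (σ.d p) = if Odd (σ.supp ∩ bdry p).card then -1 else 1 := by
  have h := odd_inter_bdry σ.supp p.1 p.2.2.ne
  rw [← plane_surj] at h
  have hd : σ.d p = curl σ.supp p.1 p.2.1.1 p.2.1.2 := by
    simp only [d_eq, curl, Form1.val_eq_ind, CharTwo.sub_eq_add]
  rw [rho_eq_ite, hd]
  exact if_congr h.symm rfl rfl

lemma sum_supp {N : ℕ} (f : Finset PosEdge → ℝ) :
    ∑ σ : Form1 N, f σ.supp = ∑ A ∈ (boxEdges N).powerset, f A := by
  refine Finset.sum_bij' (fun σ _ => σ.supp) (fun A _ e => ind A e.1) ?_ ?_ ?_ ?_ ?_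
  · exact fun σ _ => Finset.mem_powerset.2 (Finset.filter_subset _ _)
  · exact fun A _ => Finset.mem_univ _
  · intro σ _
    funext e
    rw [← Form1.val_eq_ind, Form1.val, dif_pos e.2]
  · intro A hA
    ext e
    rw [Finset.mem_powerset] at hA
    by_cases h : e ∈ A
    · simp [Form1.supp, Form1.val, ind, h, hA h]
    · by_cases h' : e ∈ boxEdges N <;> simp [Form1.supp, Form1.val, ind, h, h']
  · exact fun σ _ => rfl

/-! ### The Boltzmann weights -/

lemma wilsonSum_eq {N : ℕ} (σ : Form1 N) :
    wilsonSum σ = ∑ p ∈ boxPlaquettes N, 2 * rho (σ.d p) := by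
  refine Finset.sum_congr rfl fun p _ => ?_
  simp only [rho_units_smul, Finset.sum_const, Finset.card_univ]
  norm_num [Fintype.card_units_int]

lemma interactionSum_eq {N : ℕ} (σ : Form1 N) (φ : Form0 N) :
    interactionSum σ φ = ∑ e ∈ boxEdges N, 2 * rho ((σ - φ.grad).val e) := by
  refine Finset.sum_congr rfl fun e he => ?_
  have h : ∀ s : ℤˣ, rho (covariantEval σ φ (Finsupp.single e (s : ℤ))) =
      rho ((σ - φ.grad).val e) := by
    intro s
    rw [covariantEval_eq, Form1.eval_eq, Finsupp.linearCombination_single, rho_units_smul]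
    exact Finsupp.support_single_subset.trans (Finset.singleton_subset_iff.2 he)
  simp only [h, Finset.sum_const, Finset.card_univ]
  norm_num [Fintype.card_units_int]

lemma exp_mul_sum {ι : Type*} (I : Finset ι) (p : ι → Prop) [DecidablePred p] {f : ι → ℝ}
    (hf : ∀ i ∈ I, f i = if p i then -1 else 1) (b : ℝ) :
    Real.exp (b * ∑ i ∈ I, 2 * f i) =
      Real.exp (2 * b) ^ I.card * Real.exp (-4 * b) ^ (I.filter p).card := by
  rw [Finset.mul_sum, Real.exp_sum, ← Finset.prod_const, ← Finset.prod_const, Finset.prod_filter,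
    ← Finset.prod_mul_distrib]
  refine Finset.prod_congr rfl fun i hi => ?_
  rw [hf i hi]
  split_ifs
  · rw [← Real.exp_add]
    ring_nf
  · ring_nf

lemma exp_wilsonSum {N : ℕ} (β : ℝ) (σ : Form1 N) :
    Real.exp (β * wilsonSum σ) = Real.exp (2 * β) ^ (boxPlaquettes N).card *
      Real.exp (-4 * β) ^ (vort bdry (boxPlaquettes N) σ.supp).card := by
  rw [wilsonSum_eq, exp_mul_sum _ (fun p => Odd (σ.supp ∩ bdry p).card) (fun p _ => rho_d σ p)]
  rfl

lemma exp_interactionSum {N : ℕ} (κ : ℝ) (σ : Form1 N) (φ : Form0 N) :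
    Real.exp (κ * interactionSum σ φ) = Real.exp (2 * κ) ^ (boxEdges N).card *
      Real.exp (-4 * κ) ^ (σ - φ.grad).supp.card := by
  rw [interactionSum_eq, exp_mul_sum _ (fun e => (σ - φ.grad).val e ≠ 0)]
  · rfl
  · intro e _
    rcases zmod_two_eq ((σ - φ.grad).val e) with h | h <;> simp [rho, h]

lemma vort_supp_sub_grad {N : ℕ} (σ : Form1 N) (φ : Form0 N) :
    vort bdry (boxPlaquettes N) (σ - φ.grad).supp = vort bdry (boxPlaquettes N) σ.supp := by
  ext p
  rw [mem_vort, mem_vort]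
  refine and_congr_right fun hp => ?_
  have h := rho_d (σ - φ.grad) p
  rw [d_sub_grad σ φ hp, rho_d] at h
  split_ifs at h with h1 h2 h2
  · exact iff_of_true h2 h1
  · norm_num at h
  · norm_num at h
  · exact iff_of_false h2 h1

lemma weight_eq {N : ℕ} (β κ : ℝ) (z : Form1 N × Form0 N) :
    weight β κ z = (Real.exp (2 * β) ^ (boxPlaquettes N).card *
      Real.exp (2 * κ) ^ (boxEdges N).card) *
      wt bdry (boxPlaquettes N) (Real.exp (-4 * κ)) (fun _ => Real.exp (-4 * β))
        (z.1 - z.2.grad).supp := by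
  have h : -action β κ z.1 z.2 = β * wilsonSum z.1 + κ * interactionSum z.1 z.2 := by
    rw [action]; ring
  rw [weight, h, Real.exp_add, exp_wilsonSum, exp_interactionSum, wt, Finset.prod_const,
    vort_supp_sub_grad]
  ring

lemma weightInfty_eq {N : ℕ} (κ : ℝ) (z : Form1 N × Form0 N) :
    weightInfty κ z = Real.exp (2 * κ) ^ (boxEdges N).card *
      wt bdry (boxPlaquettes N) (Real.exp (-4 * κ)) (fun _ => 0) (z.1 - z.2.grad).supp := by
  have h : (∀ p ∈ boxPlaquettes N, z.1.d p = 0) ↔ vort bdry (boxPlaquettes N) z.1.supp = ∅ := by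
    rw [vort, Finset.filter_eq_empty_iff]
    refine forall₂_congr fun p hp => ?_
    have h1 := rho_d z.1 p
    rcases zmod_two_eq (z.1.d p) with h2 | h2
    · rw [h2] at h1 ⊢
      split_ifs at h1 with h3
      · norm_num [rho] at h1
      · simpa using h3
    · rw [h2] at h1 ⊢
      split_ifs at h1 with h3
      · simp [h3]
      · norm_num [rho] at h1
  rw [weightInfty, wt, vort_supp_sub_grad]
  split_ifs with h1
  · rw [h.1 h1, Finset.prod_empty, exp_interactionSum, mul_one]
  · rw [h, ← Finset.not_nonempty_iff_eq_empty, not_not] at h1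
    obtain ⟨p, hp⟩ := h1
    rw [Finset.prod_eq_zero hp rfl, mul_zero, mul_zero]

/-- In unitary gauge, the expectation of a gauge invariant observable is an average over sets of
edges. -/
lemma gibbsExpectation_eq {N : ℕ} {w f : Form1 N × Form0 N → ℝ} {c : ℝ} (hc : c ≠ 0)
    {W F : Finset PosEdge → ℝ} (hw : ∀ z, w z = c * W (z.1 - z.2.grad).supp)
    (hf : ∀ z, f z = F (z.1 - z.2.grad).supp) :
    gibbsExpectation w f = average (boxEdges N) W F := by
  have key : ∀ g : Finset PosEdge → ℝ, ∑ z : Form1 N × Form0 N, g (z.1 - z.2.grad).supp =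
      Fintype.card (Form0 N) * ∑ A ∈ (boxEdges N).powerset, g A := by
    intro g
    rw [Fintype.sum_prod_type_right]
    have h : ∀ φ : Form0 N, ∑ σ : Form1 N, g (σ - φ.grad).supp =
        ∑ A ∈ (boxEdges N).powerset, g A := by
      intro φ
      rw [← sum_supp]
      exact Equiv.sum_comp (Equiv.subRight φ.grad) fun σ => g σ.supp
    simp only [h, Finset.sum_const, Finset.card_univ, nsmul_eq_mul]
  have hcard : (Fintype.card (Form0 N) : ℝ) ≠ 0 := Nat.cast_ne_zero.2 Fintype.card_ne_zero
  simp only [gibbsExpectation, hw, hf, mul_assoc, ← Finset.mul_sum]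
  rw [mul_div_mul_left _ _ hc, key W, key fun A => W A * F A, mul_div_mul_left _ _ hcard, average]

lemma wilsonLine_eq {N : ℕ} {γ : Chain1} (hγ : ∀ e, γ e ∈ ({-1, 0, 1} : Set ℤ))
    (hN : γ.support ⊆ boxEdges N) (z : Form1 N × Form0 N) :
    wilsonLine N γ z = chi γ.support (z.1 - z.2.grad).supp := by
  rw [wilsonLine, covariantEval_eq _ _ hN, rho_eval _ hγ]

lemma wilsonExpectation_eq (β κ : ℝ) {N : ℕ} {γ : Chain1}
    (hγ : ∀ e, γ e ∈ ({-1, 0, 1} : Set ℤ)) (hN : γ.support ⊆ boxEdges N) :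
    wilsonExpectation β κ γ N =
      boxAverage (Real.exp (-4 * κ)) (Real.exp (-4 * β)) γ.support N :=
  gibbsExpectation_eq (by positivity) (weight_eq β κ) (wilsonLine_eq hγ hN)

lemma wilsonExpectationInfty_eq (κ : ℝ) {N : ℕ} {γ : Chain1}
    (hγ : ∀ e, γ e ∈ ({-1, 0, 1} : Set ℤ)) (hN : γ.support ⊆ boxEdges N) :
    wilsonExpectationInfty κ γ N = boxAverage (Real.exp (-4 * κ)) 0 γ.support N :=
  gibbsExpectation_eq (by positivity) (weightInfty_eq κ) (wilsonLine_eq hγ hN)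

/-! ### Paths along a rectangle -/

lemma boundary_apply (γ : Chain1) (v : Vertex) :
    boundary γ v = ∑ d, (γ (v - unit d, d) - γ (v, d)) := by
  rw [boundary_eq]
  induction γ using Finsupp.induction_linear with
  | zero => simp
  | add f g hf hg =>
    rw [map_add, Finsupp.add_apply, hf, hg, ← Finset.sum_add_distrib]
    refine Finset.sum_congr rfl fun d _ => ?_
    rw [Finsupp.add_apply, Finsupp.add_apply]
    ring
  | single e c =>
    obtain ⟨w, i⟩ := e
    rw [Finsupp.linearCombination_single, edgeBoundary, Finset.sum_sub_distrib,
      Finset.sum_eq_single i, Finset.sum_eq_single i]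
    · simp only [Finsupp.smul_apply, Finsupp.sub_apply, Finsupp.single_apply, Prod.mk.injEq,
        and_true, eq_sub_iff_add_eq, smul_eq_mul]
      split_ifs <;> ring
    · intro d _ hd
      rw [Finsupp.single_apply, if_neg fun h => hd (congrArg Prod.snd h).symm]
    · simp
    · intro d _ hd
      rw [Finsupp.single_apply, if_neg fun h => hd (congrArg Prod.snd h).symm]
    · simp

/-- The starting points of the edges in direction `i` of the rectangle with corner `a`. -/
def Side (a : Vertex) (i j : Fin 4) (ℓ₁ ℓ₂ : ℕ) (w : Vertex) : Prop :=
  (∀ c, c ≠ i → c ≠ j → w c = a c) ∧ a i ≤ w i ∧ w i < a i + ℓ₁ ∧ (w j = a j ∨ w j = a j + ℓ₂)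

lemma side_of_mem {a : Vertex} {i j : Fin 4} (hij : i ≠ j) {ℓ₁ ℓ₂ : ℕ} {w : Vertex} {s : ℕ}
    (hs : s < ℓ₁) (h : w = a + s • unit i ∨ w = a + s • unit i + ℓ₂ • unit j) :
    Side a i j ℓ₁ ℓ₂ w := by
  refine ⟨fun c hi hj => ?_, ?_, ?_, ?_⟩
  · rcases h with rfl | rfl <;> simp [unit_of_ne hi, unit_of_ne hj]
  · rcases h with rfl | rfl <;> simp [unit_of_ne hij]
  · rcases h with rfl | rfl <;> simp [unit_of_ne hij, hs]
  · rcases h with rfl | rfl <;> simp [unit_of_ne hij.symm]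

lemma side_of_mem_rectangleEdges {a : Vertex} {i j : Fin 4} (hij : i ≠ j) {ℓ₁ ℓ₂ : ℕ}
    {e : PosEdge} (h : e ∈ rectangleEdges a i j ℓ₁ ℓ₂) :
    (e.2 = i ∧ Side a i j ℓ₁ ℓ₂ e.1) ∨ (e.2 = j ∧ Side a j i ℓ₂ ℓ₁ e.1) := by
  rcases h with ⟨h1, s, hs, h⟩ | ⟨h1, s, hs, h⟩
  · exact Or.inl ⟨h1, side_of_mem hij hs h⟩
  · exact Or.inr ⟨h1, side_of_mem hij.symm hs h⟩

/-- The corners of a rectangle. -/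
def corners (a : Vertex) (i j : Fin 4) (ℓ₁ ℓ₂ : ℕ) : Finset Vertex :=
  {a, a + ℓ₁ • unit i, a + ℓ₂ • unit j, a + ℓ₁ • unit i + ℓ₂ • unit j}

lemma mem_corners {a v : Vertex} {i j : Fin 4} (hij : i ≠ j) {ℓ₁ ℓ₂ : ℕ}
    (h : ∀ c, c ≠ i → c ≠ j → v c = a c) (hi : v i = a i ∨ v i = a i + ℓ₁)
    (hj : v j = a j ∨ v j = a j + ℓ₂) : v ∈ corners a i j ℓ₁ ℓ₂ := by
  have key : ∀ w : Vertex, (∀ c, c ≠ i → c ≠ j → w c = a c) → v i = w i → v j = w j → v = w := by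
    intro w hw h1 h2
    funext c
    by_cases hci : c = i
    · rw [hci, h1]
    by_cases hcj : c = j
    · rw [hcj, h2]
    rw [h c hci hcj, hw c hci hcj]
  simp only [corners, Finset.mem_insert, Finset.mem_singleton]
  rcases hi with hi | hi <;> rcases hj with hj | hj
  · exact Or.inl (key _ (fun _ _ _ => rfl) hi hj)
  · refine Or.inr (Or.inr (Or.inl (key _ (fun c h1 h2 => ?_) ?_ ?_)))
    · simp [unit_of_ne h2]
    · simp [unit_of_ne hij, hi]
    · simp [hj]
  · refine Or.inr (Or.inl (key _ (fun c h1 h2 => ?_) ?_ ?_))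
    · simp [unit_of_ne h1]
    · simp [hi]
    · simp [unit_of_ne hij.symm, hj]
  · refine Or.inr (Or.inr (Or.inr (key _ (fun c h1 h2 => ?_) ?_ ?_)))
    · simp [unit_of_ne h1, unit_of_ne h2]
    · simp [unit_of_ne hij, hi]
    · simp [unit_of_ne hij.symm, hj]

/-- A chain along a rectangle goes straight ahead, except at the corners of the rectangle and
where its boundary does not vanish. -/
lemma straight_support {γ : Chain1} {a : Vertex} {i j : Fin 4} (hij : i ≠ j) {ℓ₁ ℓ₂ : ℕ}
    (hγ : (γ.support : Set PosEdge) ⊆ rectangleEdges a i j ℓ₁ ℓ₂) {X : Finset Vertex}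
    (hX : corners a i j ℓ₁ ℓ₂ ⊆ X) (hb : ∀ v ∉ X, boundary γ v = 0) :
    Straight γ.support X := by
  intro v hv d
  have hzero : ∀ e : PosEdge, e ∉ rectangleEdges a i j ℓ₁ ℓ₂ → γ e = 0 := fun e he => by
    by_contra h
    exact he (hγ (Finsupp.mem_support_iff.2 h))
  obtain ⟨k, hk⟩ : ∃ k, ∀ d, d ≠ k → γ (v - unit d, d) = 0 ∧ γ (v, d) = 0 := by
    by_contra hcon
    push Not at hcon
    have hdir : ∀ k, ∃ d, d ≠ k ∧ ∃ w, (w = v - unit d ∨ w = v) ∧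
        ((d = i ∧ Side a i j ℓ₁ ℓ₂ w) ∨ (d = j ∧ Side a j i ℓ₂ ℓ₁ w)) := by
      intro k
      obtain ⟨d, hd, h⟩ := hcon k
      refine ⟨d, hd, ?_⟩
      by_cases h1 : γ (v - unit d, d) = 0
      · exact ⟨v, Or.inr rfl, side_of_mem_rectangleEdges hij
          (hγ (Finsupp.mem_support_iff.2 (h h1)))⟩
      · exact ⟨v - unit d, Or.inl rfl, side_of_mem_rectangleEdges hij
          (hγ (Finsupp.mem_support_iff.2 h1))⟩
    have h1 : ∃ w, (w = v - unit i ∨ w = v) ∧ Side a i j ℓ₁ ℓ₂ w := by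
      obtain ⟨d, hd, w, hw, ⟨rfl, h⟩ | ⟨rfl, h⟩⟩ := hdir j
      · exact ⟨w, hw, h⟩
      · exact absurd rfl hd
    have h2 : ∃ w, (w = v - unit j ∨ w = v) ∧ Side a j i ℓ₂ ℓ₁ w := by
      obtain ⟨d, hd, w, hw, ⟨rfl, h⟩ | ⟨rfl, h⟩⟩ := hdir i
      · exact absurd rfl hd
      · exact ⟨w, hw, h⟩
    obtain ⟨w, hw, hoff, -, -, hj⟩ := h1
    obtain ⟨w', hw', -, -, -, hi⟩ := h2
    refine hv (hX (mem_corners hij (fun c hci hcj => ?_) ?_ ?_))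
    · rw [← hoff c hci hcj]
      rcases hw with rfl | rfl <;> simp [unit_of_ne hci]
    · have : w' i = v i := by rcases hw' with rfl | rfl <;> simp [unit_of_ne hij]
      rwa [this] at hi
    · have : w j = v j := by rcases hw with rfl | rfl <;> simp [unit_of_ne hij.symm]
      rwa [this] at hj
  rw [Finsupp.mem_support_iff, Finsupp.mem_support_iff]
  by_cases hd : d = k
  · subst hd
    have h := hb v hv
    rw [boundary_apply, Finset.sum_eq_single d] at h
    · rw [sub_eq_zero.1 h]
    · intro d' _ hd'
      rw [(hk d' hd').1, (hk d' hd').2, sub_zero]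
    · simp
  · rw [(hk d hd).1, (hk d hd).2]

lemma sparse_of_rectangle {Γ : Finset PosEdge} {a : Vertex} {i j : Fin 4} (hij : i ≠ j)
    {ℓ₁ ℓ₂ : ℕ} (h₁ : 2 ≤ ℓ₁) (h₂ : 2 ≤ ℓ₂)
    (hΓ : (Γ : Set PosEdge) ⊆ rectangleEdges a i j ℓ₁ ℓ₂)
    (hX : ∀ e ∈ Γ, ∀ v ∈ corners a i j ℓ₁ ℓ₂, 4 ≤ supDist e.1 v) : Sparse Γ := by
  have near : ∀ e ∈ Γ, ∀ (w : Vertex) (k : Fin 4), |e.1 k - w k| ≤ 1 →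
      Function.update e.1 k (w k) ∉ corners a i j ℓ₁ ℓ₂ := by
    intro e he w k hk hcon
    have h1 := hX e he _ hcon
    have h2 : supDist e.1 (Function.update e.1 k (w k)) ≤ 1 := by
      rw [supDist_le]
      intro c
      by_cases hc : c = k
      · subst hc; simpa using hk
      · simp [hc]
    omega
  intro e he e' he' hdist
  have hd := supDist_le.1 hdist
  rcases side_of_mem_rectangleEdges hij (hΓ he) with ⟨h1, h⟩ | ⟨h1, h⟩ <;>
    rcases side_of_mem_rectangleEdges hij (hΓ he') with ⟨h1', h'⟩ | ⟨h1', h'⟩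
  · refine ⟨h1'.trans h1.symm, fun c hc => ?_⟩
    rw [h1] at hc
    by_cases hcj : c = j
    · subst hcj
      have h3 := abs_le.1 (hd c)
      have h4 := h.2.2.2
      have h5 := h'.2.2.2
      push_cast at h3
      omega
    · rw [h.1 c hc hcj, h'.1 c hc hcj]
  · refine absurd (mem_corners hij (fun c hci hcj => ?_) ?_ ?_) (near e he e'.1 i (hd i))
    · rw [Function.update_of_ne hci, h.1 c hci hcj]
    · rw [Function.update_self]; exact h'.2.2.2
    · rw [Function.update_of_ne hij.symm]; exact h.2.2.2
  · refine absurd (mem_corners hij (fun c hci hcj => ?_) ?_ ?_) (near e he e'.1 j (hd j))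
    · rw [Function.update_of_ne hcj, h.1 c hcj hci]
    · rw [Function.update_of_ne hij]; exact h.2.2.2
    · rw [Function.update_self]; exact h'.2.2.2
  · refine ⟨h1'.trans h1.symm, fun c hc => ?_⟩
    rw [h1] at hc
    by_cases hcj : c = i
    · subst hcj
      have h3 := abs_le.1 (hd c)
      have h4 := h.2.2.2
      have h5 := h'.2.2.2
      push_cast at h3
      omega
    · rw [h.1 c hc hcj, h'.1 c hc hcj]

lemma IsPath.apply_mem {γ : Chain1} (h : IsPath γ) (e : PosEdge) : γ e ∈ ({-1, 0, 1} : Set ℤ) := by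
  rcases h with h | ⟨x₁, x₂, h⟩
  · exact h.1 e
  · exact h.1 e

/-- The exceptional points of a path along a rectangle are the corners of the rectangle and the
end points of the path. -/
lemma IsPath.exists_exceptional {γ : Chain1} (h : IsPath γ) {ℓ₁ ℓ₂ : ℕ} (h₁ : 2 ≤ ℓ₁)
    (h₂ : 2 ≤ ℓ₂) (hγ : IsAlongRectangle γ ℓ₁ ℓ₂) :
    ∃ X : Finset Vertex, X.card ≤ 6 ∧ Straight γ.support X ∧
      ∀ G ⊆ γ.support, (∀ e ∈ G, ∀ v ∈ X, 4 ≤ supDist e.1 v) → Sparse G := by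
  obtain ⟨a, i, j, hij, hrect⟩ := hγ
  obtain ⟨E, hE, hb⟩ : ∃ E : Finset Vertex, E.card ≤ 2 ∧ ∀ v ∉ E, boundary γ v = 0 := by
    rcases h with h | ⟨x₁, x₂, h⟩
    · exact ⟨∅, by simp, fun v _ => by rw [h.2]; rfl⟩
    · refine ⟨{x₁, x₂}, Finset.card_le_two, fun v hv => ?_⟩
      simp only [Finset.mem_insert, Finset.mem_singleton, not_or] at hv
      rw [h.2, Finsupp.sub_apply, Finsupp.single_eq_of_ne hv.2, Finsupp.single_eq_of_ne hv.1,
        sub_zero]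
  refine ⟨corners a i j ℓ₁ ℓ₂ ∪ E, ?_, ?_, fun G hG hGX => ?_⟩
  · refine (Finset.card_union_le _ _).trans ?_
    have : (corners a i j ℓ₁ ℓ₂).card ≤ 4 := Finset.card_le_four
    omega
  · exact straight_support hij hrect Finset.subset_union_left fun v hv =>
      hb v fun h => hv (Finset.mem_union_right _ h)
  · exact sparse_of_rectangle hij h₁ h₂ ((Finset.coe_subset.2 hG).trans hrect) fun e he v hv =>
      hGX e he v (Finset.mem_union_left _ hv)

/-! ### Sums of exponentially decaying errors along a path -/

/-- The sum of `q ^ (d - 6)` over all edges at distance `d` from a vertex, up to overcounting. -/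
noncomputable def decaySum (q : ℝ) : ℝ := ∑' n : ℕ, 4 * (2 * (n : ℝ) + 1) ^ 4 * q ^ (n - 6)

lemma summable_decay {q : ℝ} (hq : 0 < q) (hq1 : q < 1) :
    Summable fun n : ℕ => 4 * (2 * (n : ℝ) + 1) ^ 4 * q ^ (n - 6) := by
  have hq' : ‖q‖ < 1 := by rwa [Real.norm_of_nonneg hq.le]
  have h := ((summable_pow_mul_geometric_of_norm_lt_one 4 hq').mul_left 81).add
    ((summable_pow_mul_geometric_of_norm_lt_one 0 hq'))
  refine Summable.of_nonneg_of_le (fun n => by positivity) (fun n => ?_)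
    (h.mul_left (4 / q ^ 6))
  have h1 : (2 * (n : ℝ) + 1) ^ 4 ≤ 81 * (n : ℝ) ^ 4 + 1 := by
    rcases Nat.eq_zero_or_pos n with rfl | hn
    · norm_num
    · have h2 : (1 : ℝ) ≤ n := by exact_mod_cast hn
      have h3 : (2 * (n : ℝ) + 1) ^ 4 ≤ (3 * (n : ℝ)) ^ 4 :=
        pow_le_pow_left₀ (by positivity) (by linarith) 4
      calc _ ≤ (3 * (n : ℝ)) ^ 4 := h3
        _ ≤ 81 * (n : ℝ) ^ 4 + 1 := by rw [mul_pow]; norm_num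
  have h4 : q ^ (n - 6) ≤ q ^ n / q ^ 6 := by
    rw [le_div_iff₀ (by positivity), ← pow_add]
    exact pow_le_pow_of_le_one hq.le hq1.le (by omega)
  calc 4 * (2 * (n : ℝ) + 1) ^ 4 * q ^ (n - 6)
      ≤ 4 * (81 * (n : ℝ) ^ 4 + 1) * (q ^ n / q ^ 6) :=
        mul_le_mul (mul_le_mul_of_nonneg_left h1 (by norm_num)) h4 (by positivity) (by positivity)
    _ = _ := by rw [pow_zero]; ring

lemma card_filter_supDist_le (Γ : Finset PosEdge) (v : Vertex) (n : ℕ) :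
    ((Γ.filter fun e => supDist e.1 v = n).card : ℝ) ≤ 4 * (2 * (n : ℝ) + 1) ^ 4 := by
  have hsub : (Γ.filter fun e => supDist e.1 v = n) ⊆
      Finset.Icc (fun c => v c - n) (fun c => v c + n) ×ˢ Finset.univ := by
    intro e he
    have h := (Finset.mem_filter.1 he).2
    simp only [Finset.mem_product, Finset.mem_univ, and_true, Finset.mem_Icc, Pi.le_def]
    have h2 : ∀ c, -(n : ℤ) ≤ e.1 c - v c ∧ e.1 c - v c ≤ n := fun c => by
      have := abs_sub_le_supDist e.1 v c
      rw [h] at this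
      exact abs_le.1 this
    exact ⟨fun c => by have := h2 c; omega, fun c => by have := h2 c; omega⟩
  have hcard := Finset.card_le_card hsub
  rw [Finset.card_product, Pi.card_Icc, Finset.card_univ, Fintype.card_fin] at hcard
  have hc : ∀ c, (Finset.Icc (v c - n) (v c + n)).card = 2 * n + 1 := fun c => by
    rw [Int.card_Icc]; omega
  simp only [hc, Finset.prod_const, Finset.card_univ, Fintype.card_fin] at hcard
  calc _ ≤ (((2 * n + 1) ^ 4 * 4 : ℕ) : ℝ) := by exact_mod_cast hcard
    _ = _ := by push_cast; ring

lemma sum_pow_supDist_le {q : ℝ} (hq : 0 < q) (hq1 : q < 1) (Γ : Finset PosEdge) (v : Vertex) :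
    ∑ e ∈ Γ, q ^ (supDist e.1 v - 6) ≤ decaySum q := by
  have hpos : ∀ n : ℕ, 0 ≤ 4 * (2 * (n : ℝ) + 1) ^ 4 * q ^ (n - 6) := fun n => by positivity
  rw [Finset.sum_comp (fun n => q ^ (n - 6)) fun e : PosEdge => supDist e.1 v]
  have h := (summable_decay hq hq1).sum_le_tsum (Γ.image fun e => supDist e.1 v)
    fun n _ => hpos n
  rw [← decaySum] at h
  refine le_trans (Finset.sum_le_sum fun n _ => ?_) h
  rw [nsmul_eq_mul]
  exact mul_le_mul_of_nonneg_right (card_filter_supDist_le Γ v n) (pow_nonneg hq.le _)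

/-- The distance of an edge to `X`, truncated at `R`. -/
def margin (X : Finset Vertex) (R : ℕ) (e : PosEdge) : ℕ := X.fold min R fun v => supDist e.1 v

lemma le_margin {X : Finset Vertex} {R : ℕ} {e : PosEdge} {k : ℕ} :
    k ≤ margin X R e ↔ k ≤ R ∧ ∀ v ∈ X, k ≤ supDist e.1 v := Finset.le_fold_min k

lemma pow_margin_le {q : ℝ} (hq : 0 ≤ q) (X : Finset Vertex) (R : ℕ) (e : PosEdge) :
    q ^ (margin X R e - 6) ≤ q ^ (R - 6) + ∑ v ∈ X, q ^ (supDist e.1 v - 6) := by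
  unfold margin
  induction X using Finset.induction_on with
  | empty => simp
  | insert v X hv ih =>
    rw [Finset.fold_insert hv, Finset.sum_insert hv]
    rcases min_choice (supDist e.1 v) (X.fold min R fun v => supDist e.1 v) with h | h <;> rw [h]
    · have : 0 ≤ ∑ v ∈ X, q ^ (supDist e.1 v - 6) := Finset.sum_nonneg fun _ _ => by positivity
      have : 0 ≤ q ^ (R - 6) := by positivity
      linarith
    · have : 0 ≤ q ^ (supDist e.1 v - 6) := by positivity
      linarith

lemma sum_pow_margin_le {q : ℝ} (hq : 0 < q) (hq1 : q < 1) (Γ : Finset PosEdge)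
    (X : Finset Vertex) (R : ℕ) :
    ∑ e ∈ Γ, q ^ (margin X R e - 6) ≤ X.card * decaySum q + Γ.card * q ^ (R - 6) := by
  refine (Finset.sum_le_sum fun e _ => pow_margin_le hq.le X R e).trans ?_
  rw [Finset.sum_add_distrib, Finset.sum_comm, Finset.sum_const, nsmul_eq_mul, add_comm]
  gcongr
  calc _ ≤ ∑ v ∈ X, decaySum q := Finset.sum_le_sum fun v _ => sum_pow_supDist_le hq hq1 Γ v
    _ = _ := by rw [Finset.sum_const, nsmul_eq_mul]

/-! ### Comparison of finite and infinite inverse temperature -/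

lemma rate_le {x : ℝ} (hx : 0 ≤ x) (hx1 : x ≤ 1) : rate x ≤ 972 * x := by
  unfold rate
  push_cast
  nlinarith

/-- The rate at which a vortex forms around an edge that is excited with probability `p` in the
absence of vortices. -/
noncomputable def vortexRate (x y p : ℝ) : ℝ := y ^ 6 * x + y ^ 6 * (x⁻¹ - x) * p

lemma boxAverage_zero (x y : ℝ) (F : Finset PosEdge) (N : ℕ) :
    boxAverage x 0 F N = average (boxEdges N) (softWt N x y ∅) (chi F) := by
  have h : softWeight y ∅ = fun _ => 0 := funext fun p => softWeight_empty y p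
  unfold boxAverage softWt
  rw [h]

lemma exp_neg_le_sq {t w : ℝ} (hw : 0 < w) (ht : 1 ≤ t * w) : Real.exp (-2 * t) ≤ w ^ 2 := by
  have ht0 : 0 < t := by
    by_contra h
    nlinarith
  have h1 := Real.quadratic_le_exp_of_nonneg (by positivity : 0 ≤ 2 * t)
  rw [neg_mul, Real.exp_neg, inv_le_iff_one_le_mul₀ (Real.exp_pos _)]
  have h2 : t ^ 2 ≤ Real.exp (2 * t) := by nlinarith
  calc 1 ≤ (t * w) ^ 2 := one_le_pow₀ ht
    _ = w ^ 2 * t ^ 2 := by ring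
    _ ≤ w ^ 2 * Real.exp (2 * t) := by gcongr

set_option maxHeartbeats 1000000 in
/-- The comparison in a finite box, for vortices of weight `w ^ 3`. The sum over the edges of `Γ`
accounts for the exceptional points and the boundary of the box, and `δ` for the deviation of the
excitation probabilities in the box from their common infinite volume value `p`. -/
lemma abs_boxAverage_sub_le {Γ : Finset PosEdge} {X : Finset Vertex} (hΓ : Straight Γ X)
    (hsp : ∀ G ⊆ Γ, (∀ e ∈ G, ∀ v ∈ X, 4 ≤ supDist e.1 v) → Sparse G)
    {N R : ℕ} (hR : 4 ≤ R) (hN : ∀ e ∈ Γ, ∀ c, |e.1 c| + R ≤ N) {x w q : ℝ}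
    (hx : 0 < x) (hx1 : x ≤ 1) (hw : 0 < w) (hw1 : w ≤ 1) (hwx : (w ^ 3) ^ 6 ≤ x)
    (hα : rate x < 1) (hq : rate x ≤ q) (hq1 : q ≤ 1) {p δ J : ℝ} (hJ : J = 1 / (1 - rate x))
    (hp : 0 ≤ p) (hp1 : p ≤ 1) (hpα : p ≤ rate x ^ 2 * J)
    (hδ : ∀ e ∈ Γ, |average (boxEdges N) (softWt N x (w ^ 3) ∅) (edgeInd e) - p| ≤ δ) :
    |boxAverage x (w ^ 3) Γ N -
      Real.exp (-2 * vortexRate x (w ^ 3) p) ^ Γ.card * boxAverage x 0 Γ N| ≤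
    w ^ 2 * ((5 + 1944 * J + 8 * 972 ^ 2 * J) +
      (2 + 4 * 972 ^ 2 * J + 2 * J) * ∑ e ∈ Γ, q ^ (margin X R e - 6)) +
      2 * ((w ^ 3) ^ 6 * (x⁻¹ - x)) * (Γ.card * δ) := by
  set y := w ^ 3 with hy
  have hy0 : 0 < y := by positivity
  have hyw : y ≤ w ^ 2 := pow_le_pow_of_le_one hw.le hw1 (by norm_num)
  have hw2 : w ^ 2 ≤ 1 := pow_le_one₀ hw.le hw1
  have hy1 : y ≤ 1 := hyw.trans hw2
  set α := rate x with hα'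
  have hα0 : 0 ≤ α := rate_nonneg hx.le
  have hq0 : 0 ≤ q := hα0.trans hq
  have h1α : 0 < 1 - α := by linarith
  have hJ0 : 0 ≤ J := by rw [hJ]; positivity
  have hdiv : ∀ z : ℝ, z / (1 - α) = z * J := fun z => by rw [hJ]; ring
  set Δ := y ^ 6 * (x⁻¹ - x) with hΔ
  have hxinv : 1 ≤ x⁻¹ := (one_le_inv₀ hx).2 hx1
  have hΔ0 : 0 ≤ Δ := mul_nonneg (by positivity) (by linarith)
  set Q := y ^ 6 * x with hQ
  have hQ0 : 0 < Q := by positivity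
  have hQy : Q ≤ y := by
    have h1 : y ^ 6 ≤ y := pow_le_of_le_one hy0.le hy1 (by norm_num)
    calc Q ≤ y ^ 6 * 1 := by rw [hQ]; gcongr
      _ ≤ y := by rwa [mul_one]
  have hQw : Q ≤ w ^ 2 := hQy.trans hyw
  -- the factor `x⁻¹` is compensated by the smallness of `α`
  have hΔα : Δ * α ^ 2 ≤ 972 ^ 2 * Q := by
    have h1 : α ^ 2 ≤ (972 * x) ^ 2 := pow_le_pow_left₀ hα0 (rate_le hx.le hx1) 2
    have h2 : Δ ≤ y ^ 6 * x⁻¹ := by rw [hΔ]; gcongr; linarith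
    calc Δ * α ^ 2 ≤ y ^ 6 * x⁻¹ * (972 * x) ^ 2 := mul_le_mul h2 h1 (by positivity) (by positivity)
      _ = 972 ^ 2 * Q := by rw [hQ]; field_simp
  set r := vortexRate x y p with hr
  have hr' : r = Q + Δ * p := rfl
  have hrQ : Q ≤ r := by rw [hr']; linarith [mul_nonneg hΔ0 hp]
  have hr0 : 0 < r := hQ0.trans_le hrQ
  have hrle : r ≤ w ^ 2 * (1 + 972 ^ 2 * J) := by
    have h1 : Δ * p ≤ 972 ^ 2 * Q * J := by
      calc Δ * p ≤ Δ * (α ^ 2 * J) := by gcongr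
        _ = Δ * α ^ 2 * J := by ring
        _ ≤ _ := by gcongr
    calc r ≤ Q * (1 + 972 ^ 2 * J) := by rw [hr']; linarith
      _ ≤ _ := by gcongr
  set D := margin X R with hD
  have hDle : ∀ e, D e ≤ R ∧ ∀ v ∈ X, D e ≤ supDist e.1 v := fun e => le_margin.1 le_rfl
  have hclear : ∀ e ∈ Γ, Clear X N e (D e) := fun e he => ⟨(hDle e).2, fun c => by
    have h1 := hN e he c
    have h2 := (hDle e).1
    omega⟩
  set S := ∑ e ∈ Γ, q ^ (D e - 6) with hS
  have hS0 : 0 ≤ S := Finset.sum_nonneg fun e _ => pow_nonneg hq0 _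
  set G := Γ.filter fun e => ∀ v ∈ X, 4 ≤ supDist e.1 v with hG
  have hGΓ : G ⊆ Γ := Finset.filter_subset _ _
  have hGsp : Sparse G := hsp G hGΓ fun e he => (Finset.mem_filter.1 he).2
  have hGmem : ∀ e ∈ Γ, (∀ v ∈ X, 4 ≤ supDist e.1 v) → e ∈ G := fun e he h =>
    Finset.mem_filter.2 ⟨he, h⟩
  -- the edges of `Γ` near the exceptional points
  have hmiss : ((Γ \ G).card : ℝ) ≤ S := by
    calc ((Γ \ G).card : ℝ) = ∑ e ∈ Γ \ G, 1 := by simp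
      _ ≤ ∑ e ∈ Γ \ G, q ^ (D e - 6) := by
          refine Finset.sum_le_sum fun e he => ?_
          obtain ⟨h1, h2⟩ := Finset.mem_sdiff.1 he
          have h3 : ¬ ∀ v ∈ X, 4 ≤ supDist e.1 v := fun h => h2 (hGmem e h1 h)
          push Not at h3
          obtain ⟨v, hv, h4⟩ := h3
          have h5 := (hDle e).2 v hv
          have h6 : D e - 6 = 0 := by omega
          rw [h6, pow_zero]
      _ ≤ S := Finset.sum_le_sum_of_subset_of_nonneg Finset.sdiff_subset
          fun e _ _ => pow_nonneg hq0 _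
  set ℓ := Γ.card with hℓ
  set m := G.card with hm
  have hmℓ : m ≤ ℓ := Finset.card_le_card hGΓ
  have hmiss' : (ℓ : ℝ) = m + ((Γ \ G).card : ℝ) := by
    rw [← Nat.cast_add, hm, hℓ, add_comm, Finset.card_sdiff_add_card_eq_card hGΓ]
  set b := boxAverage x y Γ N with hb
  set d := boxAverage x 0 Γ N with hd
  set g := average (boxEdges N) (softWt N x y G) (chi Γ) with hg
  have hb0 : 0 ≤ b := boxAverage_nonneg hx.le hx1 hy0.le hy1 Γ N
  have hd0 : 0 ≤ d := boxAverage_nonneg hx.le hx1 le_rfl zero_le_one Γ N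
  have hd1 : d ≤ 1 := boxAverage_le_one hx.le le_rfl Γ N
  have hbg : b ≤ g := average_wt_anti _ _ hx.le hx1 (softWeight_nonneg hy0.le G)
    (softWeight_le hy0.le G) (fun _ => hy1) Γ
  have hδ0 : 0 ≤ (ℓ : ℝ) * δ := by
    rcases Γ.eq_empty_or_nonempty with h | ⟨e, he⟩
    · simp [hℓ, h]
    · exact mul_nonneg (Nat.cast_nonneg _) ((abs_nonneg _).trans (hδ e he))
  -- the soft edges
  have hsoft : |g - Real.exp (-2 * r) ^ m * d| ≤
      w ^ 2 * (4 + 8 * 972 ^ 2 * J + 2 * 972 ^ 2 * J * S) + 2 * Δ * (ℓ * δ) := by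
    have h := abs_average_softWt_sub_le hΓ (D := D) hx hx1 hy0 hy1 hwx hα hp hp1 hr' G hGΓ hGsp
      (fun e he c => by have := hN e (hGΓ he) c; omega) (fun e he => hclear e (hGΓ he))
      (fun e he => hδ e (hGΓ he))
    rw [← boxAverage_zero] at h
    refine h.trans ?_
    simp only [← hα', hdiv, ← hΔ]
    have h1 : 4 * Δ * (y * (α ^ 2 * J)) / r ≤ 4 * 972 ^ 2 * J * w ^ 2 := by
      rw [div_le_iff₀ hr0]
      calc 4 * Δ * (y * (α ^ 2 * J)) = 4 * (Δ * α ^ 2) * J * y := by ring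
        _ ≤ 4 * (972 ^ 2 * Q) * J * y := by gcongr
        _ ≤ 4 * (972 ^ 2 * r) * J * w ^ 2 := by gcongr
        _ = _ := by ring
    have h2 : Δ * ∑ e ∈ G, (α ^ (max 2 (D e - 4)) * J + δ) ≤
        972 ^ 2 * J * S * w ^ 2 + Δ * (ℓ * δ) := by
      have h3 : ∀ e ∈ Γ, 0 ≤ α ^ (max 2 (D e - 4)) * J + δ := fun e he =>
        add_nonneg (mul_nonneg (pow_nonneg hα0 _) hJ0) ((abs_nonneg _).trans (hδ e he))
      calc Δ * ∑ e ∈ G, (α ^ (max 2 (D e - 4)) * J + δ)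
          ≤ Δ * ∑ e ∈ Γ, (α ^ (max 2 (D e - 4)) * J + δ) :=
            mul_le_mul_of_nonneg_left (Finset.sum_le_sum_of_subset_of_nonneg hGΓ
              fun e he _ => h3 e he) hΔ0
        _ = ∑ e ∈ Γ, Δ * α ^ 2 * (α ^ (D e - 6) * J) + Δ * (ℓ * δ) := by
            rw [Finset.sum_add_distrib, Finset.sum_const, nsmul_eq_mul, mul_add, Finset.mul_sum]
            congr 1
            refine Finset.sum_congr rfl fun e _ => ?_
            have : max 2 (D e - 4) = 2 + (D e - 6) := by omega
            rw [this, pow_add]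
            ring
        _ ≤ ∑ e ∈ Γ, 972 ^ 2 * w ^ 2 * (q ^ (D e - 6) * J) + Δ * (ℓ * δ) := by
            refine add_le_add_left (Finset.sum_le_sum fun e _ => ?_) _
            have h4 : α ^ (D e - 6) ≤ q ^ (D e - 6) := pow_le_pow_left₀ hα0 hq _
            refine mul_le_mul (hΔα.trans ?_) (mul_le_mul_of_nonneg_right h4 hJ0)
              (mul_nonneg (pow_nonneg hα0 _) hJ0) (by positivity)
            gcongr
        _ = _ := by
            rw [← Finset.mul_sum, ← Finset.sum_mul]
            ring
    linarith
  -- the difference of the numbers of soft edges and of all edges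
  have hpow : |Real.exp (-2 * r) ^ m * d - Real.exp (-2 * r) ^ ℓ * d| ≤
      w ^ 2 * ((2 + 2 * 972 ^ 2 * J) * S) := by
    set ρ := Real.exp (-2 * r) with hρ
    have hρ0 : 0 ≤ ρ := (Real.exp_pos _).le
    have hρ1 : ρ ≤ 1 := Real.exp_le_one_iff.2 (by linarith)
    have h1 : 1 - ρ ^ (ℓ - m) ≤ 2 * r * S := by
      have h2 : (ℓ - m : ℕ) = (Γ \ G).card := by
        rw [Finset.card_sdiff_of_subset hGΓ]
      rw [h2, hρ, ← Real.exp_nat_mul]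
      have h3 := Real.add_one_le_exp ((Γ \ G).card * (-2 * r))
      have h4 : r * ((Γ \ G).card : ℝ) ≤ r * S := by gcongr
      linarith
    have h2 : ρ ^ ℓ = ρ ^ m * ρ ^ (ℓ - m) := by rw [← pow_add, Nat.add_sub_cancel' hmℓ]
    have h3 : 0 ≤ 1 - ρ ^ (ℓ - m) := sub_nonneg.2 (pow_le_one₀ hρ0 hρ1)
    have h4 : ρ ^ m * d - ρ ^ ℓ * d = ρ ^ m * d * (1 - ρ ^ (ℓ - m)) := by rw [h2]; ring
    rw [h4, abs_of_nonneg (mul_nonneg (mul_nonneg (pow_nonneg hρ0 _) hd0) h3)]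
    have h5 : ρ ^ m * d ≤ 1 := mul_le_one₀ (pow_le_one₀ hρ0 hρ1) hd0 hd1
    calc ρ ^ m * d * (1 - ρ ^ (ℓ - m)) ≤ 1 - ρ ^ (ℓ - m) := mul_le_of_le_one_left h3 h5
      _ ≤ 2 * r * S := h1
      _ ≤ 2 * (w ^ 2 * (1 + 972 ^ 2 * J)) * S := by gcongr
      _ = _ := by ring
  have hww : 0 ≤ w ^ 2 := pow_nonneg hw.le 2
  have hJS0 : 0 ≤ J * S := mul_nonneg hJ0 hS0
  have hJS : 0 ≤ w ^ 2 * (2 * J * S) := mul_nonneg hww (by linarith)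
  have hJw : 0 ≤ w ^ 2 * (1944 * J) := mul_nonneg hww (by linarith)
  have hrest : 0 ≤ w ^ 2 * (4 + 8 * 972 ^ 2 * J + 2 * 972 ^ 2 * J * S) :=
    mul_nonneg hww (by linarith)
  have hrest' : 0 ≤ w ^ 2 * ((2 + 2 * 972 ^ 2 * J) * S) := mul_nonneg hww (by linarith)
  have hΔδ : 0 ≤ 2 * Δ * (ℓ * δ) := mul_nonneg (mul_nonneg zero_le_two hΔ0) hδ0
  have hcombine : |g - Real.exp (-2 * r) ^ ℓ * d| ≤
      w ^ 2 * (4 + 8 * 972 ^ 2 * J + 2 * 972 ^ 2 * J * S) + 2 * Δ * (ℓ * δ) +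
        w ^ 2 * ((2 + 2 * 972 ^ 2 * J) * S) :=
    (abs_sub_le _ (Real.exp (-2 * r) ^ m * d) _).trans (add_le_add hsoft hpow)
  have hgoal : w ^ 2 * ((5 + 1944 * J + 8 * 972 ^ 2 * J) +
      (2 + 4 * 972 ^ 2 * J + 2 * J) * S) + 2 * Δ * (ℓ * δ) =
      (w ^ 2 * (4 + 8 * 972 ^ 2 * J + 2 * 972 ^ 2 * J * S) + 2 * Δ * (ℓ * δ) +
        w ^ 2 * ((2 + 2 * 972 ^ 2 * J) * S)) + (w ^ 2 * (1944 * J) + w ^ 2 * (2 * J * S)) +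
        w ^ 2 := by ring
  rw [hgoal]
  rcases le_or_gt (ℓ * Q * w) 1 with hshort | hlong
  · -- a short path: vortices off `G` are rare, so that only those around `G` count
    have hcmp := abs_average_sub_softWt_le hΓ hGmem (N := N) (D := D) hclear hx.le hy0.le hy1 hα
    have h1 : 2 * ∑ e ∈ Γ, (y ^ 7 * (α ^ 1 / (1 - α)) + y * (α ^ (D e - 4) / (1 - α))) ≤
        w ^ 2 * (1944 * J) + w ^ 2 * (2 * J * S) := by
      have h2 : y ^ 7 * α * ℓ ≤ 972 * w ^ 2 := by
        calc y ^ 7 * α * ℓ ≤ y ^ 7 * (972 * x) * ℓ :=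
              mul_le_mul_of_nonneg_right (mul_le_mul_of_nonneg_left (rate_le hx.le hx1)
                (pow_nonneg hy0.le 7)) (Nat.cast_nonneg _)
          _ = 972 * w ^ 2 * (ℓ * Q * w) := by rw [hQ, hy]; ring
          _ ≤ 972 * w ^ 2 * 1 := mul_le_mul_of_nonneg_left hshort (by positivity)
          _ = _ := mul_one _
      have h3 : ∑ e ∈ Γ, α ^ (D e - 4) ≤ S := Finset.sum_le_sum fun e _ =>
        (pow_le_pow_left₀ hα0 hq _).trans (pow_le_pow_of_le_one hq0 hq1 (by omega))
      simp only [hdiv, pow_one]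
      rw [Finset.sum_add_distrib, Finset.sum_const, nsmul_eq_mul, ← Finset.mul_sum,
        ← Finset.sum_mul]
      calc 2 * (ℓ * (y ^ 7 * (α * J)) + y * ((∑ e ∈ Γ, α ^ (D e - 4)) * J))
          = 2 * J * (y ^ 7 * α * ℓ) + 2 * J * (y * ∑ e ∈ Γ, α ^ (D e - 4)) := by ring
        _ ≤ 2 * J * (972 * w ^ 2) + 2 * J * (w ^ 2 * S) := by gcongr
        _ = _ := by ring
    have h2 : |b - g| ≤ w ^ 2 * (1944 * J) + w ^ 2 * (2 * J * S) := hcmp.trans h1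
    refine (abs_sub_le b g _).trans ?_
    linarith
  · -- a long path: `b ≤ g`, and both `g` and its approximation are small
    have h1 : Real.exp (-2 * r) ^ ℓ ≤ w ^ 2 := by
      rw [← Real.exp_nat_mul]
      refine le_trans (Real.exp_le_exp.2 ?_) (exp_neg_le_sq (t := ℓ * Q) hw hlong.le)
      have : (ℓ : ℝ) * Q ≤ ℓ * r := mul_le_mul_of_nonneg_left hrQ (Nat.cast_nonneg _)
      linarith
    have h2 : 0 ≤ Real.exp (-2 * r) ^ ℓ * d := mul_nonneg (pow_nonneg (Real.exp_pos _).le _) hd0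
    have h3 : Real.exp (-2 * r) ^ ℓ * d ≤ w ^ 2 :=
      (mul_le_of_le_one_right (pow_nonneg (Real.exp_pos _).le _) hd1).trans h1
    have h4 := abs_le.1 hcombine
    rw [abs_le]
    constructor <;> linarith

/-! ### The infinite volume limit -/

lemma eventually_subset_boxEdges (F : Finset PosEdge) : ∀ᶠ N in atTop, F ⊆ boxEdges N := by
  obtain ⟨N₀, hN₀⟩ := exists_subset_boxEdges F 1
  filter_upwards [eventually_ge_atTop N₀] with N hN e he
  exact mem_boxEdges_of_abs_le (hN₀ N hN e he)

lemma exp_neg_four_mul_le_one {κ : ℝ} (hκ : 0 ≤ κ) : Real.exp (-4 * κ) ≤ 1 :=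
  Real.exp_le_one_iff.2 (by linarith)

lemma tendsto_wilsonExpectation {β κ : ℝ} (hβ : 0 ≤ β) (hκ : 0 ≤ κ) {γ : Chain1}
    (hγ : ∀ e, γ e ∈ ({-1, 0, 1} : Set ℤ)) :
    Tendsto (wilsonExpectation β κ γ) atTop (𝓝 (wilsonLimit β κ γ)) ∧
      Tendsto (boxAverage (Real.exp (-4 * κ)) (Real.exp (-4 * β)) γ.support) atTop
        (𝓝 (wilsonLimit β κ γ)) := by
  obtain ⟨l, hl⟩ := exists_tendsto_boxAverage (Real.exp_pos (-4 * κ)).le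
    (exp_neg_four_mul_le_one hκ) (Real.exp_pos (-4 * β)).le (exp_neg_four_mul_le_one hβ) γ.support
  have h : Tendsto (wilsonExpectation β κ γ) atTop (𝓝 l) := hl.congr' <| by
    filter_upwards [eventually_subset_boxEdges γ.support] with N hN
    exact (wilsonExpectation_eq β κ hγ hN).symm
  rw [wilsonLimit, h.limUnder_eq]
  exact ⟨h, hl⟩

lemma tendsto_wilsonExpectationInfty {κ : ℝ} (hκ : 0 ≤ κ) {γ : Chain1}
    (hγ : ∀ e, γ e ∈ ({-1, 0, 1} : Set ℤ)) :
    Tendsto (wilsonExpectationInfty κ γ) atTop (𝓝 (wilsonLimitInfty κ γ)) ∧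
      Tendsto (boxAverage (Real.exp (-4 * κ)) 0 γ.support) atTop
        (𝓝 (wilsonLimitInfty κ γ)) := by
  obtain ⟨l, hl⟩ := exists_tendsto_boxAverage (Real.exp_pos (-4 * κ)).le
    (exp_neg_four_mul_le_one hκ) le_rfl zero_le_one γ.support
  have h : Tendsto (wilsonExpectationInfty κ γ) atTop (𝓝 l) := hl.congr' <| by
    filter_upwards [eventually_subset_boxEdges γ.support] with N hN
    exact (wilsonExpectationInfty_eq κ hγ hN).symm
  rw [wilsonLimitInfty, h.limUnder_eq]
  exact ⟨h, hl⟩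

lemma single_apply_mem (e e' : PosEdge) (s : ℤˣ) :
    Finsupp.single e (s : ℤ) e' ∈ ({-1, 0, 1} : Set ℤ) := by
  rw [Finsupp.single_apply]
  rcases Int.units_eq_one_or s with rfl | rfl <;> split_ifs <;> simp

lemma support_single_units (e : PosEdge) (s : ℤˣ) :
    (Finsupp.single e (s : ℤ)).support = {e} :=
  Finsupp.support_single e s.ne_zero

/-- The probability of `L_e = -1` in terms of the expectation of `L_e`. -/
lemma average_edgeInd_eq {N : ℕ} {x : ℝ} (hx : 0 ≤ x) (y : ℝ) (e : PosEdge) :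
    average (boxEdges N) (softWt N x y ∅) (edgeInd e) = (1 - boxAverage x 0 {e} N) / 2 := by
  have hw : softWt N x y ∅ = wt bdry (boxPlaquettes N) x fun _ => 0 := by
    unfold softWt
    rw [funext fun p => softWeight_empty y p]
  have hZ : 0 < ∑ A ∈ (boxEdges N).powerset, wt bdry (boxPlaquettes N) x (fun _ => 0) A :=
    sum_wt_pos (boxEdges N) hx fun _ => le_rfl
  have hF : edgeInd e = fun A => 1 / 2 * 1 + -(1 / 2) * chi {e} A := by
    funext A
    by_cases h : e ∈ A
    · rw [edgeInd, if_pos h, chi, Finset.inter_singleton_of_mem h]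
      norm_num
    · rw [edgeInd, if_neg h, chi, Finset.inter_singleton_of_notMem h]
      norm_num
  rw [hw, hF, average_add, average_const_mul, average_const_mul, average_one hZ, boxAverage]
  ring

/-- The constant in front of the error, apart from its decay. -/
noncomputable def errorConstant (a : ℝ) : ℝ :=
  (5 + 1944 * (1 / (1 - a)) + 8 * 972 ^ 2 * (1 / (1 - a))) +
    (2 + 4 * 972 ^ 2 * (1 / (1 - a)) + 2 * (1 / (1 - a))) * (6 * decaySum (max a (1 / 2)))

lemma decaySum_nonneg {q : ℝ} (hq : 0 ≤ q) : 0 ≤ decaySum q :=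
  tsum_nonneg fun n => by positivity

/-- The estimate in infinite volume. -/
lemma abs_limit_sub_le {Γ : Finset PosEdge} {X : Finset Vertex} (hΓ : Straight Γ X)
    (hX : X.card ≤ 6)
    (hsp : ∀ G ⊆ Γ, (∀ e ∈ G, ∀ v ∈ X, 4 ≤ supDist e.1 v) → Sparse G) {x w : ℝ}
    (hx : 0 < x) (hx1 : x ≤ 1) (hw : 0 < w) (hw1 : w ≤ 1) (hwx : (w ^ 3) ^ 6 ≤ x)
    (hα : rate x < 1) {b d l : ℝ} {e₀ : PosEdge}
    (hb : Tendsto (boxAverage x (w ^ 3) Γ) atTop (𝓝 b))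
    (hd : Tendsto (boxAverage x 0 Γ) atTop (𝓝 d))
    (hl : Tendsto (boxAverage x 0 {e₀}) atTop (𝓝 l)) :
    |b - Real.exp (-2 * vortexRate x (w ^ 3) ((1 - l) / 2)) ^ Γ.card * d| ≤
      w ^ 2 * errorConstant (rate x) := by
  have hprob : ∀ e, Tendsto
      (fun N => average (boxEdges N) (softWt N x (w ^ 3) ∅) (edgeInd e)) atTop
      (𝓝 ((1 - l) / 2)) := by
    intro e
    simp only [average_edgeInd_eq hx.le]
    obtain ⟨l', hl'⟩ := exists_tendsto_boxAverage hx.le hx1 le_rfl zero_le_one {e}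
    have : l' = l := le_antisymm (limit_edge_le hx.le hx1 le_rfl zero_le_one hl' hl)
      (limit_edge_le hx.le hx1 le_rfl zero_le_one hl hl')
    rw [this] at hl'
    exact (hl'.const_sub 1).div_const 2
  set p := (1 - l) / 2 with hp
  set q := max (rate x) (1 / 2) with hq
  have hq0 : 0 < q := lt_max_of_lt_right (by norm_num)
  have hq1 : q < 1 := max_lt hα (by norm_num)
  have hl1 : l ≤ 1 := le_of_tendsto hl
    (Eventually.of_forall fun N => boxAverage_le_one hx.le le_rfl _ N)
  have hl0 : 0 ≤ l := ge_of_tendsto hl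
    (Eventually.of_forall fun N => boxAverage_nonneg hx.le hx1 le_rfl zero_le_one _ N)
  have hp0 : 0 ≤ p := by rw [hp]; linarith
  have hp1 : p ≤ 1 := by rw [hp]; linarith
  set J := 1 / (1 - rate x) with hJ
  have hJ0 : 0 ≤ J := by
    have : 0 < 1 - rate x := by linarith
    positivity
  have hpα : p ≤ rate x ^ 2 * J := by
    refine le_of_tendsto (hprob e₀) ?_
    obtain ⟨N₀, hN₀⟩ := exists_subset_boxEdges {e₀} 4
    filter_upwards [eventually_ge_atTop N₀] with N hN
    have := average_edgeInd_le (hN₀ N hN e₀ (Finset.mem_singleton_self _)) hx.le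
      (pow_nonneg hw.le 3) hα
    rwa [hJ, mul_one_div]
  set δ : ℕ → ℝ := fun N => ∑ e ∈ Γ,
    |average (boxEdges N) (softWt N x (w ^ 3) ∅) (edgeInd e) - p| with hδ
  have hδ0 : Tendsto δ atTop (𝓝 0) := by
    have h : ∀ e ∈ Γ, Tendsto (fun N =>
        |average (boxEdges N) (softWt N x (w ^ 3) ∅) (edgeInd e) - p|) atTop (𝓝 0) := by
      intro e _
      have := ((hprob e).sub_const p).abs
      rwa [sub_self, abs_zero] at this
    have h2 := tendsto_finsetSum Γ h
    rwa [Finset.sum_const_zero] at h2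
  obtain ⟨N₁, hN₁⟩ := exists_subset_boxEdges Γ 0
  set C := 2 + 4 * 972 ^ 2 * J + 2 * J with hC
  have hC0 : 0 ≤ C := by rw [hC]; positivity
  set ρ := Real.exp (-2 * vortexRate x (w ^ 3) p) ^ Γ.card with hρ
  have hbound : ∀ᶠ N in atTop, |boxAverage x (w ^ 3) Γ N - ρ * boxAverage x 0 Γ N| ≤
      w ^ 2 * ((5 + 1944 * J + 8 * 972 ^ 2 * J) +
        C * (6 * decaySum q + Γ.card * q ^ (N - (N₁ + 6)))) +
      2 * ((w ^ 3) ^ 6 * (x⁻¹ - x)) * (Γ.card * δ N) := by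
    filter_upwards [eventually_ge_atTop (N₁ + 4)] with N hN
    have h1 := abs_boxAverage_sub_le hΓ hsp (N := N) (R := N - N₁) (by omega) (fun e he c => by
      have := hN₁ N₁ le_rfl e he c
      omega) hx hx1 hw hw1 hwx hα (le_max_left _ _) hq1.le hJ hp0 hp1 hpα (δ := δ N)
      (fun e he => Finset.single_le_sum
        (f := fun e => |average (boxEdges N) (softWt N x (w ^ 3) ∅) (edgeInd e) - p|)
        (fun _ _ => abs_nonneg _) he)
    refine h1.trans ?_
    have h2 := sum_pow_margin_le hq0 hq1 Γ X (N - N₁)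
    have h3 : (X.card : ℝ) * decaySum q ≤ 6 * decaySum q :=
      mul_le_mul_of_nonneg_right (by exact_mod_cast hX) (decaySum_nonneg hq0.le)
    have h4 : N - N₁ - 6 = N - (N₁ + 6) := by omega
    rw [h4] at h2
    have h5 := mul_le_mul_of_nonneg_left (h2.trans (add_le_add_left h3 _)) hC0
    have h6 := mul_le_mul_of_nonneg_left h5 (pow_nonneg hw.le 2)
    linarith
  have hlim := ((hb.sub (hd.const_mul ρ)).abs)
  have hqlim : Tendsto (fun N : ℕ => q ^ (N - (N₁ + 6))) atTop (𝓝 0) :=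
    (tendsto_pow_atTop_nhds_zero_of_lt_one hq0.le hq1).comp (tendsto_sub_atTop_nat _)
  have hright := ((((hqlim.const_mul (Γ.card : ℝ)).const_add (6 * decaySum q)).const_mul
    C).const_add (5 + 1944 * J + 8 * 972 ^ 2 * J)).const_mul (w ^ 2)
  have hright' := hright.add ((hδ0.const_mul (Γ.card : ℝ)).const_mul
    (2 * ((w ^ 3) ^ 6 * (x⁻¹ - x))))
  refine (le_of_tendsto_of_tendsto hlim hright' hbound).trans_eq ?_
  rw [errorConstant, ← hJ, ← hq, ← hC]
  ring

/-- The function of `κ` that bounds the error. -/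
noncomputable def errorBound (κ : ℝ) : ℝ :=
  |errorConstant (rate (Real.exp (-4 * κ)))| * Real.exp (-κ / 9)

lemma errorBound_nonneg (κ : ℝ) : 0 ≤ errorBound κ := by
  unfold errorBound; positivity

lemma tendsto_errorBound : Tendsto errorBound atTop (𝓝 0) := by
  have hx : Tendsto (fun κ : ℝ => Real.exp (-4 * κ)) atTop (𝓝 0) :=
    Real.tendsto_exp_atBot.comp (tendsto_id.const_mul_atTop_of_neg (by norm_num))
  have hrate : Tendsto (fun κ : ℝ => rate (Real.exp (-4 * κ))) atTop (𝓝 0) := by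
    have h := ((hx.const_mul 2).add (hx.pow 2)).const_mul (((18 : ℕ) : ℝ) ^ 2)
    simpa [rate] using h
  have hdecay : Tendsto (fun κ : ℝ => Real.exp (-κ / 9)) atTop (𝓝 0) := by
    have : Tendsto (fun κ : ℝ => -κ / 9) atTop atBot :=
      (tendsto_neg_atTop_atBot).atBot_div_const (by norm_num)
    exact Real.tendsto_exp_atBot.comp this
  have hconst : Tendsto (fun κ : ℝ => |errorConstant (rate (Real.exp (-4 * κ)))|) atTop
      (𝓝 |(5 + 1944 * (1 / (1 - 0)) + 8 * 972 ^ 2 * (1 / (1 - 0))) +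
        (2 + 4 * 972 ^ 2 * (1 / (1 - 0)) + 2 * (1 / (1 - 0))) * (6 * decaySum (1 / 2))|) := by
    have hJ : Tendsto (fun κ : ℝ => 1 / (1 - rate (Real.exp (-4 * κ)))) atTop
        (𝓝 (1 / (1 - 0))) := tendsto_const_nhds.div (hrate.const_sub 1) (by norm_num)
    have h := (((hJ.const_mul 1944).const_add 5).add (hJ.const_mul (8 * 972 ^ 2))).add
      ((((hJ.const_mul (4 * 972 ^ 2)).const_add 2).add (hJ.const_mul 2)).mul_const
        (6 * decaySum (1 / 2)))
    refine (h.congr' ?_).abs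
    filter_upwards [hrate.eventually_lt_const (by norm_num : (0 : ℝ) < 1 / 2)] with κ hκ
    rw [errorConstant, max_eq_right hκ.le]
  have := hconst.mul hdecay
  rwa [mul_zero] at this

lemma Theta'_eq (β κ : ℝ) (γ : Chain1) (e : Chain1) :
    Theta' β κ γ e = Real.exp (-2 * vortexRate (Real.exp (-4 * κ)) (Real.exp (-4 * β))
      ((1 - wilsonLimitInfty κ e) / 2)) ^ γ.support.card := by
  have h1 : Real.exp (-4 * β) ^ 6 = Real.exp (-24 * β) := by
    rw [← Real.exp_nat_mul]; congr 1; push_cast; ring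
  have h2 : Real.exp (-24 * β - 4 * κ) = Real.exp (-24 * β) * Real.exp (-4 * κ) := by
    rw [← Real.exp_add]; congr 1; ring
  have h3 : (Real.exp (-4 * κ))⁻¹ = Real.exp (-4 * κ) * Real.exp (8 * κ) := by
    rw [← Real.exp_neg, ← Real.exp_add]; congr 1; ring
  rw [Theta', ← Real.exp_nat_mul, vortexRate, h1, h2, h3]
  congr 1
  ring

lemma exp_le_mul_rpow {β κ : ℝ} (h : κ < 6 * β) {t : ℝ} (ht : 0 ≤ t) :
    Real.exp (-4 * β / 3) ^ 2 ≤
      Real.exp (-κ / 9) * (Real.exp (-4 * (β + κ / 6)) + t) ^ (1 / 4 : ℝ) := by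
  have h1 : Real.exp (-(β + κ / 6)) ≤ (Real.exp (-4 * (β + κ / 6)) + t) ^ (1 / 4 : ℝ) := by
    calc Real.exp (-(β + κ / 6)) = Real.exp (-4 * (β + κ / 6)) ^ (1 / 4 : ℝ) := by
          rw [← Real.exp_mul]; congr 1; ring
      _ ≤ _ := Real.rpow_le_rpow (Real.exp_pos _).le (by linarith) (by norm_num)
  calc Real.exp (-4 * β / 3) ^ 2 = Real.exp (-8 * β / 3) := by
        rw [← Real.exp_nat_mul]; congr 1; push_cast; ring
    _ ≤ Real.exp (-κ / 9 + -(β + κ / 6)) := Real.exp_le_exp.2 (by linarith)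
    _ = Real.exp (-κ / 9) * Real.exp (-(β + κ / 6)) := Real.exp_add _ _
    _ ≤ _ := by gcongr

end LatticeHiggs

theorem theorem1p1 :
    ∃ (K : (κ β : ℝ) → (ℓ₁ ℓ₂ : ℕ) → (γ : Chain1) → ℝ) (o : ℝ → ℝ),
      Tendsto o atTop (𝓝 0) ∧
      (∀ κ β ℓ₁ ℓ₂ γ, 0 ≤ K κ β ℓ₁ ℓ₂ γ) ∧
      ∀ (β κ : ℝ), 0 ≤ β → 0 ≤ κ →
        18 ^ 2 * Real.exp (-4 * κ) * (2 + Real.exp (-4 * κ)) < 1 →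
        κ < 6 * β →
        ∀ (ℓ₁ ℓ₂ : ℕ), 8 ≤ ℓ₁ → 8 ≤ ℓ₂ →
        ∀ γ : Chain1, IsPath γ → IsAlongRectangle γ ℓ₁ ℓ₂ → 24 ≤ γ.support.card →
          K κ β ℓ₁ ℓ₂ γ ≤
            2 * 18 ^ 3
              + (γ.support.card : ℝ) ^ (1 / 2 : ℝ) *
                (18 ^ 2 * Real.exp (-4 * κ) * (2 + Real.exp (-4 * κ))) ^ (min ℓ₁ ℓ₂)
              + o κ ∧
          -- the infinite volume limits exist
          Tendsto (wilsonExpectation β κ γ) atTop (𝓝 (wilsonLimit β κ γ)) ∧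
          Tendsto (wilsonExpectationInfty κ γ) atTop (𝓝 (wilsonLimitInfty κ γ)) ∧
          ∀ (e : PosEdge) (s : ℤˣ),
            Tendsto (wilsonExpectationInfty κ (Finsupp.single e (s : ℤ))) atTop
              (𝓝 (wilsonLimitInfty κ (Finsupp.single e (s : ℤ)))) ∧
            |wilsonLimit β κ γ - Theta' β κ γ (Finsupp.single e (s : ℤ)) * H κ γ| ≤
              K κ β ℓ₁ ℓ₂ γ *
                (Real.exp (-4 * (β + κ / 6)) + (γ.support.card : ℝ) ^ (-(1 / 2) : ℝ))
                  ^ (1 / 4 : ℝ) := by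
  -- the error is already controlled by a function of `κ` alone
  refine ⟨fun κ _ _ _ _ => errorBound κ, errorBound, tendsto_errorBound,
    fun κ _ _ _ _ => errorBound_nonneg κ, ?_⟩
  intro β κ hβ hκ hα hβκ ℓ₁ ℓ₂ hℓ₁ hℓ₂ γ hγ hrect _
  have hrate : rate (Real.exp (-4 * κ)) =
      18 ^ 2 * Real.exp (-4 * κ) * (2 + Real.exp (-4 * κ)) := by
    unfold rate
    push_cast
    ring
  obtain ⟨X, hX, hstraight, hsparse⟩ := hγ.exists_exceptional (by omega) (by omega) hrect
  obtain ⟨hlim, hb⟩ := tendsto_wilsonExpectation hβ hκ hγ.apply_mem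
  obtain ⟨hlim', hd⟩ := tendsto_wilsonExpectationInfty hκ hγ.apply_mem
  refine ⟨?_, hlim, hlim', fun e s => ?_⟩
  · have : (0 : ℝ) ≤ 2 * 18 ^ 3 + (γ.support.card : ℝ) ^ (1 / 2 : ℝ) *
        (18 ^ 2 * Real.exp (-4 * κ) * (2 + Real.exp (-4 * κ))) ^ (min ℓ₁ ℓ₂) := by positivity
    linarith
  · obtain ⟨hlim_e, hl⟩ := tendsto_wilsonExpectationInfty hκ (single_apply_mem e · s)
    refine ⟨hlim_e, ?_⟩
    rw [support_single_units] at hl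
    have hw3 : Real.exp (-4 * β / 3) ^ 3 = Real.exp (-4 * β) := by
      rw [← Real.exp_nat_mul]
      congr 1
      push_cast
      ring
    rw [← hw3] at hb
    have h := abs_limit_sub_le hstraight hX hsparse (Real.exp_pos (-4 * κ))
      (exp_neg_four_mul_le_one hκ) (Real.exp_pos (-4 * β / 3))
      (Real.exp_le_one_iff.2 (by linarith)) (by
        rw [hw3, ← Real.exp_nat_mul]
        exact Real.exp_le_exp.2 (by push_cast; linarith)) (hrate ▸ hα) hb hd hl
    rw [hw3, ← Theta'_eq] at h
    refine h.trans ?_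
    have hle := exp_le_mul_rpow hβκ (t := (γ.support.card : ℝ) ^ (-(1 / 2) : ℝ)) (by positivity)
    calc _ ≤ Real.exp (-4 * β / 3) ^ 2 * |errorConstant (rate (Real.exp (-4 * κ)))| := by
          gcongr
          exact le_abs_self _
      _ ≤ _ := mul_le_mul_of_nonneg_right hle (abs_nonneg _)
      _ = _ := by simp only [errorBound]; ring
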